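/- Let $a>0$, $b,c\in\mathbb{R}$ with $c\neq 0$, $\theta_1,\theta_2\in[0,2\pi)$, and $\mathcal{H}=L^2(0,1)$ (real-valued functions, norm $\|\cdot\|$). On $H^2(0,1)$ let $\mathcal{A}f=af''+bf$ and $$\mathcal{B}f=\big(\cos(\theta_1)f(0)-\sin(\theta_1)f'(0),\ \cos(\theta_2)f(1)+\sin(\theta_2)f'(1)\big)\in\mathbb{R}^2 .$$ The restriction $\mathcal{A}_0$ of $\mathcal{A}$ to $H^2(0,1)\cap\ker\mathcal{B}$ generates a $C_0$-semigroup $S(t)$ on $\mathcal{H}$, and the eigenvalues of $\mathcal{A}_0+cI$ form a strictly decreasing sequence $(\lambda_n)_{n\ge1}$; let $e_n$ be a unit eigenvector associated with $\lambda_n$. Let $k\ge 2$ be an integer with $\cos\theta_m+k\sin\theta_m\neq0$ for $m=1,2$, and for $v=(v_1,v_2)\in\mathbb{R}^2$ let $$[L_kv](x)=\frac{v_1(1-x)^k}{\cos\theta_1+k\sin\theta_1}+\frac{v_2x^k}{\cos\theta_2+k\sin\theta_2},\qquad x\in[0,1].$$ Given $N_0\ge1$ and $K\in\mathbb{R}^{2\times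 N_0}$, a mild solution of the closed-loop delayed reaction–diffusion system $$\dot X(t)=\mathcal{A}X(t)+cX(t-h(t))+p(t),\qquad \mathcal{B}X(t)=u(t),\qquad X(\tau)=\Phi(\tau)\ \ (\tau\in[-h_M,0]),$$ with $u=KY$, $Y(t)=(\langle X(t),e_1\rangle,\dots,\langle X(t),e_{N_0}\rangle)^\top$, is a function $X$ on $[-h_M,\infty)$ with $X\in C^0(\mathbb{R}_+;\mathcal{H})$, $X=\Phi$ on $[-h_M,0]$, with $u=KY$ absolutely continuous on every compact interval of $\mathbb{R}_+$, such that for all $t\ge0$ $$X(t)=S(t)\{\Phi(0)-L_ku(0)\}+L_ku(t)+\int_0^tS(t-s)\{\mathcal{A}L_ku(s)-L_k\dot u(s)+cX(s-h(s))+p(s)\}\,ds .$$ Let $0<h_m<h_M$ and $\kappa>0$ be arbitrary. Then there exist $N_0\ge1$, $K\in\mathbb{R}^{2\times N_0}$ and constants $C_0,C_1>0$ such that for every $\Phi\in C^0([-h_M,0];\mathcal{H})$, every $p\in L^\infty_{\mathrm{loc}}(\mathbb{R}_+;\mathcal{H})$ and every $h\in C^0(\mathbb{R}_+;\mathbb{R})$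 with $h_m\le h\le h_M$, the closed-loop system has a unique mild solution $X$, and for all $t\ge0$ $$\|X(t)\|\le C_0e^{-\kappa t}\sup_{\tau\in[-h_M,0]}\|\Phi(\tau)\|+C_1\operatorname*{ess\,sup}_{\tau\in[0,t]}e^{-\kappa(t-\tau)}\|p(\tau)\|,$$ $$\|u(t)\|\le C_0\|K\|e^{-\kappa t}\sup_{\tau\in[-h_M,0]}\|\Phi(\tau)\|+C_1\|K\|\operatorname*{ess\,sup}_{\tau\in[0,t]}e^{-\kappa(t-\tau)}\|p(\tau)\|,$$ where $\mathbb{R}^2$ carries the Euclidean norm and $\|K\|$ is the norm induced by the Euclidean norms. -/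

import Mathlib

open MeasureTheory Set Filter Topology

namespace DelayRD

/-- The state space `L²(0,1)` of real-valued functions. -/
abbrev H : Type := Lp ℝ 2 (volume.restrict (Ioo (0 : ℝ) 1))

/-- The control space `ℝ²` with its Euclidean norm. -/
abbrev U : Type := EuclideanSpace ℝ (Fin 2)

/-- `f ∈ L²(0,1)` belongs to `H²(0,1)`, with continuous representative `φ`, absolutely continuous
derivative `φ'` (both on `[0,1]`), and second derivative `f'' = w ∈ L²(0,1)`. -/
def IsH2Rep (f : H) (φ φ' : ℝ → ℝ) (w : H) : Prop :=
  (f =ᵐ[volume.restrict (Ioo (0 : ℝ) 1)] φ) ∧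
  (∀ x ∈ Icc (0 : ℝ) 1, φ x = φ 0 + ∫ ξ in (0 : ℝ)..x, φ' ξ) ∧
  (∀ x ∈ Icc (0 : ℝ) 1, φ' x = φ' 0 + ∫ ξ in (0 : ℝ)..x, w ξ)

/-- The Sobolev space `H²(0,1)`. -/
def MemH2 (f : H) : Prop := ∃ φ φ' w, IsH2Rep f φ φ' w

/-- The data `(f, f', f'')` of a function of `H²(0,1)`: on `[0,1]` the first two components, and as
an element of `L²(0,1)` the third, are determined by `f`. Arbitrary value outside `H²(0,1)`. -/
noncomputable def h2Data (f : H) : (ℝ → ℝ) × (ℝ → ℝ) × H :=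
  Classical.epsilon fun q => IsH2Rep f q.1 q.2.1 q.2.2

theorem h2Data_spec {f : H} (hf : MemH2 f) :
    IsH2Rep f (h2Data f).1 (h2Data f).2.1 (h2Data f).2.2 := by
  obtain ⟨φ, φ', w, h⟩ := hf
  exact Classical.epsilon_spec (p := fun q : (ℝ → ℝ) × (ℝ → ℝ) × H => IsH2Rep f q.1 q.2.1 q.2.2)
    ⟨(φ, φ', w), h⟩

/-- The operator `𝒜 f = a f'' + b f` on `D(𝒜) = H²(0,1)`. -/
noncomputable def opA (a b : ℝ) (f : H) : H := a • (h2Data f).2.2 + b • f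

/-- The Robin boundary operator `ℬ f` on `D(ℬ) = H²(0,1)`. -/
noncomputable def opB (θ₁ θ₂ : ℝ) (f : H) : U :=
  !₂[Real.cos θ₁ * (h2Data f).1 0 - Real.sin θ₁ * (h2Data f).2.1 0,
     Real.cos θ₂ * (h2Data f).1 1 + Real.sin θ₂ * (h2Data f).2.1 1]

/-- The domain `D(𝒜₀) = D(𝒜) ∩ ker ℬ` of the disturbance-free operator `𝒜₀`. -/
def domA₀ (θ₁ θ₂ : ℝ) : Set H := {f | MemH2 f ∧ opB θ₁ θ₂ f = 0}

/-- `S` (on `t ≥ 0`) is a `C₀`-semigroup of bounded operators on `L²(0,1)`. -/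
structure IsC0Semigroup (S : ℝ → H →L[ℝ] H) : Prop where
  zero : S 0 = ContinuousLinearMap.id ℝ H
  add : ∀ s t : ℝ, 0 ≤ s → 0 ≤ t → S (s + t) = (S s).comp (S t)
  strongly_continuous : ∀ x : H, Tendsto (fun t => S t x) (𝓝[>] 0) (𝓝 x)

/-- `𝒜₀` is the infinitesimal generator of the `C₀`-semigroup `S`, domains included. -/
def IsGeneratedByA₀ (a b θ₁ θ₂ : ℝ) (S : ℝ → H →L[ℝ] H) : Prop :=
  IsC0Semigroup S ∧
  ∀ f g : H, Tendsto (fun t : ℝ => t⁻¹ • (S t f - f)) (𝓝[>] 0) (𝓝 g) ↔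
    (f ∈ domA₀ θ₁ θ₂ ∧ g = opA a b f)

/-- `lam` is the strictly decreasing enumeration of all the eigenvalues of `𝒜₀ + c I`, and `e n` is a
unit eigenvector for `lam n`. Indexing starts at `0`: `lam n` and `e n` are `λ_{n+1}` and `e_{n+1}`. -/
structure IsEigensystem (a b c θ₁ θ₂ : ℝ) (lam : ℕ → ℝ) (e : ℕ → H) : Prop where
  strictAnti : StrictAnti lam
  mem_dom : ∀ n, e n ∈ domA₀ θ₁ θ₂
  norm_eq_one : ∀ n, ‖e n‖ = 1
  eigen : ∀ n, opA a b (e n) + c • e n = lam n • e n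
  exhaustive : ∀ (μ : ℝ) (f : H), f ∈ domA₀ θ₁ θ₂ → f ≠ 0 →
    opA a b f + c • f = μ • f → ∃ n, μ = lam n

/-- The function `L_k u` on `[0,1]`. -/
noncomputable def liftFun (θ₁ θ₂ : ℝ) (k : ℕ) (u : U) (x : ℝ) : ℝ :=
  u 0 * (1 - x) ^ k / (Real.cos θ₁ + k * Real.sin θ₁) +
    u 1 * x ^ k / (Real.cos θ₂ + k * Real.sin θ₂)

theorem memLp_liftFun (θ₁ θ₂ : ℝ) (k : ℕ) (u : U) :
    MemLp (liftFun θ₁ θ₂ k u) 2 (volume.restrict (Ioo (0 : ℝ) 1)) := by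
  have hc : Continuous (liftFun θ₁ θ₂ k u) := by unfold liftFun; fun_prop
  refine MemLp.of_bound (C := |u 0| / |Real.cos θ₁ + k * Real.sin θ₁| +
    |u 1| / |Real.cos θ₂ + k * Real.sin θ₂|) hc.aestronglyMeasurable ?_
  filter_upwards [ae_restrict_mem measurableSet_Ioo] with x hx
  have h1 : |(1 - x) ^ k| ≤ 1 := by
    rw [abs_pow]
    exact pow_le_one₀ (abs_nonneg _) (abs_le.2 ⟨by linarith [hx.2], by linarith [hx.1]⟩)
  have h2 : |x ^ k| ≤ 1 := by
    rw [abs_pow]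
    exact pow_le_one₀ (abs_nonneg _) (abs_le.2 ⟨by linarith [hx.1], hx.2.le⟩)
  refine (abs_add_le _ _).trans (add_le_add ?_ ?_)
  · rw [abs_div, abs_mul]
    gcongr
    exact mul_le_of_le_one_right (abs_nonneg _) h1
  · rw [abs_div, abs_mul]
    gcongr
    exact mul_le_of_le_one_right (abs_nonneg _) h2

/-- The lifting operator `L_k : ℝ² → L²(0,1)`. -/
noncomputable def lift (θ₁ θ₂ : ℝ) (k : ℕ) (u : U) : H := (memLp_liftFun θ₁ θ₂ k u).toLp _

/-- The vector `Y = (⟨x, e_1⟩, …, ⟨x, e_{N₀}⟩) ∈ ℝ^{N₀}` of the first `N₀` modes of `x`. -/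
noncomputable def modes (e : ℕ → H) (N₀ : ℕ) (x : H) : EuclideanSpace ℝ (Fin N₀) :=
  WithLp.toLp 2 fun i => inner ℝ x (e i)

/-- The feedback `t ↦ K Y(t)`. -/
noncomputable def feedback (e : ℕ → H) {N₀ : ℕ} (K : Matrix (Fin 2) (Fin N₀) ℝ) (X : ℝ → H)
    (t : ℝ) : U :=
  Matrix.toEuclideanLin K (modes e N₀ (X t))

/-- The matrix norm induced by the Euclidean norms. -/
noncomputable def matNorm {N₀ : ℕ} (K : Matrix (Fin 2) (Fin N₀) ℝ) : ℝ :=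
  ‖LinearMap.toContinuousLinearMap (Matrix.toEuclideanLin K)‖

/-- `p ∈ L^∞_loc(ℝ₊; L²(0,1))`. -/
def MemLinftyLoc (p : ℝ → H) : Prop :=
  ∀ T : ℝ, 0 ≤ T → MemLp p ⊤ (volume.restrict (Icc 0 T))

/-- `X ∈ C⁰(ℝ₊; L²(0,1))` is a mild solution of
`X'(t) = 𝒜 X(t) + c X(t - h(t)) + p(t)`, `ℬ X(t) = u(t)`, `X = Φ` on `[-h_M, 0]`,
for an input `u ∈ AC_loc(ℝ₊; ℝ²)`; `S` is the semigroup generated by `𝒜₀`. -/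
structure IsMildSolution (a b c θ₁ θ₂ : ℝ) (k : ℕ) (S : ℝ → H →L[ℝ] H) (hM : ℝ) (Φ p : ℝ → H)
    (h : ℝ → ℝ) (u : ℝ → U) (X : ℝ → H) : Prop where
  continuousOn : ContinuousOn X (Ici 0)
  ac_input : ∀ T : ℝ, 0 ≤ T → AbsolutelyContinuousOnInterval u 0 T
  initial : ∀ τ ∈ Icc (-hM) 0, X τ = Φ τ
  duhamel : ∀ t : ℝ, 0 ≤ t →
    X t = S t (Φ 0 - lift θ₁ θ₂ k (u 0)) + lift θ₁ θ₂ k (u t) +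
      ∫ s in (0 : ℝ)..t, S (t - s) (opA a b (lift θ₁ θ₂ k (u s)) - lift θ₁ θ₂ k (deriv u s)
        + c • X (s - h s) + p s)

/-- The right-hand side
`C₀ e^{-κt} sup_{τ ∈ [-h_M,0]} ‖Φ(τ)‖ + C₁ ess sup_{τ ∈ [0,t]} e^{-κ(t-τ)} ‖p(τ)‖`
of the fading-memory estimate. -/
noncomputable def fadingBound (hM κ C₀ C₁ : ℝ) (Φ p : ℝ → H) (t : ℝ) : ℝ :=
  C₀ * Real.exp (-κ * t) * (⨆ τ : Icc (-hM) 0, ‖Φ τ‖) +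
    C₁ * essSup (fun τ => Real.exp (-κ * (t - τ)) * ‖p τ‖) (volume.restrict (Icc 0 t))

end DelayRD

open DelayRD

/-!
The resolvent of `𝒜₀`, given by an explicit Green function, is compact and self-adjoint, so `𝒜₀ + c`
is diagonal in an orthonormal basis `e`, with eigenvalues decreasing to `-∞`. Subtracting the lift
of the input turns the boundary control into a forcing term. A scalar control `q` applied through
the first channel enters the mode `n` as `x_n' = r_n x_n + β_n q + …`, where `r_n = λ_n - c`. By
Green's formula `β_n` is a nonzero multiple of the Cauchy datum at `0` of the eigenfunction, hence
nonzero.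

Given `σ`, choose `N` such that `r_n ≤ -σ` for `n ≥ N - 1`. Choose `N` poles `μ_j` below `-σ` and
off the spectrum, and place them by a feedback on the first `N` modes. The vectors `v_j` of
coordinates `β_n / (μ_j - r_n)` are then eigenvectors of the whole closed loop, not only of its
first `N` modes. Replacing `e_0, …, e_{N-1}` by them is a finite rank perturbation `R` of the
identity, invertible because a Cauchy matrix is, and in the coordinates `ξ = R⁻¹ X` the closed loop
without delay is diagonal with all rates at most `-σ`.

The delay term commutes with `R`, so the closed loop becomes `ξ' = D ξ + c ξ(t - h) + R⁻¹ p` with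
`D` diagonal. It is solved step by step because `h ≥ h_m > 0`, and a Gronwall type estimate on the
maximum of `e^{κ t} ‖ξ t‖` gives the decay at the rate `κ`, once `σ - κ` is large compared to
`|c| e^{κ h_M}`.
-/

namespace DelayRD

/-! ### Primitives of integrable functions -/

theorem absolutelyContinuousOnInterval_congr {X : Type*} [PseudoMetricSpace X] {f g : ℝ → X}
    {a b : ℝ} (hf : AbsolutelyContinuousOnInterval f a b) (hfg : EqOn f g (uIcc a b)) :
    AbsolutelyContinuousOnInterval g a b := by
  rw [absolutelyContinuousOnInterval_iff] at hf ⊢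
  intro ε hε
  obtain ⟨δ, hδ, hsum⟩ := hf ε hε
  refine ⟨δ, hδ, fun E hE hlen => ?_⟩
  convert hsum E hE hlen using 2 with i hi
  rw [hfg (hE.1 i hi).1, hfg (hE.1 i hi).2]

/-- `F` is a primitive, on the interval with endpoints `a` and `b`, of the integrable function `q`.
This is the form in which the absolutely continuous functions of the problem are handled: the
derivative is a datum, determined only almost everywhere. -/
structure IsPrimitiveOn (F q : ℝ → ℝ) (a b : ℝ) : Prop where
  intervalIntegrable : IntervalIntegrable q volume a b
  eq_add_integral : ∀ x ∈ uIcc a b, F x = F a + ∫ ξ in a..x, q ξ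

namespace IsPrimitiveOn

variable {F G q r : ℝ → ℝ} {a b : ℝ}

theorem mono (hF : IsPrimitiveOn F q a b) {x : ℝ} (hx : x ∈ uIcc a b) : IsPrimitiveOn F q a x :=
  ⟨hF.intervalIntegrable.mono_set (uIcc_subset_uIcc_left hx),
    fun y hy => hF.eq_add_integral y (uIcc_subset_uIcc_left hx hy)⟩

theorem absolutelyContinuousOnInterval (hF : IsPrimitiveOn F q a b) :
    AbsolutelyContinuousOnInterval F a b := by
  have hint := hF.intervalIntegrable.absolutelyContinuousOnInterval_intervalIntegral
    (c := a) left_mem_uIcc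
  have hconst : AbsolutelyContinuousOnInterval (fun _ : ℝ => F a) a b :=
    (LipschitzWith.const (F a)).lipschitzOnWith.absolutelyContinuousOnInterval
  exact absolutelyContinuousOnInterval_congr (hconst.add hint)
    fun x hx => (hF.eq_add_integral x hx).symm

theorem continuousOn (hF : IsPrimitiveOn F q a b) : ContinuousOn F (uIcc a b) :=
  hF.absolutelyContinuousOnInterval.continuousOn

theorem ae_hasDerivAt (hF : IsPrimitiveOn F q a b) :
    ∀ᵐ x, x ∈ uIoc a b → HasDerivAt F (q x) x := by
  filter_upwards [hF.intervalIntegrable.ae_hasDerivAt_integral,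
    compl_mem_ae_iff.2 (measure_singleton (max a b))] with x hderiv hne hx
  have hx' : x ∈ Ioo (min a b) (max a b) := ⟨hx.1, lt_of_le_of_ne hx.2 hne⟩
  refine ((hderiv (Ioo_subset_Icc_self hx') a left_mem_uIcc).const_add
    (F a)).congr_of_eventuallyEq ?_
  filter_upwards [Ioo_mem_nhds hx'.1 hx'.2] with y hy
  exact hF.eq_add_integral y (Ioo_subset_Icc_self hy)

theorem of_absolutelyContinuousOnInterval (hF : AbsolutelyContinuousOnInterval F a b) :
    IsPrimitiveOn F (deriv F) a b := by
  refine ⟨hF.intervalIntegrable_deriv, fun x hx => ?_⟩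
  rw [(hF.mono (uIcc_subset_uIcc_left hx)).integral_deriv_eq_sub]
  ring

theorem congr_left (hF : IsPrimitiveOn F q a b) (h : EqOn F G (uIcc a b)) :
    IsPrimitiveOn G q a b := by
  refine ⟨hF.intervalIntegrable, fun x hx => ?_⟩
  rw [← h hx, hF.eq_add_integral x hx, h left_mem_uIcc]

theorem congr_right (hF : IsPrimitiveOn F q a b) (h : ∀ᵐ x, x ∈ uIoc a b → q x = r x) :
    IsPrimitiveOn F r a b := by
  refine ⟨hF.intervalIntegrable.congr_ae ((ae_restrict_iff' measurableSet_uIoc).2 h),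
    fun x hx => ?_⟩
  rw [hF.eq_add_integral x hx]
  congr 1
  refine intervalIntegral.integral_congr_ae ?_
  filter_upwards [h] with y hy hyx
  exact hy (uIoc_subset_uIoc_of_uIcc_subset_uIcc (uIcc_subset_uIcc_left hx) hyx)

theorem of_ae_hasDerivAt (hF : AbsolutelyContinuousOnInterval F a b)
    (h : ∀ᵐ x, x ∈ uIoc a b → HasDerivAt F (q x) x) : IsPrimitiveOn F q a b := by
  refine (of_absolutelyContinuousOnInterval hF).congr_right ?_
  filter_upwards [h] with x hderiv hx
  exact (hderiv hx).deriv

theorem mul (hF : IsPrimitiveOn F q a b) (hG : IsPrimitiveOn G r a b) :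
    IsPrimitiveOn (fun x => F x * G x) (fun x => q x * G x + F x * r x) a b := by
  refine of_ae_hasDerivAt
    (hF.absolutelyContinuousOnInterval.mul hG.absolutelyContinuousOnInterval) ?_
  filter_upwards [hF.ae_hasDerivAt, hG.ae_hasDerivAt] with x hFx hGx hx
  exact (hFx hx).mul (hGx hx)

theorem add (hF : IsPrimitiveOn F q a b) (hG : IsPrimitiveOn G r a b) :
    IsPrimitiveOn (fun x => F x + G x) (fun x => q x + r x) a b := by
  refine of_ae_hasDerivAt
    (hF.absolutelyContinuousOnInterval.add hG.absolutelyContinuousOnInterval) ?_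
  filter_upwards [hF.ae_hasDerivAt, hG.ae_hasDerivAt] with x hFx hGx hx
  exact (hFx hx).add (hGx hx)

theorem const_mul (hF : IsPrimitiveOn F q a b) (s : ℝ) :
    IsPrimitiveOn (fun x => s * F x) (fun x => s * q x) a b := by
  refine of_ae_hasDerivAt (hF.absolutelyContinuousOnInterval.const_mul s) ?_
  filter_upwards [hF.ae_hasDerivAt] with x hFx hx
  exact (hFx hx).const_mul s

theorem add_iff (hG : IsPrimitiveOn G r a b) :
    IsPrimitiveOn (fun x => F x + G x) (fun x => q x + r x) a b ↔ IsPrimitiveOn F q a b := by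
  refine ⟨fun h => ?_, fun h => h.add hG⟩
  simpa using h.add (hG.const_mul (-1))

theorem of_hasDerivAt (h : ∀ x, HasDerivAt F (q x) x) (hq : Continuous q) :
    IsPrimitiveOn F q a b := by
  refine ⟨hq.intervalIntegrable _ _, fun x _ => ?_⟩
  rw [intervalIntegral.integral_eq_sub_of_hasDerivAt (fun y _ => h y) (hq.intervalIntegrable _ _)]
  ring

theorem sum {ι : Type*} {F q : ι → ℝ → ℝ} (s : Finset ι)
    (h : ∀ i ∈ s, IsPrimitiveOn (F i) (q i) a b) :
    IsPrimitiveOn (fun x => ∑ i ∈ s, F i x) (fun x => ∑ i ∈ s, q i x) a b := by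
  classical
  induction s using Finset.induction_on with
  | empty =>
    simp only [Finset.sum_empty]
    exact of_hasDerivAt (fun x => hasDerivAt_const x 0) continuous_const
  | insert i s hi ih =>
    simp only [Finset.sum_insert hi]
    exact (h i (Finset.mem_insert_self i s)).add
      (ih fun j hj => h j (Finset.mem_insert_of_mem hj))

theorem integral (hq : IntervalIntegrable q volume a b) :
    IsPrimitiveOn (fun x => ∫ ξ in a..x, q ξ) q a b :=
  ⟨hq, fun x _ => by simp⟩

theorem hasDerivWithinAt_Ici (hF : IsPrimitiveOn F q a b) (hq : ContinuousOn q (Icc a b)) {x : ℝ}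
    (hx : x ∈ Ico a b) : HasDerivWithinAt F (q x) (Ici x) x := by
  have hsub : Ioo x b ⊆ Icc a b := fun y hy => ⟨hx.1.trans hy.1.le, hy.2.le⟩
  have hIcc : Icc a b ⊆ uIcc a b := Icc_subset_uIcc
  have hqx : ContinuousWithinAt q (Ioi x) x :=
    (hq x (Ico_subset_Icc_self hx)).mono_of_mem_nhdsWithin
      (mem_of_superset (Ioo_mem_nhdsGT hx.2) hsub)
  have hmeas : StronglyMeasurableAtFilter q (𝓝[>] x) :=
    ⟨Ioo x b, Ioo_mem_nhdsGT hx.2, (hq.mono hsub).aestronglyMeasurable measurableSet_Ioo⟩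
  have hderiv := intervalIntegral.integral_hasDerivWithinAt_right
    (hF.mono (hIcc (Ico_subset_Icc_self hx))).intervalIntegrable hmeas hqx (s := Ici x)
  refine (hderiv.const_add (F a)).congr_of_eventuallyEq ?_
    (hF.eq_add_integral x (hIcc (Ico_subset_Icc_self hx)))
  filter_upwards [Ico_mem_nhdsGE hx.2] with y hy
  exact hF.eq_add_integral y (hIcc ⟨hx.1.trans hy.1, hy.2.le⟩)

theorem ae_eq_of_eqOn (hF : IsPrimitiveOn F q a b) (hG : IsPrimitiveOn G r a b)
    (h : EqOn F G (uIcc a b)) : ∀ᵐ x, x ∈ uIoc a b → q x = r x := by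
  filter_upwards [hF.ae_hasDerivAt, (hG.congr_left h.symm).ae_hasDerivAt] with x hFx hGx hx
  exact (hFx hx).unique (hGx hx)

theorem lipschitzOnWith (hF : IsPrimitiveOn F q a b) {C : NNReal}
    (hq : ∀ x ∈ uIcc a b, |q x| ≤ C) : LipschitzOnWith C F (uIcc a b) := by
  refine LipschitzOnWith.of_dist_le_mul fun x hx y hy => ?_
  have hint : ∀ z ∈ uIcc a b, IntervalIntegrable q volume a z :=
    fun z hz => (hF.mono hz).intervalIntegrable
  have hsub : F x - F y = ∫ ξ in y..x, q ξ := by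
    rw [hF.eq_add_integral x hx, hF.eq_add_integral y hy, add_sub_add_left_eq_sub,
      intervalIntegral.integral_interval_sub_left (hint x hx) (hint y hy)]
  rw [Real.dist_eq, Real.dist_eq, hsub, ← Real.norm_eq_abs]
  refine intervalIntegral.norm_integral_le_of_norm_le_const fun ξ hξ => ?_
  exact hq ξ (uIcc_subset_uIcc hy hx (uIoc_subset_uIcc hξ))

end IsPrimitiveOn

/-! ### The spaces `L²(0,1)` and `H²(0,1)` -/

theorem uIcc_zero_one : uIcc (0 : ℝ) 1 = Icc 0 1 := uIcc_of_le zero_le_one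

theorem ae_restrict_Ioo_iff {P : ℝ → Prop} :
    (∀ᵐ x ∂(volume.restrict (Ioo (0 : ℝ) 1)), P x) ↔ ∀ᵐ x, x ∈ uIoc (0 : ℝ) 1 → P x := by
  rw [uIoc_of_le zero_le_one, ← ae_restrict_iff' measurableSet_Ioc,
    restrict_Ioo_eq_restrict_Ioc]

instance : IsProbabilityMeasure (volume.restrict (Ioo (0 : ℝ) 1)) := ⟨by simp⟩

theorem integral_Ioo_eq_intervalIntegral (f : ℝ → ℝ) :
    ∫ x in Ioo (0 : ℝ) 1, f x = ∫ x in (0 : ℝ)..1, f x := by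
  rw [intervalIntegral.integral_of_le zero_le_one, integral_Ioc_eq_integral_Ioo]

theorem intervalIntegrable_coe (f : H) : IntervalIntegrable f volume 0 1 := by
  rw [intervalIntegrable_iff_integrableOn_Ioo_of_le zero_le_one]
  exact (Lp.memLp f).integrable (by norm_num)

theorem integral_abs_le_norm (f : H) : ∫ x in (0 : ℝ)..1, |f x| ≤ ‖f‖ := by
  have hmono : eLpNorm f 1 (volume.restrict (Ioo (0 : ℝ) 1)) ≤
      eLpNorm f 2 (volume.restrict (Ioo (0 : ℝ) 1)) :=
    eLpNorm_le_eLpNorm_of_exponent_le (by norm_num) (Lp.aestronglyMeasurable f)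
  calc ∫ x in (0 : ℝ)..1, |f x| = (eLpNorm f 1 (volume.restrict (Ioo (0 : ℝ) 1))).toReal := by
        rw [eLpNorm_one_eq_lintegral_enorm, ← integral_Ioo_eq_intervalIntegral,
          ← integral_norm_eq_lintegral_enorm (Lp.aestronglyMeasurable f)]
        rfl
    _ ≤ ‖f‖ := ENNReal.toReal_mono (Lp.eLpNorm_ne_top f) hmono

theorem abs_integral_mul_le {y : ℝ → ℝ} {M : ℝ} (hM : ∀ x ∈ Icc (0 : ℝ) 1, |y x| ≤ M) (f : H)
    {s t : ℝ} (hs : 0 ≤ s) (hst : s ≤ t) (ht : t ≤ 1) : |∫ x in s..t, y x * f x| ≤ M * ‖f‖ := by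
  have hM0 : 0 ≤ M := (abs_nonneg _).trans (hM 0 (left_mem_Icc.2 zero_le_one))
  have hint : IntervalIntegrable (fun x => M * |f x|) volume 0 1 :=
    (intervalIntegrable_coe f).abs.const_mul M
  calc |∫ x in s..t, y x * f x| ≤ ∫ x in s..t, M * |f x| := by
        rw [← Real.norm_eq_abs]
        refine intervalIntegral.norm_integral_le_of_norm_le hst (ae_of_all _ fun x hx => ?_)
          (hint.mono_set ?_)
        · rw [norm_mul, Real.norm_eq_abs, Real.norm_eq_abs]
          gcongr
          exact hM x ⟨hs.trans hx.1.le, hx.2.trans ht⟩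
        · rw [uIcc_of_le hst, uIcc_zero_one]
          exact Icc_subset_Icc hs ht
    _ ≤ ∫ x in (0 : ℝ)..1, M * |f x| :=
        intervalIntegral.integral_mono_interval hs hst ht
          (ae_of_all _ fun x => mul_nonneg hM0 (abs_nonneg _)) hint
    _ ≤ M * ‖f‖ := by
        rw [intervalIntegral.integral_const_mul]
        exact mul_le_mul_of_nonneg_left (integral_abs_le_norm f) hM0

theorem norm_le_of_ae_eq {f : H} {φ : ℝ → ℝ} (h : f =ᵐ[volume.restrict (Ioo (0 : ℝ) 1)] φ) {C : ℝ}
    (hC : 0 ≤ C) (hφ : ∀ x ∈ Icc (0 : ℝ) 1, |φ x| ≤ C) : ‖f‖ ≤ C := by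
  have hbound : ∀ᵐ x ∂(volume.restrict (Ioo (0 : ℝ) 1)), ‖f x‖ ≤ C := by
    filter_upwards [h, ae_restrict_mem measurableSet_Ioo] with x hx hxI
    rw [hx]
    exact hφ x (Ioo_subset_Icc_self hxI)
  simpa [measureUnivNNReal] using Lp.norm_le_of_ae_bound hC hbound

theorem memLp_of_continuousOn {φ : ℝ → ℝ} (h : ContinuousOn φ (Icc 0 1)) :
    MemLp φ 2 (volume.restrict (Ioo (0 : ℝ) 1)) := by
  obtain ⟨C, hC⟩ := isCompact_Icc.exists_bound_of_continuousOn h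
  refine MemLp.of_bound (C := C)
    ((h.mono Ioo_subset_Icc_self).aestronglyMeasurable measurableSet_Ioo) ?_
  filter_upwards [ae_restrict_mem measurableSet_Ioo] with x hx
  exact hC x (Ioo_subset_Icc_self hx)

theorem isH2Rep_iff {f : H} {φ φ' : ℝ → ℝ} {w : H} :
    IsH2Rep f φ φ' w ↔ f =ᵐ[volume.restrict (Ioo (0 : ℝ) 1)] φ ∧ IsPrimitiveOn φ φ' 0 1 ∧
      IsPrimitiveOn φ' w 0 1 := by
  refine ⟨fun ⟨hf, hφ, hφ'⟩ => ?_, fun ⟨hf, hφ, hφ'⟩ => ⟨hf, ?_, ?_⟩⟩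
  · have hw : IsPrimitiveOn φ' w 0 1 := ⟨intervalIntegrable_coe w, by rwa [uIcc_zero_one]⟩
    exact ⟨hf, ⟨hw.continuousOn.intervalIntegrable, by rwa [uIcc_zero_one]⟩, hw⟩
  · exact uIcc_zero_one ▸ hφ.eq_add_integral
  · exact uIcc_zero_one ▸ hφ'.eq_add_integral

theorem isH2Rep_of_hasDerivAt {f w : H} {φ φ' φ'' : ℝ → ℝ} (h : ∀ x, HasDerivAt φ (φ' x) x)
    (h' : ∀ x, HasDerivAt φ' (φ'' x) x) (hφ'' : Continuous φ'')
    (hf : f =ᵐ[volume.restrict (Ioo (0 : ℝ) 1)] φ)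
    (hw : w =ᵐ[volume.restrict (Ioo (0 : ℝ) 1)] φ'') : IsH2Rep f φ φ' w := by
  have hφ' : Continuous φ' := continuous_iff_continuousAt.2 fun x => (h' x).continuousAt
  exact isH2Rep_iff.2 ⟨hf, .of_hasDerivAt h hφ',
    (IsPrimitiveOn.of_hasDerivAt h' hφ'').congr_right (ae_restrict_Ioo_iff.1 hw.symm)⟩

namespace IsH2Rep

variable {f g w v : H} {φ φ' ψ ψ' : ℝ → ℝ}

theorem unique (h : IsH2Rep f φ φ' w) (h' : IsH2Rep f ψ ψ' v) :
    EqOn φ ψ (Icc 0 1) ∧ EqOn φ' ψ' (Icc 0 1) ∧ w = v := by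
  obtain ⟨hfφ, hφ, hφ'⟩ := isH2Rep_iff.1 h
  obtain ⟨hfψ, hψ, hψ'⟩ := isH2Rep_iff.1 h'
  have eqOn_of_ae : ∀ {F G : ℝ → ℝ}, ContinuousOn F (uIcc 0 1) → ContinuousOn G (uIcc 0 1) →
      F =ᵐ[volume.restrict (Ioo (0 : ℝ) 1)] G → EqOn F G (Icc 0 1) := fun hF hG hFG => by
    rw [uIcc_zero_one] at hF hG
    rw [restrict_Ioo_eq_restrict_Icc] at hFG
    exact Measure.eqOn_Icc_of_ae_eq volume zero_ne_one hFG hF hG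
  have heq : EqOn φ ψ (Icc 0 1) :=
    eqOn_of_ae hφ.continuousOn hψ.continuousOn (hfφ.symm.trans hfψ)
  have heq' : EqOn φ' ψ' (Icc 0 1) :=
    eqOn_of_ae hφ'.continuousOn hψ'.continuousOn
      (ae_restrict_Ioo_iff.2 (hφ.ae_eq_of_eqOn hψ (uIcc_zero_one ▸ heq)))
  exact ⟨heq, heq', Lp.ext (ae_restrict_Ioo_iff.2 (hφ'.ae_eq_of_eqOn hψ' (uIcc_zero_one ▸ heq')))⟩

theorem add (h : IsH2Rep f φ φ' w) (h' : IsH2Rep g ψ ψ' v) :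
    IsH2Rep (f + g) (fun x => φ x + ψ x) (fun x => φ' x + ψ' x) (w + v) := by
  obtain ⟨hf, hφ, hφ'⟩ := isH2Rep_iff.1 h
  obtain ⟨hg, hψ, hψ'⟩ := isH2Rep_iff.1 h'
  exact isH2Rep_iff.2 ⟨(Lp.coeFn_add f g).trans (hf.add hg), hφ.add hψ,
    (hφ'.add hψ').congr_right (ae_restrict_Ioo_iff.1 (Lp.coeFn_add w v).symm)⟩

theorem smul (h : IsH2Rep f φ φ' w) (s : ℝ) :
    IsH2Rep (s • f) (fun x => s * φ x) (fun x => s * φ' x) (s • w) := by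
  obtain ⟨hf, hφ, hφ'⟩ := isH2Rep_iff.1 h
  exact isH2Rep_iff.2 ⟨(Lp.coeFn_smul s f).trans (hf.const_smul s), hφ.const_mul s,
    (hφ'.const_mul s).congr_right (ae_restrict_Ioo_iff.1 (Lp.coeFn_smul s w).symm)⟩

theorem green_formula (h : IsH2Rep f φ φ' w) (h' : IsH2Rep g ψ ψ' v) :
    inner ℝ w g - inner ℝ f v = (φ' 1 * ψ 1 - φ 1 * ψ' 1) - (φ' 0 * ψ 0 - φ 0 * ψ' 0) := by
  obtain ⟨hf, hφ, hφ'⟩ := isH2Rep_iff.1 h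
  obtain ⟨hg, hψ, hψ'⟩ := isH2Rep_iff.1 h'
  have hprim : IsPrimitiveOn (fun x => φ' x * ψ x + -1 * (φ x * ψ' x))
      (fun x => inner ℝ (w x) (g x) - inner ℝ (f x) (v x)) 0 1 := by
    refine ((hφ'.mul hψ).add ((hφ.mul hψ').const_mul (-1))).congr_right ?_
    filter_upwards [ae_restrict_Ioo_iff.1 hf, ae_restrict_Ioo_iff.1 hg] with x hfx hgx hx
    rw [hfx hx, hgx hx, Real.inner_apply, Real.inner_apply]
    ring
  rw [L2.inner_def, L2.inner_def,
    ← integral_sub (L2.integrable_inner w g) (L2.integrable_inner f v),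
    integral_Ioo_eq_intervalIntegral]
  linarith [hprim.eq_add_integral 1 right_mem_uIcc]

end IsH2Rep

theorem h2Data_eq {f w : H} {φ φ' : ℝ → ℝ} (h : IsH2Rep f φ φ' w) :
    EqOn (h2Data f).1 φ (Icc 0 1) ∧ EqOn (h2Data f).2.1 φ' (Icc 0 1) ∧ (h2Data f).2.2 = w :=
  (h2Data_spec ⟨φ, φ', w, h⟩).unique h

theorem opA_eq (a b : ℝ) {f w : H} {φ φ' : ℝ → ℝ} (h : IsH2Rep f φ φ' w) :
    opA a b f = a • w + b • f := by
  rw [opA, (h2Data_eq h).2.2]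

/-- `f` belongs to the domain of `𝒜₀` and `f'' = w`. For `a ≠ 0`, the pairs `(f, a • w + b • f)`
form the graph of `𝒜₀`, which this relation describes without the junk values of `opA`. -/
def HasLaplacian (θ₁ θ₂ : ℝ) (f w : H) : Prop :=
  ∃ φ φ' : ℝ → ℝ, IsH2Rep f φ φ' w ∧ Real.cos θ₁ * φ 0 - Real.sin θ₁ * φ' 0 = 0 ∧
    Real.cos θ₂ * φ 1 + Real.sin θ₂ * φ' 1 = 0

theorem hasLaplacian_iff {θ₁ θ₂ : ℝ} {f w : H} :
    HasLaplacian θ₁ θ₂ f w ↔ f ∈ domA₀ θ₁ θ₂ ∧ (h2Data f).2.2 = w := by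
  have hB : opB θ₁ θ₂ f = 0 ↔
      Real.cos θ₁ * (h2Data f).1 0 - Real.sin θ₁ * (h2Data f).2.1 0 = 0 ∧
      Real.cos θ₂ * (h2Data f).1 1 + Real.sin θ₂ * (h2Data f).2.1 1 = 0 := by
    simp [opB]
  constructor
  · rintro ⟨φ, φ', h, h₀, h₁⟩
    obtain ⟨hφ, hφ', hw⟩ := h2Data_eq h
    have left : (0 : ℝ) ∈ Icc (0 : ℝ) 1 := left_mem_Icc.2 zero_le_one
    have right : (1 : ℝ) ∈ Icc (0 : ℝ) 1 := right_mem_Icc.2 zero_le_one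
    refine ⟨⟨⟨φ, φ', w, h⟩, hB.2 ?_⟩, hw⟩
    rw [hφ left, hφ' left, hφ right, hφ' right]
    exact ⟨h₀, h₁⟩
  · rintro ⟨⟨h, hf⟩, rfl⟩
    exact ⟨_, _, h2Data_spec h, hB.1 hf⟩

theorem exists_eq_mul_sin_cos {θ x y : ℝ} (h : Real.cos θ * x - Real.sin θ * y = 0) :
    ∃ r, x = r * Real.sin θ ∧ y = r * Real.cos θ := by
  have hθ := Real.sin_sq_add_cos_sq θ
  refine ⟨x * Real.sin θ + y * Real.cos θ, ?_, ?_⟩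
  · linear_combination (-x) * hθ + Real.cos θ * h
  · linear_combination (-y) * hθ - Real.sin θ * h

namespace HasLaplacian

variable {θ₁ θ₂ : ℝ} {f g w v : H}

theorem unique (h : HasLaplacian θ₁ θ₂ f w) (h' : HasLaplacian θ₁ θ₂ f v) : w = v :=
  (hasLaplacian_iff.1 h).2.symm.trans (hasLaplacian_iff.1 h').2

theorem add (h : HasLaplacian θ₁ θ₂ f w) (h' : HasLaplacian θ₁ θ₂ g v) :
    HasLaplacian θ₁ θ₂ (f + g) (w + v) := by
  obtain ⟨φ, φ', h, hφ₀, hφ₁⟩ := h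
  obtain ⟨ψ, ψ', h', hψ₀, hψ₁⟩ := h'
  exact ⟨_, _, h.add h', by linear_combination hφ₀ + hψ₀, by linear_combination hφ₁ + hψ₁⟩

theorem smul (h : HasLaplacian θ₁ θ₂ f w) (s : ℝ) : HasLaplacian θ₁ θ₂ (s • f) (s • w) := by
  obtain ⟨φ, φ', h, h₀, h₁⟩ := h
  exact ⟨_, _, h.smul s, by linear_combination s * h₀, by linear_combination s * h₁⟩

theorem inner_comm (h : HasLaplacian θ₁ θ₂ f w) (h' : HasLaplacian θ₁ θ₂ g v) :
    inner ℝ w g = inner ℝ f v := by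
  obtain ⟨φ, φ', h, hφ₀, hφ₁⟩ := h
  obtain ⟨ψ, ψ', h', hψ₀, hψ₁⟩ := h'
  have wronskian_eq_zero : ∀ {θ x x' y y' : ℝ}, Real.cos θ * x - Real.sin θ * x' = 0 →
      Real.cos θ * y - Real.sin θ * y' = 0 → x' * y - x * y' = 0 := by
    intro θ x x' y y' hx hy
    obtain ⟨r, rfl, rfl⟩ := exists_eq_mul_sin_cos hx
    obtain ⟨s, rfl, rfl⟩ := exists_eq_mul_sin_cos hy
    ring
  have hleft := wronskian_eq_zero hφ₀ hψ₀
  have hright : -φ' 1 * ψ 1 - φ 1 * -ψ' 1 = 0 :=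
    wronskian_eq_zero (θ := θ₂) (by linarith) (by linarith)
  linarith [h.green_formula h']

end HasLaplacian

/-! ### Cauchy data and simplicity of the eigenvalues -/

theorem IsH2Rep.eq_zero_of_cauchy {f : H} {φ φ' : ℝ → ℝ} {q : ℝ} (h : IsH2Rep f φ φ' (q • f))
    (h₀ : φ 0 = 0) (h₀' : φ' 0 = 0) : f = 0 := by
  obtain ⟨hf, hφ, hφ'⟩ := isH2Rep_iff.1 h
  have hφ'' : IsPrimitiveOn φ' (fun x => q * φ x) 0 1 :=
    hφ'.congr_right (ae_restrict_Ioo_iff.1 ((Lp.coeFn_smul q f).trans (hf.const_smul q)))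
  have hcont : ContinuousOn φ (Icc 0 1) := uIcc_zero_one ▸ hφ.continuousOn
  have hcont' : ContinuousOn φ' (Icc 0 1) := uIcc_zero_one ▸ hφ'.continuousOn
  let L : ℝ × ℝ →L[ℝ] ℝ × ℝ :=
    (ContinuousLinearMap.snd ℝ ℝ ℝ).prod (q • ContinuousLinearMap.fst ℝ ℝ ℝ)
  have hzero : EqOn (fun x => (φ x, φ' x)) (fun _ => (0 : ℝ × ℝ)) (Icc 0 1) := by
    refine ODE_solution_unique_of_mem_Icc_right (v := fun _ => L) (s := fun _ => univ)
      (K := ‖L‖₊) (fun t _ => L.lipschitz.lipschitzOnWith) (hcont.prodMk hcont') (fun t ht => ?_)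
      (fun _ _ => mem_univ _) continuousOn_const (fun t _ => ?_) (fun _ _ => mem_univ _)
      (Prod.ext h₀ h₀')
    · exact (hφ.hasDerivWithinAt_Ici hcont' ht).prodMk
        (hφ''.hasDerivWithinAt_Ici (hcont.const_smul q) ht)
    · rw [map_zero]
      exact hasDerivWithinAt_const _ _ _
  refine norm_le_zero_iff.1 (norm_le_of_ae_eq hf le_rfl fun x hx => ?_)
  exact (abs_eq_zero.2 (congrArg Prod.fst (hzero hx))).le

theorem IsH2Rep.exists_cauchy_data {θ q : ℝ} {f : H} {φ φ' : ℝ → ℝ}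
    (h : IsH2Rep f φ φ' (q • f)) (hb : Real.cos θ * φ 0 - Real.sin θ * φ' 0 = 0) (hf : f ≠ 0) :
    ∃ r, r ≠ 0 ∧ φ 0 = r * Real.sin θ ∧ φ' 0 = r * Real.cos θ := by
  obtain ⟨r, hr, hr'⟩ := exists_eq_mul_sin_cos hb
  refine ⟨r, ?_, hr, hr'⟩
  rintro rfl
  exact hf (h.eq_zero_of_cauchy (by simpa using hr) (by simpa using hr'))

theorem HasLaplacian.exists_eq_smul {θ₁ θ₂ q : ℝ} {f g : H} (hf : HasLaplacian θ₁ θ₂ f (q • f))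
    (hg : HasLaplacian θ₁ θ₂ g (q • g)) (hf0 : f ≠ 0) : ∃ r : ℝ, g = r • f := by
  obtain ⟨φ, φ', hφ, hφ₀, -⟩ := hf
  obtain ⟨ψ, ψ', hψ, hψ₀, -⟩ := hg
  obtain ⟨r, hr, hφr, hφr'⟩ := hφ.exists_cauchy_data hφ₀ hf0
  obtain ⟨s, hψs, hψs'⟩ := exists_eq_mul_sin_cos hψ₀
  have hdiff := hψ.add (hφ.smul (-(s / r)))
  rw [smul_comm _ q f, ← smul_add] at hdiff
  refine ⟨s / r, ?_⟩
  rw [← sub_eq_zero, sub_eq_add_neg, ← neg_smul]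
  apply hdiff.eq_zero_of_cauchy
  · rw [hψs, hφr]; field_simp; ring
  · rw [hψs', hφr']; field_simp; ring

/-! ### The resolvent of the Laplacian with Robin boundary conditions -/

/-- `W⁻¹ (z₂(x) ∫₀ˣ y₁ f + z₁(x) ∫ₓ¹ y₂ f)`. If `y₁`, `y₂` solve `y'' = q y` with Wronskian
`y₁' y₂ - y₁ y₂' = W`, then for `z = y` this is the solution `φ` of `q φ - φ'' = f` given by the
Green function, and for `z = y'` it is `φ'`. -/
noncomputable def greenFun (W : ℝ) (y₁ y₂ z₁ z₂ f : ℝ → ℝ) (x : ℝ) : ℝ :=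
  W⁻¹ * ((z₂ x * ∫ ξ in (0 : ℝ)..x, y₁ ξ * f ξ) + z₁ x * ∫ ξ in x..(1 : ℝ), y₂ ξ * f ξ)

theorem isPrimitiveOn_greenFun {y₁ y₂ z₁ z₁' z₂ z₂' f : ℝ → ℝ} (W : ℝ)
    (hf : IntervalIntegrable f volume 0 1) (hy₁ : Continuous y₁) (hy₂ : Continuous y₂)
    (hz₁ : IsPrimitiveOn z₁ z₁' 0 1) (hz₂ : IsPrimitiveOn z₂ z₂' 0 1) :
    IsPrimitiveOn (greenFun W y₁ y₂ z₁ z₂ f)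
      (fun x => greenFun W y₁ y₂ z₁' z₂' f x + W⁻¹ * (z₂ x * y₁ x - z₁ x * y₂ x) * f x) 0 1 := by
  have hint₁ : IntervalIntegrable (fun x => y₁ x * f x) volume 0 1 :=
    hf.continuousOn_mul hy₁.continuousOn
  have hint₂ : IntervalIntegrable (fun x => y₂ x * f x) volume 0 1 :=
    hf.continuousOn_mul hy₂.continuousOn
  have hprim₂ : IsPrimitiveOn (fun x => ∫ ξ in x..(1 : ℝ), y₂ ξ * f ξ)
      (fun x => -1 * (y₂ x * f x)) 0 1 := by
    refine ⟨hint₂.const_mul (-1), fun x hx => ?_⟩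
    rw [intervalIntegral.integral_const_mul, ← intervalIntegral.integral_add_adjacent_intervals
      (hint₂.mono_set (uIcc_subset_uIcc_left hx)) (hint₂.mono_set (uIcc_subset_uIcc_right hx))]
    ring
  refine (((hz₂.mul (.integral hint₁)).add (hz₁.mul hprim₂)).const_mul W⁻¹).congr_right
    (ae_of_all _ fun x _ => ?_)
  simp only [greenFun]
  ring

theorem abs_greenFun_le {y₁ y₂ z₁ z₂ : ℝ → ℝ} {M : ℝ} (W : ℝ) (f : H)
    (hy₁ : ∀ x ∈ Icc (0 : ℝ) 1, |y₁ x| ≤ M) (hy₂ : ∀ x ∈ Icc (0 : ℝ) 1, |y₂ x| ≤ M) {x : ℝ}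
    (hx : x ∈ Icc (0 : ℝ) 1) (hz₁ : |z₁ x| ≤ M) (hz₂ : |z₂ x| ≤ M) :
    |greenFun W y₁ y₂ z₁ z₂ f x| ≤ |W⁻¹| * (2 * M ^ 2) * ‖f‖ := by
  have hM : 0 ≤ M := (abs_nonneg _).trans hz₁
  have hleft := abs_integral_mul_le hy₁ f le_rfl hx.1 hx.2
  have hright := abs_integral_mul_le hy₂ f hx.1 hx.2 le_rfl
  rw [greenFun, abs_mul, mul_assoc]
  gcongr
  calc _ ≤ |z₂ x| * |∫ ξ in (0 : ℝ)..x, y₁ ξ * f ξ| + |z₁ x| * |∫ ξ in x..(1 : ℝ), y₂ ξ * f ξ| := by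
        rw [← abs_mul, ← abs_mul]
        exact abs_add_le _ _
    _ ≤ M * (M * ‖f‖) + M * (M * ‖f‖) := by gcongr
    _ = 2 * M ^ 2 * ‖f‖ := by ring

/-- The solution of `y'' = ω² y` satisfying the Robin condition `cos θ y(0) - sin θ y'(0) = 0`. -/
noncomputable def robinSol (θ ω x : ℝ) : ℝ :=
  Real.sin θ * ω * Real.cosh (ω * x) + Real.cos θ * Real.sinh (ω * x)

/-- The derivative of `robinSol θ ω`. -/
noncomputable def robinSolDeriv (θ ω x : ℝ) : ℝ :=
  ω * (Real.cos θ * Real.cosh (ω * x) + Real.sin θ * ω * Real.sinh (ω * x))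

theorem hasDerivAt_robinSol (θ ω x : ℝ) :
    HasDerivAt (robinSol θ ω) (robinSolDeriv θ ω x) x := by
  have hlin : HasDerivAt (fun x : ℝ => ω * x) ω x := hasDerivAt_const_mul ω
  refine ((hlin.cosh.const_mul (Real.sin θ * ω)).fun_add
    (hlin.sinh.const_mul (Real.cos θ))).congr_deriv ?_
  rw [robinSolDeriv]
  ring

theorem hasDerivAt_robinSolDeriv (θ ω x : ℝ) :
    HasDerivAt (robinSolDeriv θ ω) (ω ^ 2 * robinSol θ ω x) x := by
  have hlin : HasDerivAt (fun x : ℝ => ω * x) ω x := hasDerivAt_const_mul ω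
  refine (((hlin.cosh.const_mul (Real.cos θ)).fun_add
    (hlin.sinh.const_mul (Real.sin θ * ω))).const_mul ω).congr_deriv ?_
  rw [robinSol]
  ring

theorem continuous_robinSol (θ ω : ℝ) : Continuous (robinSol θ ω) := by
  unfold robinSol
  fun_prop

theorem continuous_robinSolDeriv (θ ω : ℝ) : Continuous (robinSolDeriv θ ω) := by
  unfold robinSolDeriv
  fun_prop

theorem continuous_robinSol_one_sub (θ ω : ℝ) : Continuous fun x => robinSol θ ω (1 - x) :=
  (continuous_robinSol θ ω).comp (continuous_sub_left 1)

theorem hasDerivAt_robinSol_one_sub (θ ω x : ℝ) :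
    HasDerivAt (fun x => robinSol θ ω (1 - x)) (-robinSolDeriv θ ω (1 - x)) x :=
  (hasDerivAt_robinSol θ ω (1 - x)).comp_const_sub 1 x

theorem hasDerivAt_neg_robinSolDeriv_one_sub (θ ω x : ℝ) :
    HasDerivAt (fun x => -robinSolDeriv θ ω (1 - x)) (ω ^ 2 * robinSol θ ω (1 - x)) x :=
  ((hasDerivAt_robinSolDeriv θ ω (1 - x)).comp_const_sub 1 x).fun_neg.congr_deriv (neg_neg _)

/-- The boundary condition at `1` of the solution of `y'' = ω² y` satisfying the boundary condition
at `0`: the zeros of this function are the `ω` for which `ω²` is an eigenvalue. -/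
noncomputable def charFun (θ₁ θ₂ ω : ℝ) : ℝ :=
  Real.cos θ₂ * robinSol θ₁ ω 1 + Real.sin θ₂ * robinSolDeriv θ₁ ω 1

theorem wronskian_robinSol (θ₁ θ₂ ω x : ℝ) :
    robinSolDeriv θ₁ ω x * robinSol θ₂ ω (1 - x) + robinSol θ₁ ω x * robinSolDeriv θ₂ ω (1 - x) =
      ω * charFun θ₁ θ₂ ω := by
  have hω : ω = ω * x + ω * (1 - x) := by ring
  have hcosh : Real.cosh ω = Real.cosh (ω * x) * Real.cosh (ω * (1 - x)) +
      Real.sinh (ω * x) * Real.sinh (ω * (1 - x)) := by rw [← Real.cosh_add, ← hω]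
  have hsinh : Real.sinh ω = Real.sinh (ω * x) * Real.cosh (ω * (1 - x)) +
      Real.cosh (ω * x) * Real.sinh (ω * (1 - x)) := by rw [← Real.sinh_add, ← hω]
  simp only [charFun, robinSol, robinSolDeriv, mul_one, hcosh, hsinh]
  ring

theorem two_mul_charFun (θ₁ θ₂ ω : ℝ) :
    2 * charFun θ₁ θ₂ ω =
      Real.exp ω * ((Real.sin θ₁ * ω + Real.cos θ₁) * (Real.sin θ₂ * ω + Real.cos θ₂)) -
      Real.exp (-ω) * ((Real.sin θ₁ * ω - Real.cos θ₁) * (Real.sin θ₂ * ω - Real.cos θ₂)) := by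
  simp only [charFun, robinSol, robinSolDeriv, mul_one, Real.cosh_eq, Real.sinh_eq]
  ring

theorem eventually_abs_sub_lt_exp_mul_abs_add (θ : ℝ) :
    ∀ᶠ ω in atTop, |Real.sin θ * ω - Real.cos θ| < Real.exp ω * |Real.sin θ * ω + Real.cos θ| := by
  rcases eq_or_ne (Real.sin θ) 0 with hs | hs
  · have hc : Real.cos θ ≠ 0 := fun hc => by simpa [hs, hc] using Real.sin_sq_add_cos_sq θ
    filter_upwards [eventually_gt_atTop 0] with ω hω
    simpa [hs] using lt_mul_of_one_lt_left (abs_pos.2 hc) (Real.one_lt_exp_iff.2 hω)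
  · filter_upwards [eventually_ge_atTop 1,
      (tendsto_id.const_mul_atTop (abs_pos.2 hs)).eventually_gt_atTop 3] with ω hω hsω
    have hc := Real.abs_cos_le_one θ
    have hlarge : 3 < |Real.sin θ * ω| := by
      rwa [abs_mul, abs_of_pos (zero_lt_one.trans_le hω)]
    have hsub : |Real.sin θ * ω - Real.cos θ| ≤ |Real.sin θ * ω| + 1 :=
      (abs_sub _ _).trans (by linarith)
    have hadd : |Real.sin θ * ω| - 1 ≤ |Real.sin θ * ω + Real.cos θ| := by
      linarith [abs_sub_abs_le_abs_add (Real.sin θ * ω) (Real.cos θ)]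
    have hexp : 2 ≤ Real.exp ω := by linarith [Real.add_one_le_exp ω]
    calc |Real.sin θ * ω - Real.cos θ| < 2 * |Real.sin θ * ω + Real.cos θ| := by linarith
      _ ≤ Real.exp ω * |Real.sin θ * ω + Real.cos θ| := by gcongr

theorem eventually_charFun_ne_zero (θ₁ θ₂ : ℝ) : ∀ᶠ ω in atTop, charFun θ₁ θ₂ ω ≠ 0 := by
  filter_upwards [eventually_abs_sub_lt_exp_mul_abs_add θ₁,
    eventually_abs_sub_lt_exp_mul_abs_add θ₂] with ω h₁ h₂ hzero
  have hexp : Real.exp ω * Real.exp (-ω) = 1 := by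
    rw [← Real.exp_add, add_neg_cancel, Real.exp_zero]
  have hprod : (Real.sin θ₁ * ω - Real.cos θ₁) * (Real.sin θ₂ * ω - Real.cos θ₂) =
      Real.exp ω * (Real.sin θ₁ * ω + Real.cos θ₁) *
        (Real.exp ω * (Real.sin θ₂ * ω + Real.cos θ₂)) := by
    linear_combination Real.exp ω * (two_mul_charFun θ₁ θ₂ ω - 2 * hzero) -
      (Real.sin θ₁ * ω - Real.cos θ₁) * (Real.sin θ₂ * ω - Real.cos θ₂) * hexp
  have habs := congrArg abs hprod
  simp only [abs_mul, Real.abs_exp] at habs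
  exact (mul_lt_mul'' h₁ h₂ (abs_nonneg _) (abs_nonneg _)).ne habs

/-- The solution `φ` of `ω² φ - φ'' = f` with Robin boundary conditions; a junk value if `ω²` is an
eigenvalue. -/
noncomputable def resolventFun (θ₁ θ₂ ω : ℝ) : (ℝ → ℝ) → ℝ → ℝ :=
  greenFun (ω * charFun θ₁ θ₂ ω) (robinSol θ₁ ω) (fun x => robinSol θ₂ ω (1 - x))
    (robinSol θ₁ ω) (fun x => robinSol θ₂ ω (1 - x))

/-- The derivative of `resolventFun θ₁ θ₂ ω f`. -/
noncomputable def resolventFunDeriv (θ₁ θ₂ ω : ℝ) : (ℝ → ℝ) → ℝ → ℝ :=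
  greenFun (ω * charFun θ₁ θ₂ ω) (robinSol θ₁ ω) (fun x => robinSol θ₂ ω (1 - x))
    (robinSolDeriv θ₁ ω) (fun x => -robinSolDeriv θ₂ ω (1 - x))

theorem isPrimitiveOn_resolventFun (θ₁ θ₂ ω : ℝ) {f : ℝ → ℝ}
    (hf : IntervalIntegrable f volume 0 1) :
    IsPrimitiveOn (resolventFun θ₁ θ₂ ω f) (resolventFunDeriv θ₁ θ₂ ω f) 0 1 :=
  (isPrimitiveOn_greenFun _ hf (continuous_robinSol θ₁ ω)
    (continuous_robinSol_one_sub θ₂ ω)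
    (.of_hasDerivAt (hasDerivAt_robinSol θ₁ ω) (continuous_robinSolDeriv θ₁ ω))
    (.of_hasDerivAt (hasDerivAt_robinSol_one_sub θ₂ ω)
      ((continuous_robinSolDeriv θ₂ ω).comp (continuous_sub_left 1)).neg)).congr_right
    (ae_of_all _ fun x _ => by rw [mul_comm (robinSol θ₁ ω x), sub_self, mul_zero, zero_mul,
      add_zero, resolventFunDeriv])

theorem isPrimitiveOn_resolventFunDeriv {θ₁ θ₂ ω : ℝ} (hω : ω ≠ 0) (hchar : charFun θ₁ θ₂ ω ≠ 0)
    {f : ℝ → ℝ} (hf : IntervalIntegrable f volume 0 1) :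
    IsPrimitiveOn (resolventFunDeriv θ₁ θ₂ ω f)
      (fun x => ω ^ 2 * resolventFun θ₁ θ₂ ω f x - f x) 0 1 := by
  refine (isPrimitiveOn_greenFun _ hf (continuous_robinSol θ₁ ω)
    (continuous_robinSol_one_sub θ₂ ω)
    (.of_hasDerivAt (hasDerivAt_robinSolDeriv θ₁ ω) ((continuous_robinSol θ₁ ω).const_mul _))
    (.of_hasDerivAt (hasDerivAt_neg_robinSolDeriv_one_sub θ₂ ω)
      ((continuous_robinSol_one_sub θ₂ ω).const_mul _))).congr_right
    (ae_of_all _ fun x _ => ?_)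
  simp only [resolventFun, greenFun]
  linear_combination (-(ω * charFun θ₁ θ₂ ω)⁻¹ * f x) * wronskian_robinSol θ₁ θ₂ ω x -
    f x * inv_mul_cancel₀ (mul_ne_zero hω hchar)

theorem resolventFun_zero (θ₁ θ₂ ω : ℝ) (f : ℝ → ℝ) :
    Real.cos θ₁ * resolventFun θ₁ θ₂ ω f 0 - Real.sin θ₁ * resolventFunDeriv θ₁ θ₂ ω f 0 = 0 := by
  simp only [resolventFun, resolventFunDeriv, greenFun, robinSol, robinSolDeriv,
    intervalIntegral.integral_same, mul_zero, Real.cosh_zero, Real.sinh_zero]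
  ring

theorem resolventFun_one (θ₁ θ₂ ω : ℝ) (f : ℝ → ℝ) :
    Real.cos θ₂ * resolventFun θ₁ θ₂ ω f 1 + Real.sin θ₂ * resolventFunDeriv θ₁ θ₂ ω f 1 = 0 := by
  simp only [resolventFun, resolventFunDeriv, greenFun, robinSol, robinSolDeriv,
    intervalIntegral.integral_same, sub_self, mul_zero, Real.cosh_zero, Real.sinh_zero]
  ring

theorem exists_abs_resolventFun_le (θ₁ θ₂ ω : ℝ) :
    ∃ C, 0 ≤ C ∧ ∀ f : H, ∀ x ∈ Icc (0 : ℝ) 1,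
      |resolventFun θ₁ θ₂ ω f x| ≤ C * ‖f‖ ∧ |resolventFunDeriv θ₁ θ₂ ω f x| ≤ C * ‖f‖ := by
  obtain ⟨M, hM⟩ := isCompact_Icc.exists_bound_of_continuousOn (s := Icc (0 : ℝ) 1)
    (((continuous_robinSol θ₁ ω).prodMk (continuous_robinSolDeriv θ₁ ω)).prodMk
      (((continuous_robinSol θ₂ ω).prodMk (continuous_robinSolDeriv θ₂ ω).neg).comp
        (continuous_sub_left 1))).continuousOn
  simp only [Function.comp_apply, Prod.norm_mk, sup_le_iff, Real.norm_eq_abs] at hM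
  have hy₁ : ∀ x ∈ Icc (0 : ℝ) 1, |robinSol θ₁ ω x| ≤ M := fun x hx => (hM x hx).1.1
  have hy₂ : ∀ x ∈ Icc (0 : ℝ) 1, |robinSol θ₂ ω (1 - x)| ≤ M := fun x hx => (hM x hx).2.1
  exact ⟨|(ω * charFun θ₁ θ₂ ω)⁻¹| * (2 * M ^ 2), by positivity, fun f x hx =>
    ⟨abs_greenFun_le _ f hy₁ hy₂ hx (hy₁ x hx) (hy₂ x hx),
      abs_greenFun_le _ f hy₁ hy₂ hx (hM x hx).1.2 (hM x hx).2.2⟩⟩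

theorem exists_isH2Rep_resolventFun {θ₁ θ₂ ω : ℝ} (hω : ω ≠ 0) (hchar : charFun θ₁ θ₂ ω ≠ 0)
    (f : H) : ∃ g : H, IsH2Rep g (resolventFun θ₁ θ₂ ω f) (resolventFunDeriv θ₁ θ₂ ω f)
      (ω ^ 2 • g - f) := by
  have hφ := isPrimitiveOn_resolventFun θ₁ θ₂ ω (intervalIntegrable_coe f)
  have hLp := memLp_of_continuousOn (uIcc_zero_one ▸ hφ.continuousOn)
  refine ⟨hLp.toLp, isH2Rep_iff.2 ⟨hLp.coeFn_toLp, hφ,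
    (isPrimitiveOn_resolventFunDeriv hω hchar (intervalIntegrable_coe f)).congr_right
      (ae_restrict_Ioo_iff.1 ?_)⟩⟩
  filter_upwards [hLp.coeFn_toLp, Lp.coeFn_sub (ω ^ 2 • hLp.toLp) f,
    Lp.coeFn_smul (ω ^ 2) hLp.toLp] with x hg hsub hsmul
  rw [hsub, Pi.sub_apply, hsmul, Pi.smul_apply, hg, smul_eq_mul]

theorem HasLaplacian.eq_zero_of_charFun_ne_zero {θ₁ θ₂ ω : ℝ} (hω : ω ≠ 0)
    (hchar : charFun θ₁ θ₂ ω ≠ 0) {f : H} (hf : HasLaplacian θ₁ θ₂ f (ω ^ 2 • f)) : f = 0 := by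
  obtain ⟨g, hg⟩ := exists_isH2Rep_resolventFun hω hchar f
  have hsymm := hf.inner_comm ⟨_, _, hg, resolventFun_zero .., resolventFun_one ..⟩
  rw [inner_sub_right, real_inner_smul_left, real_inner_smul_right] at hsymm
  exact inner_self_eq_zero.1 (by linarith : inner ℝ f f = 0)

/-- Arzelà–Ascoli. -/
theorem exists_isCompact_of_lipschitzOnWith (C : NNReal) :
    ∃ K : Set H, IsCompact K ∧ ∀ (g : H) (φ : ℝ → ℝ), g =ᵐ[volume.restrict (Ioo (0 : ℝ) 1)] φ →
      (∀ x ∈ Icc (0 : ℝ) 1, |φ x| ≤ C) → LipschitzOnWith C φ (Icc 0 1) → g ∈ K := by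
  let A : Set (BoundedContinuousFunction (Icc (0 : ℝ) 1) ℝ) :=
    {ψ | (∀ x, |ψ x| ≤ C) ∧ LipschitzWith C ψ}
  have hA : IsCompact (closure A) :=
    BoundedContinuousFunction.arzela_ascoli (Metric.closedBall 0 C) (isCompact_closedBall _ _) A
      (fun ψ x hψ => by simpa using hψ.1 x)
      (LipschitzWith.uniformEquicontinuous _ C fun ψ => ψ.2.2).equicontinuous
  let proj : C(ℝ, Icc (0 : ℝ) 1) := ⟨projIcc 0 1 zero_le_one, continuous_projIcc⟩
  let toL2 := BoundedContinuousFunction.toLp (E := ℝ) 2 (volume.restrict (Ioo (0 : ℝ) 1)) ℝ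
  let restr : BoundedContinuousFunction (Icc (0 : ℝ) 1) ℝ → H := fun ψ =>
    toL2 (ψ.compContinuous proj)
  have hrestr : Continuous restr :=
    toL2.continuous.comp (BoundedContinuousFunction.continuous_compContinuous proj)
  refine ⟨restr '' closure A, hA.image hrestr, fun g φ hg hbound hlip => ?_⟩
  let ψ : BoundedContinuousFunction (Icc (0 : ℝ) 1) ℝ :=
    BoundedContinuousFunction.mkOfCompact ⟨fun x => φ x, hlip.to_restrict.continuous⟩
  refine ⟨ψ, subset_closure ⟨fun x => hbound x x.2, hlip.to_restrict⟩, Lp.ext ?_⟩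
  filter_upwards [BoundedContinuousFunction.coeFn_toLp 2 _ ℝ (ψ.compContinuous proj), hg,
    ae_restrict_mem measurableSet_Ioo] with x hψ hgφ hx
  rw [hψ, hgφ]
  exact congrArg (fun y : Icc (0 : ℝ) 1 => φ y)
    (projIcc_of_mem zero_le_one (Ioo_subset_Icc_self hx))

theorem exists_resolvent {θ₁ θ₂ ω : ℝ} (hω : ω ≠ 0) (hchar : charFun θ₁ θ₂ ω ≠ 0) :
    ∃ G : H →L[ℝ] H, IsCompactOperator G ∧
      ∀ f g : H, HasLaplacian θ₁ θ₂ g (ω ^ 2 • g - f) ↔ g = G f := by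
  obtain ⟨C, hC, hbound⟩ := exists_abs_resolventFun_le θ₁ θ₂ ω
  choose G hrep using exists_isH2Rep_resolventFun hω hchar
  have hG : ∀ f, HasLaplacian θ₁ θ₂ (G f) (ω ^ 2 • G f - f) := fun f =>
    ⟨_, _, hrep f, resolventFun_zero .., resolventFun_one ..⟩
  have eq_of_hasLaplacian : ∀ f g, HasLaplacian θ₁ θ₂ g (ω ^ 2 • g - f) → g = G f := by
    intro f g hg
    have hdiff : HasLaplacian θ₁ θ₂ (g + (-1 : ℝ) • G f) (ω ^ 2 • (g + (-1 : ℝ) • G f)) := by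
      convert hg.add ((hG f).smul (-1)) using 1
      module
    simpa [← sub_eq_add_neg, sub_eq_zero] using hdiff.eq_zero_of_charFun_ne_zero hω hchar
  let L : H →ₗ[ℝ] H :=
    { toFun := G
      map_add' := fun f g => (eq_of_hasLaplacian _ _ (by
        convert (hG f).add (hG g) using 1
        module)).symm
      map_smul' := fun s f => (eq_of_hasLaplacian _ _ (by
        rw [RingHom.id_apply]
        simpa only [smul_sub, smul_comm s (ω ^ 2)] using (hG f).smul s)).symm }
  have hL : ∀ f, ‖L f‖ ≤ C * ‖f‖ := fun f =>
    norm_le_of_ae_eq (hrep f).1 (by positivity) fun x hx => (hbound f x hx).1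
  refine ⟨L.mkContinuous C hL, ?_, fun f g => ⟨eq_of_hasLaplacian f g, fun h => h ▸ hG f⟩⟩
  obtain ⟨K, hK, hmem⟩ := exists_isCompact_of_lipschitzOnWith ⟨C, hC⟩
  refine ⟨K, hK, mem_of_superset (Metric.closedBall_mem_nhds 0 one_pos) fun f hf => ?_⟩
  have hCf : C * ‖f‖ ≤ C := mul_le_of_le_one_right hC (by simpa using hf)
  obtain ⟨hae, hφ, -⟩ := isH2Rep_iff.1 (hrep f)
  refine hmem (G f) _ hae (fun x hx => (hbound f x hx).1.trans hCf) ?_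
  rw [← uIcc_zero_one] at hbound ⊢
  exact hφ.lipschitzOnWith fun x hx => (hbound f x hx).2.trans hCf

/-! ### Spectral decomposition -/

/-- `G` is the resolvent of the Laplacian at `ω²`, it is compact, and `ω²` lies strictly above all
the eigenvalues of the Laplacian. -/
structure IsResolvent (θ₁ θ₂ ω : ℝ) (G : H →L[ℝ] H) : Prop where
  eq_zero : ∀ (q : ℝ) (f : H), ω ^ 2 ≤ q → HasLaplacian θ₁ θ₂ f (q • f) → f = 0
  compact : IsCompactOperator G
  hasLaplacian_iff : ∀ f g : H, HasLaplacian θ₁ θ₂ g (ω ^ 2 • g - f) ↔ g = G f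

theorem exists_isResolvent (θ₁ θ₂ : ℝ) : ∃ ω G, IsResolvent θ₁ θ₂ ω G := by
  obtain ⟨ω, hω⟩ := eventually_atTop.1
    ((eventually_charFun_ne_zero θ₁ θ₂).and (eventually_gt_atTop 0))
  have hω0 : 0 < ω := (hω ω le_rfl).2
  obtain ⟨G, hcompact, hG⟩ := exists_resolvent hω0.ne' (hω ω le_rfl).1
  refine ⟨ω, G, fun q f hq hf => ?_, hcompact, hG⟩
  obtain ⟨hchar, hsqrt⟩ := hω (√q) (Real.le_sqrt_of_sq_le hq)
  rw [← Real.sq_sqrt ((sq_nonneg ω).trans hq)] at hf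
  exact hf.eq_zero_of_charFun_ne_zero hsqrt.ne' hchar

/-- The eigenvalues of the Laplacian with the Robin boundary conditions. -/
def eigSet (θ₁ θ₂ : ℝ) : Set ℝ := {q | ∃ f : H, ‖f‖ = 1 ∧ HasLaplacian θ₁ θ₂ f (q • f)}

theorem HasLaplacian.mem_eigSet {θ₁ θ₂ q : ℝ} {f : H} (hf : HasLaplacian θ₁ θ₂ f (q • f))
    (hf0 : f ≠ 0) : q ∈ eigSet θ₁ θ₂ :=
  ⟨‖f‖⁻¹ • f, norm_smul_inv_norm hf0, smul_comm q ‖f‖⁻¹ f ▸ hf.smul ‖f‖⁻¹⟩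

theorem HasLaplacian.inner_eq_zero {θ₁ θ₂ q r : ℝ} {f g : H} (hf : HasLaplacian θ₁ θ₂ f (q • f))
    (hg : HasLaplacian θ₁ θ₂ g (r • g)) (hqr : q ≠ r) : inner ℝ f g = 0 := by
  have hsymm := hf.inner_comm hg
  rw [real_inner_smul_left, real_inner_smul_right, ← sub_eq_zero, ← sub_mul] at hsymm
  exact (mul_eq_zero.1 hsymm).resolve_left (sub_ne_zero.2 hqr)

theorem orthonormal_of_hasLaplacian {ι : Type*} {θ₁ θ₂ : ℝ} {f : ι → H} {q : ι → ℝ}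
    (hq : Function.Injective q) (hnorm : ∀ i, ‖f i‖ = 1)
    (hf : ∀ i, HasLaplacian θ₁ θ₂ (f i) (q i • f i)) : Orthonormal ℝ f :=
  ⟨hnorm, fun i j hij => (hf i).inner_eq_zero (hf j) (hq.ne hij)⟩

theorem exists_abs_lt_of_orthonormal {E : Type*} [NormedAddCommGroup E] [InnerProductSpace ℝ E]
    {G : E →L[ℝ] E} (hG : IsCompactOperator G) {f : ℕ → E} (hf : Orthonormal ℝ f) {γ : ℕ → ℝ}
    (h : ∀ n, G (f n) = γ n • f n) {ε : ℝ} (hε : 0 < ε) : ∃ n, |γ n| < ε := by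
  by_contra! hge
  obtain ⟨K, hK, hsub⟩ := IsCompactOperator.image_closedBall_subset_compact (f := (G : E →ₗ[ℝ] E))
    hG 1
  obtain ⟨x, -, σ, hσ, hx⟩ := hK.tendsto_subseq fun n => hsub ⟨f n, by simp [hf.1 n], rfl⟩
  obtain ⟨N, hN⟩ := Metric.cauchySeq_iff'.1 hx.cauchySeq ε hε
  have hclose : ‖G (f (σ (N + 1))) - G (f (σ N))‖ < ε := by
    simpa [dist_eq_norm] using hN (N + 1) N.le_succ
  have hpyth : ‖G (f (σ (N + 1))) - G (f (σ N))‖ ^ 2 = γ (σ (N + 1)) ^ 2 + γ (σ N) ^ 2 := by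
    rw [h, h, norm_sub_sq_real, real_inner_smul_left, real_inner_smul_right,
      hf.2 (hσ N.lt_succ_self).ne', norm_smul, norm_smul, hf.1, hf.1, Real.norm_eq_abs,
      Real.norm_eq_abs, mul_one, mul_one, sq_abs, sq_abs]
    ring
  have hlarge : ε ^ 2 ≤ γ (σ (N + 1)) ^ 2 := sq_abs (γ _) ▸ pow_le_pow_left₀ hε.le (hge _) 2
  have hsmall := pow_lt_pow_left₀ hclose (norm_nonneg _) two_ne_zero
  linarith [sq_nonneg (γ (σ N))]

/-- The functions with a Laplacian, as a subspace of `L²(0,1)`. -/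
def laplacianDomain (θ₁ θ₂ : ℝ) : Submodule ℝ H where
  carrier := {f | ∃ w, HasLaplacian θ₁ θ₂ f w}
  zero_mem' := ⟨0, fun _ => 0, fun _ => 0,
    isH2Rep_of_hasDerivAt (fun _ => hasDerivAt_const _ _) (fun _ => hasDerivAt_const _ _)
      continuous_const (Lp.coeFn_zero ℝ 2 _) (Lp.coeFn_zero ℝ 2 _), by simp, by simp⟩
  add_mem' := fun ⟨_, hf⟩ ⟨_, hg⟩ => ⟨_, hf.add hg⟩
  smul_mem' := fun s _ ⟨_, hf⟩ => ⟨_, hf.smul s⟩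

theorem laplacianDomain_ne_top (θ₁ θ₂ : ℝ) : laplacianDomain θ₁ θ₂ ≠ ⊤ := by
  intro htop
  let y : ℝ → ℝ := fun x => Real.cos θ₁ - Real.sin θ₁ * x
  have hLp := memLp_of_continuousOn (φ := y) (by fun_prop)
  have hderiv : ∀ x, HasDerivAt y (-Real.sin θ₁) x := fun x =>
    (hasDerivAt_const_mul (Real.sin θ₁)).const_sub (Real.cos θ₁)
  have hy : IsH2Rep hLp.toLp y (fun _ => -Real.sin θ₁) 0 :=
    isH2Rep_of_hasDerivAt hderiv (fun _ => hasDerivAt_const _ _) continuous_const hLp.coeFn_toLp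
      (Lp.coeFn_zero ℝ 2 _)
  obtain ⟨w, φ, φ', hφ, hbc, -⟩ := htop.ge (Submodule.mem_top (x := hLp.toLp))
  obtain ⟨heq, heq', -⟩ := hφ.unique hy
  rw [heq (left_mem_Icc.2 zero_le_one), heq' (left_mem_Icc.2 zero_le_one)] at hbc
  linarith [Real.sin_sq_add_cos_sq θ₁, show Real.cos θ₁ * (Real.cos θ₁ - Real.sin θ₁ * 0) -
    Real.sin θ₁ * -Real.sin θ₁ = Real.sin θ₁ ^ 2 + Real.cos θ₁ ^ 2 by ring]

namespace IsResolvent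

variable {θ₁ θ₂ ω : ℝ} {G : H →L[ℝ] H}

theorem hasLaplacian (hG : IsResolvent θ₁ θ₂ ω G) (f : H) :
    HasLaplacian θ₁ θ₂ (G f) (ω ^ 2 • G f - f) :=
  (hG.hasLaplacian_iff f _).2 rfl

theorem apply_of_hasLaplacian (hG : IsResolvent θ₁ θ₂ ω G) {g w : H}
    (h : HasLaplacian θ₁ θ₂ g w) : G (ω ^ 2 • g - w) = g :=
  ((hG.hasLaplacian_iff _ _).1 (by rwa [sub_sub_cancel])).symm

theorem isSymmetric (hG : IsResolvent θ₁ θ₂ ω G) : G.IsSymmetric := by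
  intro f g
  have hsymm := (hG.hasLaplacian f).inner_comm (hG.hasLaplacian g)
  rw [inner_sub_left, inner_sub_right, real_inner_smul_left, real_inner_smul_right] at hsymm
  exact (sub_right_injective hsymm).symm

theorem eq_zero_of_apply_eq_zero (hG : IsResolvent θ₁ θ₂ ω G) {f : H} (h : G f = 0) : f = 0 := by
  have hf := hG.hasLaplacian f
  have hzero := hf.smul 0
  rw [h] at hf
  rw [h, smul_zero, zero_smul] at hzero
  simpa using hf.unique hzero

theorem lt_sq (hG : IsResolvent θ₁ θ₂ ω G) {q : ℝ} {f : H} (hf : HasLaplacian θ₁ θ₂ f (q • f))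
    (hf0 : f ≠ 0) : q < ω ^ 2 :=
  not_le.1 fun hq => hf0 (hG.eq_zero q f hq hf)

theorem apply_eigenvector (hG : IsResolvent θ₁ θ₂ ω G) {q : ℝ} {f : H}
    (hf : HasLaplacian θ₁ θ₂ f (q • f)) (hf0 : f ≠ 0) : G f = (ω ^ 2 - q)⁻¹ • f := by
  have hne : ω ^ 2 - q ≠ 0 := (sub_pos.2 (hG.lt_sq hf hf0)).ne'
  rw [eq_inv_smul_iff₀ hne, ← map_smul, sub_smul, hG.apply_of_hasLaplacian hf]

theorem hasLaplacian_of_apply_eq_smul (hG : IsResolvent θ₁ θ₂ ω G) {γ : ℝ} {f : H}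
    (hf : G f = γ • f) (hf0 : f ≠ 0) : HasLaplacian θ₁ θ₂ f ((ω ^ 2 - γ⁻¹) • f) := by
  have hγ : γ ≠ 0 := by
    rintro rfl
    exact hf0 (hG.eq_zero_of_apply_eq_zero (by simpa using hf))
  have hlap := (hG.hasLaplacian f).smul γ⁻¹
  rwa [smul_sub, smul_comm γ⁻¹, hf, inv_smul_smul₀ hγ, ← sub_smul] at hlap

theorem exists_lt_of_orthonormal (hG : IsResolvent θ₁ θ₂ ω G) {f : ℕ → H} (hf : Orthonormal ℝ f)
    {q : ℕ → ℝ} (h : ∀ n, HasLaplacian θ₁ θ₂ (f n) (q n • f n)) (t : ℝ) : ∃ n, q n < t := by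
  by_contra! hge
  have hlt : ∀ n, q n < ω ^ 2 := fun n => hG.lt_sq (h n) (hf.ne_zero n)
  have hpos : 0 < ω ^ 2 - t := sub_pos.2 ((hge 0).trans_lt (hlt 0))
  obtain ⟨n, hn⟩ := exists_abs_lt_of_orthonormal hG.compact hf
    (fun n => hG.apply_eigenvector (h n) (hf.ne_zero n)) (inv_pos.2 hpos)
  have hqn : 0 < ω ^ 2 - q n := sub_pos.2 (hlt n)
  rw [abs_of_pos (inv_pos.2 hqn), inv_lt_inv₀ hqn hpos] at hn
  linarith [hge n]

theorem finite_eigSet_inter (hG : IsResolvent θ₁ θ₂ ω G) (t : ℝ) :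
    (eigSet θ₁ θ₂ ∩ Ici t).Finite := by
  by_contra hinf
  let q := Set.Infinite.natEmbedding _ hinf
  choose f hnorm hf using fun n => (q n).2.1
  have horth := orthonormal_of_hasLaplacian (Subtype.val_injective.comp q.injective) hnorm hf
  obtain ⟨n, hlt⟩ := hG.exists_lt_of_orthonormal horth hf t
  exact absurd (q n).2.2 (not_le.2 hlt)

theorem orthogonal_eq_bot (hG : IsResolvent θ₁ θ₂ ω G) {M : Submodule ℝ H}
    (hM : ∀ (q : ℝ) (f : H), f ≠ 0 → HasLaplacian θ₁ θ₂ f (q • f) → f ∈ M) : Mᗮ = ⊥ := by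
  rw [eq_bot_iff, ← ContinuousLinearMap.orthogonalComplement_iSup_eigenspaces_eq_bot hG.compact
    hG.isSymmetric]
  refine Submodule.orthogonal_le (iSup_le fun γ f hf => ?_)
  rcases eq_or_ne f 0 with rfl | hf0
  · exact M.zero_mem
  · exact hM _ f hf0 (hG.hasLaplacian_of_apply_eq_smul (Module.End.mem_eigenspace_iff.1 hf) hf0)

theorem infinite_eigSet (hG : IsResolvent θ₁ θ₂ ω G) : (eigSet θ₁ θ₂).Infinite := by
  intro hfin
  choose! f hnorm hf using fun (q : ℝ) (hq : q ∈ eigSet θ₁ θ₂) => hq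
  let M : Submodule ℝ H := Submodule.span ℝ (f '' eigSet θ₁ θ₂)
  have : FiniteDimensional ℝ M := FiniteDimensional.span_of_finite ℝ (hfin.image f)
  have hM : Mᗮ = ⊥ := hG.orthogonal_eq_bot fun q g hg0 hg => by
    have hq : q ∈ eigSet θ₁ θ₂ := hg.mem_eigSet hg0
    obtain ⟨r, rfl⟩ := (hf q hq).exists_eq_smul hg (norm_ne_zero_iff.1 (by simp [hnorm q hq]))
    exact M.smul_mem r (Submodule.subset_span ⟨q, hq, rfl⟩)
  refine laplacianDomain_ne_top θ₁ θ₂ (top_le_iff.1 ?_)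
  rw [← M.orthogonal_eq_bot_iff.1 hM, Submodule.span_le]
  rintro _ ⟨q, hq, rfl⟩
  exact ⟨_, hf q hq⟩

end IsResolvent

theorem exists_strictAnti_range_eq {α : Type*} [LinearOrder α] {s : Set α} (hs : s.Infinite)
    (hfin : ∀ t, (s ∩ Ici t).Finite) : ∃ q : ℕ → α, StrictAnti q ∧ range q = s := by
  obtain ⟨m, hm⟩ : ∃ m : s, ∀ y : s, y ≤ m := by
    obtain ⟨x, hx⟩ := hs.nonempty
    obtain ⟨m, hm, hmax⟩ := Set.exists_max_image _ id (hfin x) ⟨x, hx, le_refl x⟩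
    refine ⟨⟨m, hm.1⟩, fun y => ?_⟩
    rcases le_total x y with hxy | hyx
    · exact hmax y ⟨y.2, hxy⟩
    · exact hyx.trans hm.2
  let : OrderBot sᵒᵈ := { bot := OrderDual.toDual m, bot_le := fun y => hm (OrderDual.ofDual y) }
  let : LocallyFiniteOrder sᵒᵈ := LocallyFiniteOrder.ofFiniteIcc fun _ t =>
    ((hfin (OrderDual.ofDual t : s)).preimage
      (Subtype.val_injective.comp OrderDual.ofDual.injective).injOn).subset
      fun y hy => ⟨(OrderDual.ofDual y).2, hy.2⟩
  let : SuccOrder sᵒᵈ := LinearLocallyFiniteOrder.succOrder _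
  let : PredOrder sᵒᵈ := LinearLocallyFiniteOrder.predOrder _
  have : NoMaxOrder sᵒᵈ := ⟨fun t => by
    by_contra! hmax
    exact hs ((hfin (OrderDual.ofDual t : s)).subset fun y hy =>
      ⟨hy, hmax (OrderDual.toDual ⟨y, hy⟩)⟩)⟩
  let iso : sᵒᵈ ≃o ℕ := orderIsoNatOfLinearSuccPredArch
  refine ⟨fun n => (OrderDual.ofDual (iso.symm n) : s), fun n m hnm => iso.symm.strictMono hnm, ?_⟩
  ext x
  exact ⟨fun ⟨n, hn⟩ => hn ▸ (OrderDual.ofDual (iso.symm n)).2,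
    fun hx => ⟨iso (OrderDual.toDual ⟨x, hx⟩), by simp⟩⟩

theorem hasLaplacian_smul_iff {a θ₁ θ₂ : ℝ} (ha : a ≠ 0) (b c : ℝ) {q : ℝ} {f : H} :
    HasLaplacian θ₁ θ₂ f (q • f) ↔
      f ∈ domA₀ θ₁ θ₂ ∧ opA a b f + c • f = (a * q + b + c) • f := by
  have hsub : opA a b f + c • f - (a * q + b + c) • f = a • ((h2Data f).2.2 - q • f) := by
    rw [opA]
    module
  rw [hasLaplacian_iff, ← sub_eq_zero (a := opA a b f + c • f), hsub, smul_eq_zero_iff_right ha,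
    sub_eq_zero]

theorem exists_isEigensystem {a : ℝ} (ha : 0 < a) (b c θ₁ θ₂ : ℝ) :
    ∃ lam e, IsEigensystem a b c θ₁ θ₂ lam e := by
  obtain ⟨ω, G, hG⟩ := exists_isResolvent θ₁ θ₂
  obtain ⟨q, hq, hrange⟩ := exists_strictAnti_range_eq hG.infinite_eigSet hG.finite_eigSet_inter
  choose e hnorm he using fun n => hrange.le (mem_range_self n)
  have heig := fun n => (hasLaplacian_smul_iff ha.ne' b c).1 (he n)
  refine ⟨fun n => a * q n + b + c, e, fun n m hnm => ?_, fun n => (heig n).1, hnorm,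
    fun n => (heig n).2, fun μ f hf hf0 hμ => ?_⟩
  · simpa using mul_lt_mul_of_pos_left (hq hnm) ha
  · have hμq : a * ((μ - b - c) / a) + b + c = μ := by
      rw [mul_div_cancel₀ _ ha.ne']
      ring
    have hlap := (hasLaplacian_smul_iff ha.ne' b c).2 ⟨hf, hμ.trans (congrArg (· • f) hμq.symm)⟩
    obtain ⟨n, hn⟩ := hrange.ge (hlap.mem_eigSet hf0)
    exact ⟨n, by rw [hn, hμq]⟩

namespace IsEigensystem

variable {a b c θ₁ θ₂ : ℝ} {lam : ℕ → ℝ} {e : ℕ → H}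

theorem hasLaplacian (he : IsEigensystem a b c θ₁ θ₂ lam e) (ha : a ≠ 0) (n : ℕ) :
    HasLaplacian θ₁ θ₂ (e n) (((lam n - b - c) / a) • e n) := by
  refine (hasLaplacian_smul_iff ha b c).2 ⟨he.mem_dom n, ?_⟩
  rw [he.eigen n, mul_div_cancel₀ _ ha, sub_sub, sub_add, add_sub_cancel_left, sub_add_cancel]

theorem orthonormal (he : IsEigensystem a b c θ₁ θ₂ lam e) (ha : a ≠ 0) : Orthonormal ℝ e := by
  refine orthonormal_of_hasLaplacian (fun n m hnm => he.strictAnti.injective ?_) he.norm_eq_one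
    (he.hasLaplacian ha)
  simpa [div_left_inj' ha] using hnm

theorem orthogonal_span_eq_bot (he : IsEigensystem a b c θ₁ θ₂ lam e) (ha : a ≠ 0) :
    (Submodule.span ℝ (range e))ᗮ = ⊥ := by
  obtain ⟨ω, G, hG⟩ := exists_isResolvent θ₁ θ₂
  refine hG.orthogonal_eq_bot fun q f hf0 hf => ?_
  obtain ⟨hdom, heig⟩ := (hasLaplacian_smul_iff ha b c).1 hf
  obtain ⟨n, hn⟩ := he.exhaustive _ f hdom hf0 heig
  have hlap := he.hasLaplacian ha n
  rw [← hn, show (a * q + b + c - b - c) / a = q by field_simp; ring] at hlap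
  obtain ⟨r, rfl⟩ := hlap.exists_eq_smul hf ((he.orthonormal ha).ne_zero n)
  exact Submodule.smul_mem _ r (Submodule.subset_span (mem_range_self n))

theorem exists_hilbertBasis (he : IsEigensystem a b c θ₁ θ₂ lam e) (ha : a ≠ 0) :
    ∃ B : HilbertBasis ℕ ℝ H, ⇑B = e :=
  ⟨HilbertBasis.mkOfOrthogonalEqBot (he.orthonormal ha) (he.orthogonal_span_eq_bot ha),
    HilbertBasis.coe_mkOfOrthogonalEqBot _ _⟩

theorem exists_lam_lt (he : IsEigensystem a b c θ₁ θ₂ lam e) (ha : 0 < a) (t : ℝ) :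
    ∃ n, lam n < t := by
  obtain ⟨ω, G, hG⟩ := exists_isResolvent θ₁ θ₂
  obtain ⟨n, hn⟩ := hG.exists_lt_of_orthonormal (he.orthonormal ha.ne') (he.hasLaplacian ha.ne')
    ((t - b - c) / a)
  rw [div_lt_div_iff_of_pos_right ha] at hn
  exact ⟨n, by linarith⟩

end IsEigensystem

/-! ### Strongly continuous families of operators -/

section StronglyContinuous

variable {X E F : Type*} [TopologicalSpace X] [NormedAddCommGroup E] [NormedSpace ℝ E]
  [NormedAddCommGroup F] [NormedSpace ℝ F] [CompleteSpace E]

theorem exists_opNorm_le_of_isCompact {D : X → E →L[ℝ] F} {K : Set X} (hK : IsCompact K)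
    (hD : ∀ x, ContinuousOn (fun t => D t x) K) : ∃ C, ∀ t ∈ K, ‖D t‖ ≤ C := by
  obtain ⟨C, hC⟩ := banach_steinhaus (g := fun t : K => D t) fun x => by
    obtain ⟨C, hC⟩ := hK.exists_bound_of_continuousOn (hD x)
    exact ⟨C, fun t => hC t t.2⟩
  exact ⟨C, fun t ht => hC ⟨t, ht⟩⟩

theorem continuous_uncurry_of_continuous_apply [WeaklyLocallyCompactSpace X]
    {D : X → E →L[ℝ] F} (hD : ∀ x, Continuous fun t => D t x) :
    Continuous fun p : X × E => D p.1 p.2 := by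
  refine continuous_iff_continuousAt.2 fun ⟨t₀, x₀⟩ => ?_
  obtain ⟨K, hK, hKt₀⟩ := exists_compact_mem_nhds t₀
  obtain ⟨C, hC⟩ := exists_opNorm_le_of_isCompact hK fun x => (hD x).continuousOn
  have hlim : Tendsto (fun p : X × E => C * ‖p.2 - x₀‖ + ‖D p.1 x₀ - D t₀ x₀‖)
      (𝓝 (t₀, x₀)) (𝓝 0) := by
    have hcont : Continuous fun p : X × E => C * ‖p.2 - x₀‖ + ‖D p.1 x₀ - D t₀ x₀‖ := by
      have := (hD x₀).comp (continuous_fst (Y := E))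
      fun_prop
    simpa using hcont.tendsto (t₀, x₀)
  rw [ContinuousAt, tendsto_iff_norm_sub_tendsto_zero]
  refine squeeze_zero' (Eventually.of_forall fun _ => norm_nonneg _) ?_ hlim
  filter_upwards [continuous_fst.continuousAt.preimage_mem_nhds hKt₀] with p hp
  calc ‖D p.1 p.2 - D t₀ x₀‖ = ‖D p.1 (p.2 - x₀) + (D p.1 x₀ - D t₀ x₀)‖ := by
        rw [map_sub, sub_add_sub_cancel]
    _ ≤ C * ‖p.2 - x₀‖ + ‖D p.1 x₀ - D t₀ x₀‖ := by
        refine (norm_add_le _ _).trans ?_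
        gcongr
        exact (D p.1).le_of_opNorm_le (hC _ hp) _

variable {D : ℝ → E →L[ℝ] F} {f : ℝ → E}

theorem aestronglyMeasurable_apply_sub (hD : ∀ x, Continuous fun t => D t x) {μ : Measure ℝ}
    (hf : AEStronglyMeasurable f μ) (t : ℝ) :
    AEStronglyMeasurable (fun s => D (t - s) (f s)) μ :=
  (continuous_uncurry_of_continuous_apply hD).comp_aestronglyMeasurable
    ((continuous_const.sub continuous_id).aestronglyMeasurable.prodMk hf)

theorem intervalIntegrable_apply_sub (hD : ∀ x, Continuous fun t => D t x) {a b : ℝ}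
    (hf : IntervalIntegrable f volume a b) (t : ℝ) :
    IntervalIntegrable (fun s => D (t - s) (f s)) volume a b := by
  obtain ⟨C, hC⟩ := exists_opNorm_le_of_isCompact (D := fun s => D (t - s)) isCompact_uIcc
    fun x => ((hD x).comp (continuous_const.sub continuous_id)).continuousOn (s := uIcc a b)
  refine (hf.norm.const_mul C).mono_fun'
    (aestronglyMeasurable_apply_sub hD hf.def'.aestronglyMeasurable t) ?_
  filter_upwards [ae_restrict_mem measurableSet_uIoc] with s hs
  exact (D (t - s)).le_of_opNorm_le (hC s (uIoc_subset_uIcc hs)) _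

theorem continuous_integral_apply_sub (hD : ∀ x, Continuous fun t => D t x)
    (hf : ∀ a b, IntervalIntegrable f volume a b) (a : ℝ) :
    Continuous fun t => ∫ s in a..t, D (t - s) (f s) := by
  refine continuous_iff_continuousAt.2 fun t₀ => ?_
  set l := min a t₀ - 1
  set r := max a t₀ + 1
  have hal : l < min a t₀ := sub_one_lt _
  have har : max a t₀ < r := lt_add_one _
  obtain ⟨C, hC⟩ := exists_opNorm_le_of_isCompact (D := D)
    (isCompact_Icc (a := t₀ - 1 - r) (b := t₀ + 1 - l)) fun x => (hD x).continuousOn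
  have hjoint := intervalIntegral.continuousAt_parametric_primitive_of_dominated (μ := volume)
    (F := fun t s => D (t - s) (f s)) (bound := fun s => C * ‖f s‖) (x₀ := t₀) l r
    (fun t => aestronglyMeasurable_apply_sub hD (hf l r).def'.aestronglyMeasurable t) ?_
    ((hf l r).norm.const_mul C)
    (Eventually.of_forall fun s => ((hD (f s)).comp (continuous_sub_right s)).continuousAt)
    ⟨hal.trans_le (min_le_left _ _), (le_max_left _ _).trans_lt har⟩
    ⟨hal.trans_le (min_le_right _ _), (le_max_right _ _).trans_lt har⟩ (measure_singleton _)
  · exact hjoint.comp (f := fun t => (t, t)) (continuous_id.prodMk continuous_id).continuousAt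
  · filter_upwards [Icc_mem_nhds (sub_one_lt t₀) (lt_add_one t₀)] with t ht
    filter_upwards [ae_restrict_mem measurableSet_uIoc] with s hs
    rw [uIoc_of_le (by linarith [min_le_left a t₀, le_max_left a t₀])] at hs
    exact (D (t - s)).le_of_opNorm_le (hC _ ⟨by linarith [ht.1, hs.2], by linarith [ht.2, hs.1]⟩) _

theorem continuousOn_integral_apply_sub (hD : ∀ x, Continuous fun t => D t x)
    (hf : ∀ T, 0 ≤ T → IntervalIntegrable f volume 0 T) :
    ContinuousOn (fun t => ∫ s in (0 : ℝ)..t, D (t - s) (f s)) (Ici 0) := by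
  have hf' : ∀ a b, IntervalIntegrable ((Ioi 0).indicator f) volume a b := by
    suffices h : ∀ b, IntervalIntegrable ((Ioi 0).indicator f) volume 0 b from
      fun a b => (h a).symm.trans (h b)
    intro b
    rcases le_total 0 b with hb | hb
    · refine (hf b hb).congr fun s hs => ?_
      rw [uIoc_of_le hb] at hs
      exact (indicator_of_mem (mem_Ioi.2 hs.1) f).symm
    · refine (intervalIntegrable_const (c := (0 : E))).congr fun s hs => ?_
      rw [uIoc_of_ge hb] at hs
      exact (indicator_of_notMem (notMem_Ioi.2 hs.2) f).symm
  refine (continuous_integral_apply_sub hD hf' 0).continuousOn.congr fun t ht => ?_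
  refine intervalIntegral.integral_congr_uIoo fun s hs => ?_
  rw [uIoo_of_le ht] at hs
  simp only [indicator_of_mem (mem_Ioi.2 hs.1)]

end StronglyContinuous

/-! ### Diagonal semigroups -/

theorem hasDerivAt_exp_mul (r t : ℝ) :
    HasDerivAt (fun s => Real.exp (r * s)) (r * Real.exp (r * t)) t := by
  simpa [mul_comm] using ((hasDerivAt_id t).const_mul r).exp

section Diagonal

variable {ι E : Type*} [NormedAddCommGroup E] [InnerProductSpace ℝ E] (B : HilbertBasis ι ℝ E)

theorem hilbertBasis_ext {x y : E} (h : ∀ n, inner ℝ (B n) x = inner ℝ (B n) y) : x = y :=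
  B.repr.injective <| by
    ext n
    rw [B.repr_apply_apply, B.repr_apply_apply, h]

theorem hasSum_sq_inner (x : E) : HasSum (fun n => inner ℝ (B n) x ^ 2) (‖x‖ ^ 2) := by
  have := B.hasSum_inner_mul_inner x x
  rw [real_inner_self_eq_norm_sq] at this
  exact this.congr_fun fun n => by rw [real_inner_comm, sq]

theorem exists_inner_eq {y : ι → ℝ} (hy : Summable fun n => y n ^ 2) :
    ∃ x : E, ∀ n, inner ℝ (B n) x = y n := by
  have hmem : Memℓp y 2 := (memℓp_gen_iff (by norm_num)).2 (by simpa using hy)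
  refine ⟨B.repr.symm ⟨y, hmem⟩, fun n => ?_⟩
  rw [← B.repr_apply_apply, LinearIsometryEquiv.apply_symm_apply]

theorem tendsto_zero_of_inner {α : Type*} {l : Filter α} {y : α → E} {a : ι → ℝ}
    (ha : Summable fun n => a n ^ 2) (hya : ∀ᶠ t in l, ∀ n, |inner ℝ (B n) (y t)| ≤ a n)
    (hy : ∀ n, Tendsto (fun t => inner ℝ (B n) (y t)) l (𝓝 0)) : Tendsto y l (𝓝 0) := by
  have hsq : Tendsto (fun t => ‖y t‖ ^ 2) l (𝓝 0) := by
    simp_rw [← (hasSum_sq_inner B _).tsum_eq]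
    rw [← tsum_zero (α := ℝ) (β := ι)]
    refine tendsto_tsum_of_dominated_convergence ha (fun n => ?_) ?_
    · simpa using (hy n).pow 2
    · filter_upwards [hya] with t ht n
      rw [norm_pow, Real.norm_eq_abs]
      exact pow_le_pow_left₀ (abs_nonneg _) (ht n) 2
  rw [tendsto_zero_iff_norm_tendsto_zero]
  simpa using hsq.sqrt

theorem exists_diagonal {m : ι → ℝ} {C : ℝ} (hC0 : 0 ≤ C) (hC : ∀ n, |m n| ≤ C) :
    ∃ T : E →L[ℝ] E, (∀ x n, inner ℝ (B n) (T x) = m n * inner ℝ (B n) x) ∧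
      ∀ x, ‖T x‖ ≤ C * ‖x‖ := by
  have hle : ∀ x n, (m n * inner ℝ (B n) x) ^ 2 ≤ C ^ 2 * inner ℝ (B n) x ^ 2 := fun x n => by
    rw [mul_pow]
    exact mul_le_mul_of_nonneg_right (sq_le_sq' (abs_le.1 (hC n)).1 (abs_le.1 (hC n)).2)
      (sq_nonneg _)
  choose T hT using fun x => exists_inner_eq B
    (((hasSum_sq_inner B x).summable.mul_left (C ^ 2)).of_nonneg_of_le (fun n => sq_nonneg _)
      (hle x))
  have hnorm : ∀ x, ‖T x‖ ≤ C * ‖x‖ := fun x => by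
    refine le_of_sq_le_sq ?_ (by positivity)
    rw [mul_pow]
    refine hasSum_le (fun n => ?_) (hasSum_sq_inner B (T x))
      ((hasSum_sq_inner B x).mul_left (C ^ 2))
    rw [hT]
    exact hle x n
  let L : E →ₗ[ℝ] E :=
    { toFun := T
      map_add' := fun x y => hilbertBasis_ext B fun n => by
        rw [inner_add_right, hT, hT, hT, inner_add_right, mul_add]
      map_smul' := fun s x => hilbertBasis_ext B fun n => by
        rw [RingHom.id_apply, inner_smul_right, hT, hT, inner_smul_right, mul_left_comm] }
  exact ⟨L.mkContinuous C hnorm, hT, hnorm⟩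

/-- The semigroup `D` which is diagonal in the Hilbert basis `B`, with rates `ν n` bounded above by
`w`. It is extended by the identity to `t ≤ 0`, so as to be strongly continuous on `ℝ`. -/
structure IsDiagSemigroup (ν : ι → ℝ) (w : ℝ) (D : ℝ → E →L[ℝ] E) : Prop where
  rate_le : ∀ n, ν n ≤ w
  inner_apply : ∀ t x n, inner ℝ (B n) (D t x) = Real.exp (ν n * max t 0) * inner ℝ (B n) x
  norm_apply_le : ∀ t x, ‖D t x‖ ≤ Real.exp (w * max t 0) * ‖x‖

theorem exists_isDiagSemigroup {ν : ι → ℝ} {w : ℝ} (h : ∀ n, ν n ≤ w) :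
    ∃ D, IsDiagSemigroup B ν w D := by
  choose D hDinner hDnorm using fun t : ℝ => exists_diagonal B
    (m := fun n => Real.exp (ν n * max t 0)) (Real.exp_nonneg (w * max t 0)) fun n => by
      rw [Real.abs_exp]
      gcongr
      exact h n
  exact ⟨D, h, hDinner, hDnorm⟩

namespace IsDiagSemigroup

variable {B} {ν : ι → ℝ} {w : ℝ} {D : ℝ → E →L[ℝ] E}

theorem continuous_apply (hD : IsDiagSemigroup B ν w D) (x : E) : Continuous fun t => D t x := by
  refine continuous_iff_continuousAt.2 fun t₀ => tendsto_sub_nhds_zero_iff.1 ?_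
  set M := Real.exp (w * max t₀ 0) + 1
  have hM : ∀ᶠ t in 𝓝 t₀, Real.exp (w * max t 0) < M :=
    ((by fun_prop : Continuous fun t : ℝ => Real.exp (w * max t 0)).tendsto t₀).eventually_lt_const
      (lt_add_one _)
  have hle : ∀ t n, Real.exp (ν n * max t 0) ≤ Real.exp (w * max t 0) := fun t n => by
    gcongr
    exact hD.rate_le n
  have hinner : ∀ t n, inner ℝ (B n) (D t x - D t₀ x) =
      (Real.exp (ν n * max t 0) - Real.exp (ν n * max t₀ 0)) * inner ℝ (B n) x := fun t n => by
    rw [inner_sub_right, hD.inner_apply, hD.inner_apply, sub_mul]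
  refine tendsto_zero_of_inner B (a := fun n => M * |inner ℝ (B n) x|) ?_ ?_ fun n => ?_
  · simpa only [mul_pow, sq_abs] using (hasSum_sq_inner B x).summable.mul_left (M ^ 2)
  · filter_upwards [hM] with t ht n
    rw [hinner, abs_mul]
    gcongr
    exact abs_sub_le_of_nonneg_of_le (Real.exp_nonneg _) ((hle t n).trans ht.le)
      (Real.exp_nonneg _) ((hle t₀ n).trans hM.self_of_nhds.le)
  · simp only [hinner]
    have hcont : Continuous fun t : ℝ =>
        (Real.exp (ν n * max t 0) - Real.exp (ν n * max t₀ 0)) * inner ℝ (B n) x := by fun_prop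
    simpa using hcont.tendsto t₀

theorem norm_apply_le_of_nonneg (hD : IsDiagSemigroup B ν w D) (t : ℝ) (ht : 0 ≤ t) (x : E) :
    ‖D t x‖ ≤ Real.exp (w * t) * ‖x‖ := by
  simpa only [max_eq_left ht] using hD.norm_apply_le t x

theorem zero (hD : IsDiagSemigroup B ν w D) : D 0 = ContinuousLinearMap.id ℝ E := by
  ext x
  refine hilbertBasis_ext B fun n => ?_
  simp [hD.inner_apply]

theorem add (hD : IsDiagSemigroup B ν w D) {s t : ℝ} (hs : 0 ≤ s) (ht : 0 ≤ t) :
    D (s + t) = (D s).comp (D t) := by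
  ext x
  refine hilbertBasis_ext B fun n => ?_
  rw [ContinuousLinearMap.comp_apply, hD.inner_apply, hD.inner_apply, hD.inner_apply,
    max_eq_left hs, max_eq_left ht, max_eq_left (add_nonneg hs ht), mul_add, Real.exp_add,
    mul_assoc]

theorem apply_basis (hD : IsDiagSemigroup B ν w D) {t : ℝ} (ht : 0 ≤ t) (n : ι) :
    D t (B n) = Real.exp (ν n * t) • B n := by
  refine hilbertBasis_ext B fun m => ?_
  rw [hD.inner_apply, inner_smul_right, max_eq_left ht]
  by_cases h : m = n
  · rw [h]
  · rw [B.orthonormal.2 h, mul_zero, mul_zero]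

theorem integral_apply [CompleteSpace E] (hD : IsDiagSemigroup B ν w D) {f g : E}
    (hfg : ∀ n, inner ℝ (B n) g = ν n * inner ℝ (B n) f) {t : ℝ} (ht : 0 ≤ t) :
    ∫ s in (0 : ℝ)..t, D s g = D t f - f := by
  refine hilbertBasis_ext B fun n => ?_
  calc inner ℝ (B n) (∫ s in (0 : ℝ)..t, D s g)
      = ∫ s in (0 : ℝ)..t, inner ℝ (B n) (D s g) :=
        ((innerSL ℝ (B n)).intervalIntegral_comp_comm
          ((hD.continuous_apply g).intervalIntegrable 0 t)).symm
    _ = ∫ s in (0 : ℝ)..t, ν n * Real.exp (ν n * s) * inner ℝ (B n) f := by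
        refine intervalIntegral.integral_congr fun s hs => ?_
        rw [uIcc_of_le ht] at hs
        simp only [hD.inner_apply, max_eq_left hs.1, hfg n]
        ring
    _ = (Real.exp (ν n * t) - 1) * inner ℝ (B n) f := by
        rw [intervalIntegral.integral_mul_const, intervalIntegral.integral_eq_sub_of_hasDerivAt
          (fun s _ => hasDerivAt_exp_mul (ν n) s) (Continuous.intervalIntegrable (by fun_prop) _ _),
          mul_zero, Real.exp_zero]
    _ = inner ℝ (B n) (D t f - f) := by
        rw [inner_sub_right, hD.inner_apply, max_eq_left ht, sub_mul, one_mul]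

theorem tendsto_generator_iff [CompleteSpace E] (hD : IsDiagSemigroup B ν w D) (f g : E) :
    Tendsto (fun t : ℝ => t⁻¹ • (D t f - f)) (𝓝[>] 0) (𝓝 g) ↔
      ∀ n, inner ℝ (B n) g = ν n * inner ℝ (B n) f := by
  constructor
  · intro hlim n
    have hslope : Tendsto (fun t : ℝ => inner ℝ (B n) (t⁻¹ • (D t f - f))) (𝓝[>] 0)
        (𝓝 (ν n * inner ℝ (B n) f)) := by
      have hderiv := (hasDerivAt_exp_mul (ν n) 0).hasDerivWithinAt (s := Ioi 0)
      rw [hasDerivWithinAt_iff_tendsto_slope' self_notMem_Ioi] at hderiv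
      simp only [mul_zero, Real.exp_zero, mul_one] at hderiv
      refine (hderiv.mul_const (inner ℝ (B n) f)).congr' ?_
      filter_upwards [self_mem_nhdsWithin] with t ht
      rw [inner_smul_right, inner_sub_right, hD.inner_apply, max_eq_left (le_of_lt ht),
        slope_def_field, mul_zero, Real.exp_zero]
      ring
    exact tendsto_nhds_unique (tendsto_const_nhds.inner hlim) hslope
  · intro hfg
    have hderiv := ((hD.continuous_apply g).integral_hasStrictDerivAt 0 0).hasDerivAt
      |>.hasDerivWithinAt (s := Ioi 0)
    rw [hasDerivWithinAt_iff_tendsto_slope' self_notMem_Ioi, hD.zero] at hderiv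
    refine hderiv.congr' ?_
    filter_upwards [self_mem_nhdsWithin] with t ht
    rw [slope_def_module, intervalIntegral.integral_same, sub_zero, sub_zero,
      hD.integral_apply hfg (le_of_lt ht)]

end IsDiagSemigroup

end Diagonal

/-! ### The semigroup generated by `𝒜₀` -/

namespace IsEigensystem

variable {a b c θ₁ θ₂ : ℝ} {lam : ℕ → ℝ} {e : ℕ → H} {B : HilbertBasis ℕ ℝ H}

theorem inner_opA (he : IsEigensystem a b c θ₁ θ₂ lam e) (ha : a ≠ 0) {f : H}
    (hf : f ∈ domA₀ θ₁ θ₂) (n : ℕ) :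
    inner ℝ (e n) (opA a b f) = (lam n - c) * inner ℝ (e n) f := by
  have hgreen := (he.hasLaplacian ha n).inner_comm (hasLaplacian_iff.2 ⟨hf, rfl⟩)
  rw [opA, inner_add_right, inner_smul_right, inner_smul_right, ← hgreen, real_inner_smul_left]
  field

theorem mem_domA₀_and_eq_opA_iff (he : IsEigensystem a b c θ₁ θ₂ lam e) (ha : a ≠ 0)
    (hB : ⇑B = e) (f g : H) :
    (f ∈ domA₀ θ₁ θ₂ ∧ g = opA a b f) ↔
      ∀ n, inner ℝ (B n) g = (lam n - c) * inner ℝ (B n) f := by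
  rw [hB]
  refine ⟨fun ⟨hf, hg⟩ n => hg ▸ he.inner_opA ha hf n, fun h => ?_⟩
  obtain ⟨ω, G, hG⟩ := exists_isResolvent θ₁ θ₂
  set w : H := a⁻¹ • (g - b • f) with hw
  have hGf : f = G (ω ^ 2 • f - w) := hilbertBasis_ext B fun n => by
    have hlap := he.hasLaplacian ha n
    have hne := (he.orthonormal ha).ne_zero n
    have hlt := hG.lt_sq hlap hne
    have hsymm : inner ℝ (G (e n)) (ω ^ 2 • f - w) = inner ℝ (e n) (G (ω ^ 2 • f - w)) :=
      hG.isSymmetric (e n) _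
    rw [hB, ← hsymm, hG.apply_eigenvector hlap hne, real_inner_smul_left,
      eq_inv_mul_iff_mul_eq₀ (sub_pos.2 hlt).ne', inner_sub_right, inner_smul_right, hw,
      inner_smul_right, inner_sub_right, inner_smul_right, h n]
    field
  have hlap : HasLaplacian θ₁ θ₂ f w := by
    have := (hG.hasLaplacian_iff (ω ^ 2 • f - w) f).2 hGf
    rwa [sub_sub_cancel] at this
  obtain ⟨hf, hfw⟩ := hasLaplacian_iff.1 hlap
  exact ⟨hf, by rw [opA, hfw, hw, smul_inv_smul₀ ha, sub_add_cancel]⟩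

theorem isGeneratedByA₀ (he : IsEigensystem a b c θ₁ θ₂ lam e) (ha : a ≠ 0) (hB : ⇑B = e) {w : ℝ}
    {D : ℝ → H →L[ℝ] H} (hD : IsDiagSemigroup B (fun n => lam n - c) w D) :
    IsGeneratedByA₀ a b θ₁ θ₂ D := by
  refine ⟨⟨hD.zero, fun s t => hD.add, fun x => ?_⟩, fun f g => ?_⟩
  · have := (hD.continuous_apply x).tendsto 0
    rw [hD.zero] at this
    exact this.mono_left nhdsWithin_le_nhds
  · rw [hD.tendsto_generator_iff, he.mem_domA₀_and_eq_opA_iff ha hB]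

end IsEigensystem

namespace IsC0Semigroup

variable {S : ℝ → H →L[ℝ] H}

theorem apply_eq_apply_sub (hS : IsC0Semigroup S) {s t : ℝ} (hs : 0 ≤ s) (hst : s ≤ t) (x : H) :
    S t x = S s (S (t - s) x) := by
  rw [← ContinuousLinearMap.comp_apply, ← hS.add _ _ hs (sub_nonneg.2 hst), add_sub_cancel]

theorem tendsto_nhdsGE (hS : IsC0Semigroup S) (x : H) :
    Tendsto (fun s => S s x) (𝓝[≥] 0) (𝓝 x) := by
  have hIoi : ContinuousWithinAt (fun s => S s x) (Ioi 0) 0 := by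
    simpa [ContinuousWithinAt, hS.zero] using hS.strongly_continuous x
  simpa [ContinuousWithinAt, hS.zero] using continuousWithinAt_Ioi_iff_Ici.1 hIoi

theorem exists_opNorm_le_nhds_zero (hS : IsC0Semigroup S) :
    ∃ δ > 0, ∃ M, ∀ t ∈ Icc 0 δ, ‖S t‖ ≤ M := by
  by_contra! hunbdd
  choose t ht hbig using fun n : ℕ => hunbdd (1 / ((n : ℝ) + 1)) (by positivity) n
  have hlim : Tendsto t atTop (𝓝[≥] 0) :=
    tendsto_nhdsWithin_iff.2 ⟨squeeze_zero (fun n => (ht n).1) (fun n => (ht n).2)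
      tendsto_one_div_add_atTop_nhds_zero_nat, Eventually.of_forall fun n => (ht n).1⟩
  obtain ⟨C, hC⟩ := banach_steinhaus (g := fun n => S (t n)) fun x => by
    obtain ⟨C, hC⟩ := ((hS.tendsto_nhdsGE x).comp hlim).norm.bddAbove_range
    exact ⟨C, fun n => hC ⟨n, rfl⟩⟩
  obtain ⟨n, hn⟩ := exists_nat_gt C
  linarith [hC n, hbig n]

theorem exists_opNorm_le (hS : IsC0Semigroup S) (T : ℝ) : ∃ M, ∀ t ∈ Icc 0 T, ‖S t‖ ≤ M := by
  obtain ⟨δ, hδ, M₀, hM₀⟩ := hS.exists_opNorm_le_nhds_zero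
  have hstep : ∀ n : ℕ, ∃ M, ∀ t ∈ Icc 0 (n • δ), ‖S t‖ ≤ M := by
    intro n
    induction n with
    | zero => exact ⟨M₀, fun t ht => hM₀ t ⟨ht.1, by linarith [ht.2, zero_nsmul δ]⟩⟩
    | succ n ih =>
      obtain ⟨M, hM⟩ := ih
      refine ⟨max M₀ (‖S δ‖ * M), fun t ht => ?_⟩
      rcases le_total t δ with htδ | htδ
      · exact (hM₀ t ⟨ht.1, htδ⟩).trans (le_max_left _ _)
      · have hsplit : S t = (S δ).comp (S (t - δ)) :=
          ContinuousLinearMap.ext (hS.apply_eq_apply_sub hδ.le htδ)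
        rw [hsplit]
        refine ((ContinuousLinearMap.opNorm_comp_le _ _).trans ?_).trans (le_max_right _ _)
        gcongr
        exact hM _ ⟨sub_nonneg.2 htδ, by linarith [ht.2, succ_nsmul δ n]⟩
  obtain ⟨n, hn⟩ := Archimedean.arch T hδ
  obtain ⟨M, hM⟩ := hstep n
  exact ⟨M, fun t ht => hM t ⟨ht.1, ht.2.trans hn⟩⟩

theorem norm_apply_sub_le (hS : IsC0Semigroup S) {T M : ℝ} (hM : ∀ t ∈ Icc 0 T, ‖S t‖ ≤ M)
    {s t : ℝ} (hs : s ∈ Icc 0 T) (ht : t ∈ Icc 0 T) (x : H) :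
    ‖S s x - S t x‖ ≤ M * ‖S |s - t| x - x‖ := by
  wlog hst : s ≤ t generalizing s t
  · rw [norm_sub_rev, abs_sub_comm]
    exact this ht hs (le_of_not_ge hst)
  rw [norm_sub_rev, abs_sub_comm, abs_of_nonneg (sub_nonneg.2 hst),
    hS.apply_eq_apply_sub hs.1 hst, ← map_sub]
  exact (S s).le_of_opNorm_le (hM s hs) _

theorem continuousOn (hS : IsC0Semigroup S) (x : H) : ContinuousOn (fun t => S t x) (Ici 0) := by
  intro t ht
  obtain ⟨M, hM⟩ := hS.exists_opNorm_le (t + 1)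
  have habs : Tendsto (fun s => |s - t|) (𝓝[Ici 0] t) (𝓝[≥] 0) := by
    refine tendsto_nhdsWithin_iff.2 ⟨?_, Eventually.of_forall fun s => mem_Ici.2 (abs_nonneg _)⟩
    have : Continuous fun s : ℝ => |s - t| := by fun_prop
    simpa using (this.tendsto t).mono_left nhdsWithin_le_nhds
  have hlim : Tendsto (fun s => M * ‖S |s - t| x - x‖) (𝓝[Ici 0] t) (𝓝 0) := by
    simpa using (tendsto_iff_norm_sub_tendsto_zero.1 ((hS.tendsto_nhdsGE x).comp habs)).const_mul M
  rw [ContinuousWithinAt, tendsto_iff_norm_sub_tendsto_zero]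
  refine squeeze_zero' (Eventually.of_forall fun _ => norm_nonneg _) ?_ hlim
  filter_upwards [self_mem_nhdsWithin, nhdsWithin_le_nhds (Iic_mem_nhds (lt_add_one t))]
    with s hs hst using hS.norm_apply_sub_le hM ⟨hs, hst⟩ ⟨ht, (lt_add_one t).le⟩ x

theorem hasDerivWithinAt_Ici (hS : IsC0Semigroup S) {f g : H}
    (hfg : Tendsto (fun t : ℝ => t⁻¹ • (S t f - f)) (𝓝[>] 0) (𝓝 g)) {s : ℝ} (hs : 0 ≤ s) :
    HasDerivWithinAt (fun t => S t f) (S s g) (Ici s) s := by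
  rw [← hasDerivWithinAt_Ioi_iff_Ici, hasDerivWithinAt_iff_tendsto_slope' self_notMem_Ioi]
  have hsub : Tendsto (fun t => t - s) (𝓝[>] s) (𝓝[>] 0) := by
    refine tendsto_nhdsWithin_iff.2 ⟨?_, ?_⟩
    · have : Continuous fun t : ℝ => t - s := by fun_prop
      simpa using (this.tendsto s).mono_left nhdsWithin_le_nhds
    · filter_upwards [self_mem_nhdsWithin] with t ht using mem_Ioi.2 (sub_pos.2 ht)
  refine (((S s).continuous.tendsto g).comp (hfg.comp hsub)).congr' ?_
  filter_upwards [self_mem_nhdsWithin] with t ht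
  simp only [Function.comp_apply, map_smul, map_sub, slope_def_module,
    hS.apply_eq_apply_sub hs (le_of_lt ht)]

end IsC0Semigroup

namespace IsGeneratedByA₀

variable {a b θ₁ θ₂ : ℝ} {S : ℝ → H →L[ℝ] H}

theorem apply_eigenvector (hS : IsGeneratedByA₀ a b θ₁ θ₂ S) {f : H} (hf : f ∈ domA₀ θ₁ θ₂) {r : ℝ}
    (hr : opA a b f = r • f) {t : ℝ} (ht : 0 ≤ t) : S t f = Real.exp (r * t) • f := by
  have hgen := (hS.2 f (r • f)).2 ⟨hf, hr.symm⟩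
  have hexp : ∀ s : ℝ, HasDerivAt (fun s => Real.exp (r * s) • f) (r • Real.exp (r * s) • f) s :=
    fun s => (hasDerivAt_exp_mul r s).smul_const f |>.congr_deriv (mul_smul _ _ _)
  refine ODE_solution_unique_of_mem_Icc_right (v := fun _ x => r • x) (s := fun _ => univ)
    (f := fun s => S s f) (g := fun s => Real.exp (r * s) • f) (K := ‖r‖₊)
    (fun s _ => (lipschitzWith_smul r).lipschitzOnWith)
    ((hS.1.continuousOn f).mono Icc_subset_Ici_self) (fun s hs => ?_) (fun _ _ => mem_univ _)
    (fun s _ => (hexp s).continuousAt.continuousWithinAt)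
    (fun s _ => (hexp s).hasDerivWithinAt) (fun _ _ => mem_univ _) ?_ (right_mem_Icc.2 ht)
  · simpa only [map_smul] using hS.1.hasDerivWithinAt_Ici hgen hs.1
  · simp [hS.1.zero]

theorem eq_of_isDiagSemigroup (hS : IsGeneratedByA₀ a b θ₁ θ₂ S) {c : ℝ} {lam : ℕ → ℝ} {e : ℕ → H}
    (he : IsEigensystem a b c θ₁ θ₂ lam e) {B : HilbertBasis ℕ ℝ H} (hB : ⇑B = e) {w : ℝ}
    {D : ℝ → H →L[ℝ] H} (hD : IsDiagSemigroup B (fun n => lam n - c) w D) {t : ℝ} (ht : 0 ≤ t) :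
    S t = D t := by
  refine ContinuousLinearMap.ext_on (s := range B)
    (Submodule.dense_iff_topologicalClosure_eq_top.2 B.dense_span) ?_
  rintro _ ⟨n, rfl⟩
  rw [hD.apply_basis ht, hB]
  refine hS.apply_eigenvector (he.mem_dom n) ?_ ht
  rw [sub_smul, ← he.eigen n, add_sub_cancel_right]

end IsGeneratedByA₀

theorem exists_isGeneratedByA₀ {a : ℝ} (ha : 0 < a) (b θ₁ θ₂ : ℝ) :
    ∃ S, IsGeneratedByA₀ a b θ₁ θ₂ S := by
  obtain ⟨lam, e, he⟩ := exists_isEigensystem ha b 0 θ₁ θ₂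
  obtain ⟨B, hB⟩ := he.exists_hilbertBasis ha.ne'
  obtain ⟨D, hD⟩ := exists_isDiagSemigroup B (ν := fun n => lam n - 0) (w := lam 0 - 0) fun n =>
    sub_le_sub_right (he.strictAnti.antitone n.zero_le) 0
  exact ⟨D, he.isGeneratedByA₀ ha.ne' hB hD⟩

/-! ### Variation of constants -/

theorem exp_neg_mul_exp_mul (r t : ℝ) : Real.exp (-r * t) * Real.exp (r * t) = 1 := by
  rw [← Real.exp_add, neg_mul, neg_add_cancel, Real.exp_zero]

theorem integral_exp_mul_sub (r t : ℝ) (g : ℝ → ℝ) :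
    ∫ s in (0 : ℝ)..t, Real.exp (r * (t - s)) * g s =
      Real.exp (r * t) * ∫ s in (0 : ℝ)..t, Real.exp (-r * s) * g s := by
  rw [← intervalIntegral.integral_const_mul]
  refine intervalIntegral.integral_congr fun s _ => ?_
  rw [← mul_assoc, ← Real.exp_add]
  ring_nf

theorem IsPrimitiveOn.exp_mul {y q : ℝ → ℝ} {a b : ℝ} (hy : IsPrimitiveOn y q a b) (r : ℝ) :
    IsPrimitiveOn (fun t => Real.exp (r * t) * y t)
      (fun t => r * Real.exp (r * t) * y t + Real.exp (r * t) * q t) a b :=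
  (of_hasDerivAt (hasDerivAt_exp_mul r) (by fun_prop)).mul hy

theorem isPrimitiveOn_linear_iff {y g : ℝ → ℝ} {r T : ℝ} (hg : IntervalIntegrable g volume 0 T) :
    IsPrimitiveOn y (fun s => r * y s + g s) 0 T ↔
      ∀ t ∈ uIcc 0 T,
        y t = Real.exp (r * t) * y 0 + ∫ s in (0 : ℝ)..t, Real.exp (r * (t - s)) * g s := by
  have hinv := exp_neg_mul_exp_mul r
  constructor
  · intro hy t ht
    have hz : IsPrimitiveOn (fun t => Real.exp (-r * t) * y t) (fun s => Real.exp (-r * s) * g s)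
        0 T := (hy.exp_mul (-r)).congr_right (ae_of_all _ fun s _ => by ring)
    have hzt := hz.eq_add_integral t ht
    simp only [mul_zero, Real.exp_zero, one_mul] at hzt
    rw [integral_exp_mul_sub, ← mul_add, ← hzt]
    linear_combination -y t * hinv t
  · intro hy
    have hz : IsPrimitiveOn (fun t => Real.exp (-r * t) * y t) (fun s => Real.exp (-r * s) * g s)
        0 T := by
      refine ⟨hg.continuousOn_mul (by fun_prop), fun t ht => ?_⟩
      simp only [mul_zero, Real.exp_zero, one_mul]
      rw [hy t ht, integral_exp_mul_sub]
      linear_combination (y 0 + ∫ s in (0 : ℝ)..t, Real.exp (-r * s) * g s) * hinv t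
    refine ((hz.exp_mul r).congr_left fun t _ => ?_).congr_right (ae_of_all _ fun t _ => ?_)
    · linear_combination y t * hinv t
    · linear_combination (r * y t + g t) * hinv t

/-- `y` is a mild solution on `ℝ₊` of `y' = A y + F`, where `A` is the generator of the semigroup
`D`: it satisfies the variation of constants formula. -/
def IsDuhamelSolution {E : Type*} [NormedAddCommGroup E] [NormedSpace ℝ E]
    (D : ℝ → E →L[ℝ] E) (F y : ℝ → E) : Prop :=
  ∀ t, 0 ≤ t → y t = D t (y 0) + ∫ s in (0 : ℝ)..t, D (t - s) (F s)

section Duhamel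

variable {ι E : Type*} [NormedAddCommGroup E] [InnerProductSpace ℝ E] [CompleteSpace E]
  {B : HilbertBasis ι ℝ E} {ν : ι → ℝ} {w : ℝ} {D : ℝ → E →L[ℝ] E}
  {F y : ℝ → E}

theorem IsDiagSemigroup.inner_duhamel (hD : IsDiagSemigroup B ν w D) {t : ℝ} (ht : 0 ≤ t)
    (hF : IntervalIntegrable F volume 0 t) (x : E) (n : ι) :
    inner ℝ (B n) (D t x + ∫ s in (0 : ℝ)..t, D (t - s) (F s)) =
      Real.exp (ν n * t) * inner ℝ (B n) x +
        ∫ s in (0 : ℝ)..t, Real.exp (ν n * (t - s)) * inner ℝ (B n) (F s) := by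
  have hcomm := (innerSL ℝ (B n)).intervalIntegral_comp_comm
    (intervalIntegrable_apply_sub hD.continuous_apply hF t)
  simp only [innerSL_apply_apply] at hcomm
  rw [inner_add_right, hD.inner_apply, max_eq_left ht, ← hcomm]
  congr 1
  refine intervalIntegral.integral_congr fun s hs => ?_
  rw [uIcc_of_le ht] at hs
  simp only [hD.inner_apply, max_eq_left (sub_nonneg.2 hs.2)]

theorem IsDiagSemigroup.isDuhamelSolution_iff (hD : IsDiagSemigroup B ν w D)
    (hF : ∀ T, 0 ≤ T → IntervalIntegrable F volume 0 T) :
    IsDuhamelSolution D F y ↔ ∀ n T, 0 ≤ T →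
      IsPrimitiveOn (fun t => inner ℝ (B n) (y t))
        (fun s => ν n * inner ℝ (B n) (y s) + inner ℝ (B n) (F s)) 0 T := by
  have hFn : ∀ n T, 0 ≤ T → IntervalIntegrable (fun s => inner ℝ (B n) (F s)) volume 0 T :=
    fun n T hT => ⟨(hF T hT).1.const_inner _, (hF T hT).2.const_inner _⟩
  constructor
  · intro hy n T hT
    refine (isPrimitiveOn_linear_iff (hFn n T hT)).2 fun t ht => ?_
    rw [uIcc_of_le hT] at ht
    conv_lhs => rw [hy t ht.1]
    exact hD.inner_duhamel ht.1 (hF t ht.1) _ n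
  · intro hy t ht
    refine hilbertBasis_ext B fun n => ?_
    rw [hD.inner_duhamel ht (hF t ht)]
    exact (isPrimitiveOn_linear_iff (hFn n t ht)).1 (hy n t ht) t right_mem_uIcc

end Duhamel

/-! ### The method of steps -/

section Causal

variable {X : Type*} {a δ : ℝ} {P : (ℝ → X) → ℝ → X}

/-- On `[a, ∞)`, the values of `P y` before time `T + δ` depend only on those of `y` before time
`T`. For `δ > 0` this lets the equation `y = P y` be solved step by step. -/
def IsStrictlyCausal (a δ : ℝ) (P : (ℝ → X) → ℝ → X) : Prop :=
  ∀ T y y', EqOn y y' (Ico a T) → EqOn (P y) (P y') (Ico a (T + δ))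

theorem IsStrictlyCausal.succ (hP : IsStrictlyCausal a δ P) {y y' : ℝ → X} {n : ℕ}
    (h : EqOn y y' (Ico a (a + n * δ))) : EqOn (P y) (P y') (Ico a (a + (n + 1 : ℕ) * δ)) := by
  convert hP _ y y' h using 2
  push_cast
  ring

theorem exists_lt_add_natCast_mul (hδ : 0 < δ) (t : ℝ) : ∃ n : ℕ, t < a + n * δ := by
  obtain ⟨n, hn⟩ := exists_nat_gt ((t - a) / δ)
  exact ⟨n, by linarith [(div_lt_iff₀ hδ).1 hn]⟩

theorem IsStrictlyCausal.eqOn_of_fixedPoint (hδ : 0 < δ) (hP : IsStrictlyCausal a δ P)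
    {y y' : ℝ → X} (hy : EqOn y (P y) (Ici a)) (hy' : EqOn y' (P y') (Ici a)) :
    EqOn y y' (Ici a) := by
  have hstep : ∀ n : ℕ, EqOn y y' (Ico a (a + n * δ)) := fun n => by
    induction n with
    | zero => simp
    | succ n ih =>
      intro t ht
      rw [hy ht.1, hP.succ ih ht, hy' ht.1]
  intro t ht
  obtain ⟨n, hn⟩ := exists_lt_add_natCast_mul hδ t
  exact hstep n ⟨ht, hn⟩

theorem IsStrictlyCausal.eqOn_iterate (hδ : 0 ≤ δ) (hP : IsStrictlyCausal a δ P) (y : ℝ → X)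
    {m n : ℕ} (hmn : m ≤ n) : EqOn (P^[n] y) (P^[m] y) (Ico a (a + m * δ)) := by
  have hstep : ∀ n : ℕ, EqOn (P^[n + 1] y) (P^[n] y) (Ico a (a + n * δ)) := fun n => by
    induction n with
    | zero => simp
    | succ n ih =>
      simpa only [Function.iterate_succ_apply'] using hP.succ ih
  induction n, hmn using Nat.le_induction with
  | base => exact eqOn_refl _ _
  | succ n hmn ih =>
    exact ((hstep n).mono (Ico_subset_Ico_right (by gcongr))).trans ih

theorem IsStrictlyCausal.exists_fixedPoint [TopologicalSpace X] [Nonempty X] (hδ : 0 < δ)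
    (hP : IsStrictlyCausal a δ P)
    (hcont : ∀ y, ContinuousOn y (Ici a) → ContinuousOn (P y) (Ici a)) :
    ∃ y, ContinuousOn y (Ici a) ∧ EqOn y (P y) (Ici a) := by
  let x : ℕ → ℝ → X := fun n => P^[n] fun _ => Classical.arbitrary X
  have hx : ∀ n, ContinuousOn (x n) (Ici a) := fun n => by
    induction n with
    | zero => exact continuousOn_const
    | succ n ih =>
      simp only [x, Function.iterate_succ_apply']
      exact hcont _ ih
  choose N hN using exists_lt_add_natCast_mul (a := a) hδ
  let y : ℝ → X := fun t => x (N t) t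
  have hyx : ∀ n : ℕ, EqOn y (x n) (Ico a (a + n * δ)) := fun n t ht => by
    rcases le_total n (N t) with h | h
    · exact hP.eqOn_iterate hδ.le _ h ht
    · exact (hP.eqOn_iterate hδ.le _ h ⟨ht.1, hN t⟩).symm
  refine ⟨y, fun t ht => ?_, fun t ht => ?_⟩
  · refine (hx (N t) t ht).congr_of_eventuallyEq ?_ rfl
    filter_upwards [self_mem_nhdsWithin, nhdsWithin_le_nhds (Iio_mem_nhds (hN t))] with s hs hsN
    exact hyx (N t) ⟨hs, hsN⟩
  · have ht' : t ∈ Ico a (a + (N t + 1 : ℕ) * δ) :=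
      ⟨ht, (hN t).trans_le (by push_cast; nlinarith)⟩
    rw [hyx _ ht', hP.succ (hyx (N t)) ht', ← Function.iterate_succ_apply' P]

end Causal

/-! ### Delayed evolution equations -/

section Delay

variable {E : Type*} [NormedAddCommGroup E] [NormedSpace ℝ E] {D : ℝ → E →L[ℝ] E}
  {c hm hM : ℝ} {h : ℝ → ℝ} {Φ q ξ ξ' : ℝ → E}

/-- `ξ` is a mild solution of `ξ'(t) = A ξ(t) + c ξ(t - h(t)) + q(t)`, where `A` is the generator of
`D`, with initial condition `ξ = Φ` on `[-h_M, 0]`. -/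
structure IsDelaySolution (D : ℝ → E →L[ℝ] E) (c hM : ℝ) (h : ℝ → ℝ) (Φ q ξ : ℝ → E) : Prop where
  continuousOn : ContinuousOn ξ (Ici (-hM))
  initial : EqOn ξ Φ (Icc (-hM) 0)
  duhamel : IsDuhamelSolution D (fun s => c • ξ (s - h s) + q s) ξ

/-- The operator whose fixed points are the mild solutions of the delayed equation: `Φ` on negative
times, the variation of constants formula on positive ones. Truncating the time makes it a sum of
continuous functions. -/
noncomputable def delayPicard (D : ℝ → E →L[ℝ] E) (c : ℝ) (h : ℝ → ℝ) (Φ q ξ : ℝ → E) (t : ℝ) : E :=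
  Φ (min t 0) - Φ 0 + (D (max t 0) (Φ 0) +
    ∫ s in (0 : ℝ)..max t 0, D (max t 0 - s) (c • ξ (s - h s) + q s))

theorem delayPicard_of_nonpos (hD0 : D 0 = ContinuousLinearMap.id ℝ E) {t : ℝ} (ht : t ≤ 0) :
    delayPicard D c h Φ q ξ t = Φ t := by
  simp [delayPicard, min_eq_left ht, max_eq_right ht, hD0]

theorem delayPicard_of_nonneg {t : ℝ} (ht : 0 ≤ t) :
    delayPicard D c h Φ q ξ t =
      D t (Φ 0) + ∫ s in (0 : ℝ)..t, D (t - s) (c • ξ (s - h s) + q s) := by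
  simp [delayPicard, min_eq_right ht, max_eq_left ht]

theorem isDelaySolution_iff (hD0 : D 0 = ContinuousLinearMap.id ℝ E) (hM0 : 0 ≤ hM) :
    IsDelaySolution D c hM h Φ q ξ ↔
      ContinuousOn ξ (Ici (-hM)) ∧ EqOn ξ (delayPicard D c h Φ q ξ) (Ici (-hM)) := by
  have h0 : (0 : ℝ) ∈ Icc (-hM) 0 := ⟨neg_nonpos.2 hM0, le_rfl⟩
  constructor
  · refine fun hξ => ⟨hξ.continuousOn, fun t ht => ?_⟩
    rcases le_total t 0 with ht0 | ht0
    · rw [delayPicard_of_nonpos hD0 ht0, hξ.initial ⟨ht, ht0⟩]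
    · rw [delayPicard_of_nonneg ht0, hξ.duhamel t ht0, hξ.initial h0]
  · rintro ⟨hcont, hfix⟩
    have hinit : EqOn ξ Φ (Icc (-hM) 0) := fun t ht => by
      rw [hfix ht.1, delayPicard_of_nonpos hD0 ht.2]
    refine ⟨hcont, hinit, fun t ht => ?_⟩
    rw [hfix (h0.1.trans ht), delayPicard_of_nonneg ht, hinit h0]

theorem isStrictlyCausal_delayPicard (hD0 : D 0 = ContinuousLinearMap.id ℝ E)
    (hh : ∀ t, 0 ≤ t → hm ≤ h t ∧ h t ≤ hM) :
    IsStrictlyCausal (-hM) hm (delayPicard D c h Φ q) := by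
  intro T ξ ξ' hξ t ht
  rcases le_total t 0 with ht0 | ht0
  · rw [delayPicard_of_nonpos hD0 ht0, delayPicard_of_nonpos hD0 ht0]
  rw [delayPicard_of_nonneg ht0, delayPicard_of_nonneg ht0]
  congr 1
  refine intervalIntegral.integral_congr fun s hs => ?_
  rw [uIcc_of_le ht0] at hs
  have hhs := hh s hs.1
  simp only [hξ ⟨by linarith [hs.1], (by linarith [hs.2, ht.2] : s - h s < T)⟩]

theorem IsDelaySolution.eqOn (hD0 : D 0 = ContinuousLinearMap.id ℝ E) (hm_pos : 0 < hm)
    (hh : ∀ t, 0 ≤ t → hm ≤ h t ∧ h t ≤ hM) (hξ : IsDelaySolution D c hM h Φ q ξ)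
    (hξ' : IsDelaySolution D c hM h Φ q ξ') : EqOn ξ ξ' (Ici (-hM)) := by
  have hM0 : 0 ≤ hM := hm_pos.le.trans ((hh 0 le_rfl).1.trans (hh 0 le_rfl).2)
  exact (isStrictlyCausal_delayPicard hD0 hh).eqOn_of_fixedPoint hm_pos
    ((isDelaySolution_iff hD0 hM0).1 hξ).2 ((isDelaySolution_iff hD0 hM0).1 hξ').2

theorem continuousOn_delayed {X : Type*} [TopologicalSpace X] {ξ : ℝ → X}
    (hξ : ContinuousOn ξ (Ici (-hM))) (hcont : ContinuousOn h (Ici 0))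
    (hh : ∀ t, 0 ≤ t → h t ≤ hM) : ContinuousOn (fun s => ξ (s - h s)) (Ici 0) :=
  hξ.comp (continuousOn_id.sub hcont) fun s hs => by
    simp only [mem_Ici] at hs ⊢
    linarith [hh s hs]

theorem intervalIntegrable_delayed (hξ : ContinuousOn ξ (Ici (-hM)))
    (hcont : ContinuousOn h (Ici 0)) (hh : ∀ t, 0 ≤ t → h t ≤ hM)
    (hq : ∀ T, 0 ≤ T → IntervalIntegrable q volume 0 T) (T : ℝ) (hT : 0 ≤ T) :
    IntervalIntegrable (fun s => c • ξ (s - h s) + q s) volume 0 T := by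
  have hdelayed : ContinuousOn (fun s => ξ (s - h s)) (uIcc 0 T) :=
    (continuousOn_delayed hξ hcont hh).mono (uIcc_of_le hT ▸ Icc_subset_Ici_self)
  exact (hdelayed.const_smul c).intervalIntegrable.add (hq T hT)

variable [CompleteSpace E]

theorem continuousOn_delayPicard (hD : ∀ x, Continuous fun t => D t x)
    (hξ : ContinuousOn ξ (Ici (-hM))) (hcont : ContinuousOn h (Ici 0))
    (hh : ∀ t, 0 ≤ t → h t ≤ hM) (hM0 : 0 ≤ hM) (hΦ : ContinuousOn Φ (Icc (-hM) 0))
    (hq : ∀ T, 0 ≤ T → IntervalIntegrable q volume 0 T) :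
    ContinuousOn (delayPicard D c h Φ q ξ) (Ici (-hM)) := by
  have hΦmin : ContinuousOn (fun t => Φ (min t 0)) (Ici (-hM)) :=
    hΦ.comp (by fun_prop) fun t ht => ⟨le_min ht (neg_nonpos.2 hM0), min_le_right _ _⟩
  have hconv := continuousOn_integral_apply_sub hD (intervalIntegrable_delayed hξ hcont hh hq
    (c := c))
  have hmax : MapsTo (fun t : ℝ => max t 0) (Ici (-hM)) (Ici 0) := fun t _ => le_max_right t 0
  exact (hΦmin.sub continuousOn_const).add
    (((hD (Φ 0)).continuousOn.add hconv).comp (by fun_prop) hmax)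

theorem exists_isDelaySolution (hD : ∀ x, Continuous fun t => D t x)
    (hD0 : D 0 = ContinuousLinearMap.id ℝ E) (hm_pos : 0 < hm) (hcont : ContinuousOn h (Ici 0))
    (hh : ∀ t, 0 ≤ t → hm ≤ h t ∧ h t ≤ hM) (hΦ : ContinuousOn Φ (Icc (-hM) 0))
    (hq : ∀ T, 0 ≤ T → IntervalIntegrable q volume 0 T) :
    ∃ ξ, IsDelaySolution D c hM h Φ q ξ := by
  have hM0 : 0 ≤ hM := hm_pos.le.trans ((hh 0 le_rfl).1.trans (hh 0 le_rfl).2)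
  obtain ⟨ξ, hξ⟩ := (isStrictlyCausal_delayPicard hD0 hh).exists_fixedPoint hm_pos fun ξ hξ =>
    continuousOn_delayPicard hD hξ hcont (fun t ht => (hh t ht).2) hM0 hΦ hq
  exact ⟨ξ, (isDelaySolution_iff hD0 hM0).2 hξ⟩

end Delay

/-! ### Exponential decay -/

section Decay

theorem integral_exp_le {r t : ℝ} (hr : 0 < r) :
    ∫ s in (0 : ℝ)..t, Real.exp (-r * (t - s)) ≤ r⁻¹ := by
  have hderiv : ∀ s, HasDerivAt (fun s => r⁻¹ * Real.exp (-r * (t - s)))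
      (Real.exp (-r * (t - s))) s := fun s => by
    have hlin : HasDerivAt (fun s : ℝ => -r * (t - s)) r s := by
      simpa using ((hasDerivAt_id s).const_sub t).const_mul (-r)
    exact (hlin.exp.const_mul r⁻¹).congr_deriv (by field_simp)
  rw [intervalIntegral.integral_eq_sub_of_hasDerivAt (fun s _ => hderiv s)
    (Continuous.intervalIntegrable (by fun_prop) _ _), sub_self, mul_zero, Real.exp_zero, mul_one]
  exact sub_le_self _ (by positivity)

variable {E : Type*} [NormedAddCommGroup E] [NormedSpace ℝ E] {D : ℝ → E →L[ℝ] E} {σ κ : ℝ}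

theorem norm_integral_apply_sub_le (hD : ∀ t, 0 ≤ t → ∀ x, ‖D t x‖ ≤ Real.exp (-σ * t) * ‖x‖)
    (hκ : κ < σ) {F : ℝ → E} {A t : ℝ} (ht : 0 ≤ t) (hA : 0 ≤ A)
    (hF : ∀ᵐ s, s ∈ Ioc 0 t → Real.exp (κ * s) * ‖F s‖ ≤ A) :
    Real.exp (κ * t) * ‖∫ s in (0 : ℝ)..t, D (t - s) (F s)‖ ≤ A * (σ - κ)⁻¹ := by
  have hbound : ∀ᵐ s, s ∈ Ioc 0 t →
      ‖D (t - s) (F s)‖ ≤ Real.exp (-κ * t) * A * Real.exp (-(σ - κ) * (t - s)) := by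
    filter_upwards [hF] with s hFs hs
    calc ‖D (t - s) (F s)‖
        ≤ Real.exp (-σ * (t - s)) * ‖F s‖ := hD _ (sub_nonneg.2 hs.2) _
      _ = Real.exp (-κ * t) * (Real.exp (κ * s) * ‖F s‖) * Real.exp (-(σ - κ) * (t - s)) := by
          rw [← mul_assoc, ← Real.exp_add, mul_right_comm, ← Real.exp_add]
          ring_nf
      _ ≤ Real.exp (-κ * t) * A * Real.exp (-(σ - κ) * (t - s)) := by
          gcongr
          exact hFs hs
  have hint := intervalIntegral.norm_integral_le_of_norm_le ht hbound
    (Continuous.intervalIntegrable (by fun_prop) _ _)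
  rw [intervalIntegral.integral_const_mul] at hint
  calc Real.exp (κ * t) * ‖∫ s in (0 : ℝ)..t, D (t - s) (F s)‖
      ≤ Real.exp (κ * t) * (Real.exp (-κ * t) * A *
          ∫ s in (0 : ℝ)..t, Real.exp (-(σ - κ) * (t - s))) := by gcongr
    _ = A * ∫ s in (0 : ℝ)..t, Real.exp (-(σ - κ) * (t - s)) := by
        linear_combination (A * ∫ s in (0 : ℝ)..t, Real.exp (-(σ - κ) * (t - s))) *
          exp_neg_mul_exp_mul κ t
    _ ≤ A * (σ - κ)⁻¹ := by
        gcongr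
        exact integral_exp_le (sub_pos.2 hκ)

theorem IsDuhamelSolution.exp_mul_norm_le
    (hD : ∀ t, 0 ≤ t → ∀ x, ‖D t x‖ ≤ Real.exp (-σ * t) * ‖x‖) (hκ : κ < σ) {F y : ℝ → E}
    (hy : IsDuhamelSolution D F y) {A t : ℝ} (ht : 0 ≤ t) (hA : 0 ≤ A)
    (hF : ∀ᵐ s, s ∈ Ioc 0 t → Real.exp (κ * s) * ‖F s‖ ≤ A) :
    Real.exp (κ * t) * ‖y t‖ ≤ ‖y 0‖ + A * (σ - κ)⁻¹ := by
  have hfree : Real.exp (κ * t) * ‖D t (y 0)‖ ≤ ‖y 0‖ := by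
    calc Real.exp (κ * t) * ‖D t (y 0)‖
        ≤ Real.exp (κ * t) * (Real.exp (-κ * t) * ‖y 0‖) := by
          gcongr
          exact (hD t ht _).trans (by gcongr)
      _ = ‖y 0‖ := by linear_combination ‖y 0‖ * exp_neg_mul_exp_mul κ t
  calc Real.exp (κ * t) * ‖y t‖
      ≤ Real.exp (κ * t) * (‖D t (y 0)‖ + ‖∫ s in (0 : ℝ)..t, D (t - s) (F s)‖) := by
        rw [hy t ht]
        gcongr
        exact norm_add_le _ _
    _ ≤ ‖y 0‖ + A * (σ - κ)⁻¹ := by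
        rw [mul_add]
        exact add_le_add hfree (norm_integral_apply_sub_le hD hκ ht hA hF)

variable {c hM : ℝ} {h : ℝ → ℝ}

theorem IsDelaySolution.exp_mul_norm_le_of_forall_le
    (hD : ∀ t, 0 ≤ t → ∀ x, ‖D t x‖ ≤ Real.exp (-σ * t) * ‖x‖) (hκ : 0 ≤ κ) (hκσ : κ < σ)
    (hh : ∀ t, 0 ≤ t → 0 ≤ h t ∧ h t ≤ hM) {Φ q ξ : ℝ → E}
    (hξ : IsDelaySolution D c hM h Φ q ξ) {M P t : ℝ} (ht : 0 ≤ t) (hP : 0 ≤ P)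
    (hM_le : ∀ s ∈ Icc (-hM) t, Real.exp (κ * s) * ‖ξ s‖ ≤ M)
    (hq : ∀ᵐ s, s ∈ Ioc 0 t → Real.exp (κ * s) * ‖q s‖ ≤ P) :
    Real.exp (κ * t) * ‖ξ t‖ ≤ ‖ξ 0‖ + (|c| * Real.exp (κ * hM) * M + P) * (σ - κ)⁻¹ := by
  have hM0 : 0 ≤ M := (by positivity : (0 : ℝ) ≤ _).trans
    (hM_le t ⟨by linarith [(hh 0 le_rfl).1, (hh 0 le_rfl).2], le_rfl⟩)
  refine hξ.duhamel.exp_mul_norm_le hD hκσ ht (by positivity) ?_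
  filter_upwards [hq] with s hqs hs
  obtain ⟨hs0, hsM⟩ := hh s hs.1.le
  have hdelayed : Real.exp (κ * s) * ‖ξ (s - h s)‖ ≤ Real.exp (κ * hM) * M := by
    calc Real.exp (κ * s) * ‖ξ (s - h s)‖
        = Real.exp (κ * h s) * (Real.exp (κ * (s - h s)) * ‖ξ (s - h s)‖) := by
          rw [← mul_assoc, ← Real.exp_add]
          ring_nf
      _ ≤ Real.exp (κ * hM) * M := by
          gcongr
          exact hM_le _ ⟨by linarith [hs.1], by linarith [hs.2]⟩
  calc Real.exp (κ * s) * ‖c • ξ (s - h s) + q s‖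
      ≤ Real.exp (κ * s) * (|c| * ‖ξ (s - h s)‖ + ‖q s‖) := by
        gcongr
        exact (norm_add_le _ _).trans_eq (by rw [norm_smul, Real.norm_eq_abs])
    _ = |c| * (Real.exp (κ * s) * ‖ξ (s - h s)‖) + Real.exp (κ * s) * ‖q s‖ := by ring
    _ ≤ |c| * (Real.exp (κ * hM) * M) + P := by
        gcongr
        exact hqs hs
    _ = |c| * Real.exp (κ * hM) * M + P := by ring

theorem IsDelaySolution.exp_mul_norm_le
    (hD : ∀ t, 0 ≤ t → ∀ x, ‖D t x‖ ≤ Real.exp (-σ * t) * ‖x‖) (hκ : 0 ≤ κ)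
    (hσ : 1 + 2 * (|c| * Real.exp (κ * hM)) ≤ σ - κ)
    (hh : ∀ t, 0 ≤ t → 0 ≤ h t ∧ h t ≤ hM) {Φ q ξ : ℝ → E}
    (hξ : IsDelaySolution D c hM h Φ q ξ) {M P t : ℝ} (ht : 0 ≤ t)
    (hΦ : ∀ τ ∈ Icc (-hM) 0, ‖Φ τ‖ ≤ M) (hP : 0 ≤ P)
    (hq : ∀ᵐ s, s ∈ Ioc 0 t → Real.exp (κ * s) * ‖q s‖ ≤ P) :
    Real.exp (κ * t) * ‖ξ t‖ ≤ 2 * (M + P) := by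
  have hM0 : 0 ≤ hM := (hh 0 le_rfl).1.trans (hh 0 le_rfl).2
  have h0 : (0 : ℝ) ∈ Icc (-hM) 0 := ⟨neg_nonpos.2 hM0, le_rfl⟩
  have htmem : t ∈ Icc (-hM) t := ⟨h0.1.trans ht, le_rfl⟩
  have hweighted : ContinuousOn (fun s => Real.exp (κ * s) * ‖ξ s‖) (Icc (-hM) t) :=
    (by fun_prop : Continuous fun s : ℝ => Real.exp (κ * s)).continuousOn.mul
      (hξ.continuousOn.mono Icc_subset_Ici_self).norm
  obtain ⟨s, hs, hmax⟩ := isCompact_Icc.exists_isMaxOn ⟨t, htmem⟩ hweighted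
  refine (hmax htmem).trans ?_
  set m := Real.exp (κ * s) * ‖ξ s‖
  have hm0 : 0 ≤ m := by positivity
  have hMnonneg : 0 ≤ M := (norm_nonneg _).trans (hΦ 0 h0)
  rcases le_total s 0 with hs0 | hs0
  · have hexp : Real.exp (κ * s) ≤ 1 :=
      Real.exp_le_one_iff.2 (mul_nonpos_of_nonneg_of_nonpos hκ hs0)
    have hξs : ‖ξ s‖ ≤ M := hξ.initial ⟨hs.1, hs0⟩ ▸ hΦ s ⟨hs.1, hs0⟩
    have hle : m ≤ 1 * M := mul_le_mul hexp hξs (norm_nonneg _) zero_le_one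
    linarith
  · have hg : 0 ≤ |c| * Real.exp (κ * hM) := by positivity
    have hle := hξ.exp_mul_norm_le_of_forall_le hD hκ (by linarith) hh hs0 hP
      (fun τ hτ => hmax ⟨hτ.1, hτ.2.trans hs.2⟩) (hq.mono fun τ hτ h => hτ ⟨h.1, h.2.trans hs.2⟩)
    -- the maximum is absorbed by the left-hand side, as `|c| e^{κ h_M} ≤ (σ - κ) / 2`
    have habsorb : (|c| * Real.exp (κ * hM) * m + P) * (σ - κ)⁻¹ ≤ m / 2 + P := by
      rw [mul_inv_le_iff₀ (by linarith)]
      nlinarith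
    have hξ0 : ‖ξ 0‖ ≤ M := hξ.initial h0 ▸ hΦ 0 h0
    linarith

end Decay

/-! ### Pole placement and diagonalization of the closed loop -/

/-- When `κ = ι`, the columns of this matrix are the eigenvectors, for the eigenvalues `y j`, of the
matrix `diag x + b kᵀ`, provided that the row vector `k` is normalized to have product `1` with each
of them. -/
def controlMatrix {κ ι 𝕜 : Type*} [Field 𝕜] (b x : κ → 𝕜) (y : ι → 𝕜) : Matrix κ ι 𝕜 :=
  Matrix.of fun i j => b i / (y j - x i)

theorem controlMatrix_mul {κ ι 𝕜 : Type*} [Field 𝕜] {b x : κ → 𝕜} {y : ι → 𝕜} {i : κ} {j : ι}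
    (h : y j ≠ x i) :
    controlMatrix b x y i j * y j = x i * controlMatrix b x y i j + b i := by
  have hne : y j - x i ≠ 0 := sub_ne_zero.2 h
  simp only [controlMatrix, Matrix.of_apply]
  field_simp
  ring

section Cauchy

variable {ι 𝕜 : Type*} [Fintype ι] [Field 𝕜] {x y : ι → 𝕜}

theorem eq_zero_of_forall_sum_div_sub_eq_zero (hx : Function.Injective x)
    (hy : Function.Injective y) (hxy : ∀ i j, y j ≠ x i) {z : ι → 𝕜}
    (h : ∀ i, ∑ j, z j / (y j - x i) = 0) : z = 0 := by
  classical
  have hw : ∀ j, Lagrange.nodalWeight Finset.univ y j ≠ 0 := fun j =>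
    Lagrange.nodalWeight_ne_zero hy.injOn (Finset.mem_univ j)
  -- `∑ j, z j / (t - y j)`, cleared of denominators, is a polynomial of degree `< card ι` in `t`.
  let P := Lagrange.interpolate Finset.univ y fun j => z j / Lagrange.nodalWeight Finset.univ y j
  have hP : P = 0 := by
    refine Polynomial.eq_zero_of_degree_lt_of_eval_index_eq_zero Finset.univ hx.injOn
      (Lagrange.degree_interpolate_lt _ hy.injOn) fun i _ => ?_
    have hsum : ∑ j, Lagrange.nodalWeight Finset.univ y j * (x i - y j)⁻¹ *
        (z j / Lagrange.nodalWeight Finset.univ y j) = -∑ j, z j / (y j - x i) := by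
      rw [← Finset.sum_neg_distrib]
      refine Finset.sum_congr rfl fun j _ => ?_
      rw [← neg_sub (y j), inv_neg]
      field_simp [hw j]
    rw [Lagrange.eval_interpolate_not_at_node _ fun j _ => (hxy i j).symm, hsum, h i, neg_zero,
      mul_zero]
  funext j
  have hzj : P.eval (y j) = z j / Lagrange.nodalWeight Finset.univ y j :=
    Lagrange.eval_interpolate_at_node _ hy.injOn (Finset.mem_univ j)
  rw [hP, Polynomial.eval_zero] at hzj
  exact (div_eq_zero_iff.1 hzj.symm).resolve_right (hw j)

theorem isUnit_controlMatrix [DecidableEq ι] {b : ι → 𝕜} (hb : ∀ i, b i ≠ 0)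
    (hx : Function.Injective x) (hy : Function.Injective y) (hxy : ∀ i j, y j ≠ x i) :
    IsUnit (controlMatrix b x y) := by
  refine Matrix.mulVec_injective_iff_isUnit.1 fun z z' hz => sub_eq_zero.1 ?_
  refine eq_zero_of_forall_sum_div_sub_eq_zero hx hy hxy fun i => ?_
  have hi : (controlMatrix b x y).mulVec (z - z') i = 0 := by
    rw [Matrix.mulVec_sub, sub_eq_zero.2 hz, Pi.zero_apply]
  refine (mul_eq_zero.1 (Eq.trans ?_ hi)).resolve_left (hb i)
  rw [Finset.mul_sum]
  exact Finset.sum_congr rfl fun j _ => by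
    change _ = b i / (y j - x i) * _
    ring

end Cauchy

theorem exists_pos_forall_le_abs_sub {r : ℕ → ℝ} (hr : Antitone r) {m : ℕ} {μ : ℝ}
    (hμ : μ ∈ Ioo (r (m + 1)) (r m)) : ∃ δ > 0, ∀ n, δ ≤ |μ - r n| := by
  refine ⟨min (μ - r (m + 1)) (r m - μ), lt_min (sub_pos.2 hμ.1) (sub_pos.2 hμ.2), fun n => ?_⟩
  rcases Nat.lt_or_ge m n with hn | hn
  · have hle : r n ≤ r (m + 1) := hr hn
    exact (min_le_left _ _).trans ((sub_le_sub_left hle μ).trans (le_abs_self _))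
  · have hle : r m ≤ r n := hr hn
    rw [abs_sub_comm]
    exact (min_le_right _ _).trans ((sub_le_sub_right hle μ).trans (le_abs_self _))

section ChangeOfCoordinates

variable {ι E : Type*} [Fintype ι] [DecidableEq ι] [NormedAddCommGroup E] [InnerProductSpace ℝ E]

theorem exists_continuousLinearEquiv_add_sum {e v : ι → E} (he : Orthonormal ℝ e)
    {W : Matrix ι ι ℝ} (hVW : Matrix.of (fun i j => inner ℝ (e i) (v j)) * W = 1) :
    ∃ R : E ≃L[ℝ] E, ∀ ξ, R ξ = ξ + ∑ j, inner ℝ (e j) ξ • (v j - e j) := by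
  set V : Matrix ι ι ℝ := Matrix.of fun i j => inner ℝ (e i) (v j) with hV
  let coords : E → ι → ℝ := fun x i => inner ℝ (e i) x
  let P : E →L[ℝ] E := ContinuousLinearMap.id ℝ E +
    ∑ j, (innerSL ℝ (e j)).smulRight (v j - e j)
  let Q : E →L[ℝ] E := ContinuousLinearMap.id ℝ E -
    ∑ j, (∑ i, W j i • innerSL ℝ (e i)).smulRight (v j - e j)
  have hP : ∀ ξ, P ξ = ξ + ∑ j, coords ξ j • (v j - e j) := fun ξ => by simp [P, coords]
  have hQ : ∀ x, Q x = x - ∑ j, W.mulVec (coords x) j • (v j - e j) := fun x => by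
    simp [Q, coords, Matrix.mulVec, dotProduct]
  have hshift : ∀ (z : ι → ℝ), coords (∑ j, z j • (v j - e j)) = V.mulVec z - z := fun z => by
    funext l
    simp [coords, hV, inner_sum, inner_smul_right, inner_sub_right, orthonormal_iff_ite.1 he,
      mul_sub, Matrix.mulVec, dotProduct, mul_comm]
  have hcoordsP : ∀ ξ, coords (P ξ) = V.mulVec (coords ξ) := fun ξ => by
    have : coords (P ξ) = coords ξ + coords (∑ j, coords ξ j • (v j - e j)) := by
      rw [hP]; exact funext fun i => inner_add_right _ _ _
    rw [this, hshift, add_sub_cancel]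
  have hcoordsQ : ∀ x, coords (Q x) = W.mulVec (coords x) := fun x => by
    have : coords (Q x) = coords x - coords (∑ j, W.mulVec (coords x) j • (v j - e j)) := by
      rw [hQ]; exact funext fun i => inner_sub_right _ _ _
    rw [this, hshift, Matrix.mulVec_mulVec, hVW, Matrix.one_mulVec, sub_sub_cancel]
  refine ⟨ContinuousLinearEquiv.equivOfInverse P Q (fun ξ => ?_) (fun x => ?_), hP⟩
  · rw [hQ, hcoordsP, Matrix.mulVec_mulVec, mul_eq_one_comm.1 hVW, Matrix.one_mulVec, hP,
      add_sub_cancel_right]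
  · rw [hP, hcoordsQ, hQ, sub_add_cancel]

end ChangeOfCoordinates

/-- The pairs `(p, q)` for which `⟪p, ξ⟫' = ⟪q, ξ⟫ + ⟪p, f⟫` on `ℝ₊`. They encode the evolution
equation `ξ' = A ξ + f`, which makes `(p, A† p)` such a pair for every `p` in the domain of `A†`. -/
def weakEquations {E : Type*} [NormedAddCommGroup E] [InnerProductSpace ℝ E] (ξ f : ℝ → E) :
    Submodule ℝ (E × E) where
  carrier := {p | ∀ T, 0 ≤ T → IsPrimitiveOn (fun t => inner ℝ p.1 (ξ t))
    (fun s => inner ℝ p.2 (ξ s) + inner ℝ p.1 (f s)) 0 T}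
  zero_mem' T _ := by
    simpa using IsPrimitiveOn.of_hasDerivAt (hasDerivAt_const · (0 : ℝ)) continuous_const
  add_mem' hp hq T hT := by
    refine (((hp T hT).add (hq T hT)).congr_left fun t _ => ?_).congr_right
      (ae_of_all _ fun s _ => ?_)
    · exact (inner_add_left _ _ _).symm
    · simp only [Prod.fst_add, Prod.snd_add, inner_add_left]
      ring
  smul_mem' s p hp T hT := by
    refine (((hp T hT).const_mul s).congr_left fun t _ => ?_).congr_right
      (ae_of_all _ fun s _ => ?_)
    · exact (real_inner_smul_left _ _ _).symm
    · simp only [Prod.smul_fst, Prod.smul_snd, real_inner_smul_left]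
      ring

theorem mem_weakEquations_iff {E : Type*} [NormedAddCommGroup E] [InnerProductSpace ℝ E]
    {ξ f : ℝ → E} {p : E × E} : p ∈ weakEquations ξ f ↔ ∀ T, 0 ≤ T →
      IsPrimitiveOn (fun t => inner ℝ p.1 (ξ t))
        (fun s => inner ℝ p.2 (ξ s) + inner ℝ p.1 (f s)) 0 T :=
  Iff.rfl

theorem forall_mem_submodule_iff_of_leftInverse {𝕜 G : Type*} [Ring 𝕜] [AddCommGroup G]
    [Module 𝕜 G] {N : ℕ} {V : Matrix ℕ (Fin N) 𝕜} {W : Matrix (Fin N) (Fin N) 𝕜}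
    (hWV : W * V.submatrix Fin.val id = 1) {x ψ : ℕ → G}
    (hx : ∀ n, x n = ∑ j : Fin N, V n j • ψ j + if n < N then 0 else ψ n) (M : Submodule 𝕜 G) :
    (∀ n, x n ∈ M) ↔ ∀ n, ψ n ∈ M := by
  have hsum : (∀ j : Fin N, ψ j ∈ M) → ∀ n, ∑ j : Fin N, V n j • ψ j ∈ M := fun h n =>
    M.sum_mem fun j _ => M.smul_mem _ (h j)
  refine ⟨fun h => ?_, fun h n => ?_⟩
  · have hψ : ∀ j : Fin N, ψ j = ∑ i : Fin N, W j i • x i := fun j => by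
      calc ψ j = ∑ l : Fin N, (W * V.submatrix Fin.val id : Matrix _ (Fin N) 𝕜) j l • ψ l := by
            simp [hWV, Matrix.one_apply]
        _ = ∑ i : Fin N, W j i • x i := by
            simp only [hx, Fin.is_lt, if_true, add_zero, Matrix.mul_apply, Matrix.submatrix_apply,
              id_eq, Finset.sum_smul, Finset.smul_sum, mul_smul]
            exact Finset.sum_comm
    have hlow : ∀ j : Fin N, ψ j ∈ M := fun j => by
      rw [hψ j]
      exact M.sum_mem fun i _ => M.smul_mem _ (h i)
    intro n
    by_cases hn : n < N
    · exact hlow ⟨n, hn⟩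
    · have := M.sub_mem (h n) (hsum hlow n)
      rwa [hx n, if_neg hn, add_sub_cancel_left] at this
  · rw [hx n]
    refine M.add_mem (hsum (fun j => h j) n) ?_
    split_ifs
    exacts [M.zero_mem, h n]

/-- The spectrum of the closed loop: the first `N` values of `r` are replaced by `μ`. -/
noncomputable def closedLoopRate {N : ℕ} (r : ℕ → ℝ) (μ : Fin N → ℝ) (n : ℕ) : ℝ :=
  if h : n < N then μ ⟨n, h⟩ else r n

section ClosedLoop

variable {E : Type*} [NormedAddCommGroup E] [InnerProductSpace ℝ E] {N : ℕ}

/-- In the coordinates `ξ` given by `x = R ξ`, the system `x_n' = r_n x_n + β_n u + (R f)_n` of the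
modes of `x` with respect to `B`, closed by the feedback `u = ∑ i, g i * x_i`, is the diagonal
system `ξ_n' = ν_n ξ_n + f_n`. -/
def DiagonalizesClosedLoop (B : HilbertBasis ℕ ℝ E) (r β : ℕ → ℝ) (g : Fin N → ℝ) (ν : ℕ → ℝ)
    (R : E ≃L[ℝ] E) : Prop :=
  ∀ ξ f : ℝ → E,
    (∀ n T, 0 ≤ T → IsPrimitiveOn (fun t => inner ℝ (B n) (ξ t))
      (fun s => ν n * inner ℝ (B n) (ξ s) + inner ℝ (B n) (f s)) 0 T) ↔
    ∀ n T, 0 ≤ T → IsPrimitiveOn (fun t => inner ℝ (B n) (R (ξ t)))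
      (fun s => r n * inner ℝ (B n) (R (ξ s)) + (β n * ∑ i : Fin N, g i * inner ℝ (B i) (R (ξ s)) +
        inner ℝ (B n) (R (f s)))) 0 T

variable {B : HilbertBasis ℕ ℝ E} {r β : ℕ → ℝ} {g μ : Fin N → ℝ} {R : E ≃L[ℝ] E}
  {W : Matrix (Fin N) (Fin N) ℝ}

theorem inner_add_sum_eq (B : HilbertBasis ℕ ℝ E) {v : Fin N → E} (ξ : E) (n : ℕ) :
    inner ℝ (B n) (ξ + ∑ j : Fin N, inner ℝ (B j) ξ • (v j - B j)) =
      inner ℝ (∑ j : Fin N, inner ℝ (B n) (v j) • B j + if n < N then 0 else B n) ξ := by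
  have hdelta : ∑ j : Fin N, (if n = j then inner ℝ (B j) ξ else 0) =
      if n < N then inner ℝ (B n) ξ else 0 := by
    split_ifs with hn
    · rw [Finset.sum_eq_single_of_mem (⟨n, hn⟩ : Fin N) (Finset.mem_univ _) fun j _ hj =>
        if_neg fun h => hj (Fin.ext h.symm), if_pos rfl]
    · exact Finset.sum_eq_zero fun j _ => if_neg (by rintro rfl; exact hn j.2)
  simp only [inner_add_right, inner_sum, inner_smul_right, inner_sub_right,
    orthonormal_iff_ite.1 B.orthonormal, mul_sub, Finset.sum_sub_distrib, mul_ite, mul_one,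
    mul_zero, hdelta, inner_add_left, sum_inner, real_inner_smul_left]
  rw [Finset.sum_congr rfl fun j _ => mul_comm (inner ℝ (B n) (v j)) _]
  split_ifs
  · rw [inner_zero_left]; ring
  · ring

theorem diagonalizesClosedLoop (hμ : ∀ n j, μ j ≠ r n)
    (hWV : W * (controlMatrix β r μ).submatrix Fin.val id = 1)
    (hg : Matrix.vecMul g ((controlMatrix β r μ).submatrix Fin.val id) = 1)
    (hR : ∀ ξ n, inner ℝ (B n) (R ξ) =
      inner ℝ (∑ j : Fin N, controlMatrix β r μ n j • B j + if n < N then 0 else B n) ξ) :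
    DiagonalizesClosedLoop B r β g (closedLoopRate r μ) R := by
  intro ξ f
  set V := controlMatrix β r μ
  have hVμ : ∀ n j, V n j * μ j = r n * V n j + β n := fun n j => controlMatrix_mul (hμ n j)
  have hgV : ∀ j, ∑ i : Fin N, g i * V i j = 1 := congrFun hg
  let rowVec : ℕ → E := fun n => ∑ j : Fin N, V n j • B j + if n < N then 0 else B n
  have hRrow : ∀ ξ n, inner ℝ (B n) (R ξ) = inner ℝ (rowVec n) ξ := hR
  have hfeedback : ∀ s, ∑ i : Fin N, g i * inner ℝ (rowVec i) (ξ s) =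
      inner ℝ (∑ j : Fin N, B j) (ξ s) := fun s => by
    simp only [rowVec, Fin.is_lt, if_true, add_zero, sum_inner, real_inner_smul_left,
      Finset.mul_sum]
    rw [Finset.sum_comm]
    refine Finset.sum_congr rfl fun j _ => ?_
    simp only [← mul_assoc, ← Finset.sum_mul, hgV, one_mul]
  have hrow : ∀ n, (rowVec n, r n • rowVec n + β n • ∑ j : Fin N, B j) =
      ∑ j : Fin N, V n j • (B j, closedLoopRate r μ j • B j) +
        if n < N then 0 else (B n, closedLoopRate r μ n • B n) := fun n => by
    have hsnd : r n • ∑ j : Fin N, V n j • B j + β n • ∑ j : Fin N, B j =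
        ∑ j : Fin N, V n j • closedLoopRate r μ j • B j := by
      simp only [Finset.smul_sum, smul_smul, ← Finset.sum_add_distrib, ← add_smul, closedLoopRate,
        Fin.is_lt, dif_pos, Fin.eta, hVμ]
    by_cases hn : n < N
    · simp [rowVec, hn, hsnd, Prod.ext_iff, Prod.fst_sum, Prod.snd_sum]
    · have hrate : closedLoopRate r μ n = r n := dif_neg hn
      simp [rowVec, hn, ← hsnd, Prod.ext_iff, Prod.fst_sum, Prod.snd_sum, hrate, add_right_comm]
  have hiff := forall_mem_submodule_iff_of_leftInverse
    (ψ := fun n => (B n, closedLoopRate r μ n • B n)) hWV hrow (weakEquations ξ f)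
  simp only [mem_weakEquations_iff, inner_add_left, real_inner_smul_left, add_assoc] at hiff
  simp only [hRrow, hfeedback]
  exact hiff.symm

theorem exists_inner_eq_div [CompleteSpace E] {ι : Type*} (B : HilbertBasis ι ℝ E) {r : ι → ℝ}
    {μ δ : ℝ} (hδ : 0 < δ) (hμ : ∀ n, δ ≤ |μ - r n|) (ℓ α : E) :
    ∃ v, ∀ n, inner ℝ (B n) v = (inner ℝ (B n) α - r n * inner ℝ (B n) ℓ) / (μ - r n) := by
  obtain ⟨T, hT, -⟩ := exists_diagonal B (m := fun n => (μ - r n)⁻¹) (inv_nonneg.2 hδ.le)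
    fun n => by rw [abs_inv]; exact inv_anti₀ hδ (hμ n)
  refine ⟨ℓ + T (α - μ • ℓ), fun n => ?_⟩
  have hne : μ - r n ≠ 0 := abs_pos.1 (hδ.trans_le (hμ n))
  rw [inner_add_right, hT, inner_sub_right, inner_smul_right]
  field_simp
  ring

theorem exists_diagonalizesClosedLoop [CompleteSpace E] (B : HilbertBasis ℕ ℝ E)
    (hr : StrictAnti r) {ℓ α : E} (hβ : ∀ n, β n = inner ℝ (B n) α - r n * inner ℝ (B n) ℓ)
    (hβ0 : ∀ n, β n ≠ 0) (m : ℕ) :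
    ∃ (g : Fin (m + 1) → ℝ) (ν : ℕ → ℝ) (R : E ≃L[ℝ] E), (∀ n, ν n ≤ r m) ∧
      DiagonalizesClosedLoop B r β g ν R := by
  have hinf : (Ioo (r (m + 1)) (r m)).Infinite := Ioo_infinite (hr m.lt_succ_self)
  let μ : Fin (m + 1) → ℝ := fun j => hinf.natEmbedding _ j
  have hμ : ∀ j, μ j ∈ Ioo (r (m + 1)) (r m) := fun j => Subtype.prop _
  have hμ_inj : Function.Injective μ :=
    Subtype.val_injective.comp ((hinf.natEmbedding _).injective.comp Fin.val_injective)
  choose δ hδ hδμ using fun j => exists_pos_forall_le_abs_sub hr.antitone (hμ j)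
  have hμr : ∀ n j, μ j ≠ r n := fun n j =>
    sub_ne_zero.1 (abs_pos.1 ((hδ j).trans_le (hδμ j n)))
  choose v hv using fun j => exists_inner_eq_div B (hδ j) (hδμ j) ℓ α
  have hvV : ∀ n j, inner ℝ (B n) (v j) = controlMatrix β r μ n j := fun n j => by
    rw [hv, ← hβ]; rfl
  obtain ⟨⟨V, W, hVW, hWV⟩, rfl : V = (controlMatrix β r μ).submatrix Fin.val id⟩ :=
    isUnit_controlMatrix (fun i : Fin (m + 1) => hβ0 i) (hr.injective.comp Fin.val_injective)
      hμ_inj fun i j => hμr i j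
  obtain ⟨R, hR⟩ := exists_continuousLinearEquiv_add_sum (e := fun i : Fin (m + 1) => B i)
    (v := v) (W := W) (B.orthonormal.comp _ Fin.val_injective)
    (by simp only [hvV]; exact hVW)
  refine ⟨Matrix.vecMul 1 W, closedLoopRate r μ, R, fun n => ?_,
    diagonalizesClosedLoop hμr hWV ?_ fun ξ n => ?_⟩
  · unfold closedLoopRate
    split_ifs with hn
    · exact (hμ _).2.le
    · exact hr.antitone (by omega)
  · rw [Matrix.vecMul_vecMul, hWV, Matrix.vecMul_one]
  · simp only [hR, inner_add_sum_eq, hvV]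

end ClosedLoop

/-! ### Boundary control through one channel -/

/-- The first of the two control channels, the only one that the feedback uses. -/
noncomputable def firstInput : U := EuclideanSpace.single 0 1

theorem lift_smul (θ₁ θ₂ : ℝ) (k : ℕ) (s : ℝ) (u : U) :
    lift θ₁ θ₂ k (s • u) = s • lift θ₁ θ₂ k u := by
  rw [lift, lift, ← MemLp.toLp_const_smul]
  refine MemLp.toLp_congr _ _ (ae_of_all _ fun x => ?_)
  simp only [liftFun, PiLp.smul_apply, smul_eq_mul, Pi.smul_apply]
  ring

theorem hasDerivAt_one_sub_pow (n : ℕ) (x : ℝ) :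
    HasDerivAt (fun x : ℝ => (1 - x) ^ n) (-(n * (1 - x) ^ (n - 1))) x := by
  exact (((hasDerivAt_id x).const_sub 1).pow n).congr_deriv (by simp)

theorem exists_isH2Rep_lift_firstInput (θ₁ θ₂ : ℝ) (k : ℕ) :
    ∃ w, IsH2Rep (lift θ₁ θ₂ k firstInput)
      (fun x => (Real.cos θ₁ + k * Real.sin θ₁)⁻¹ * (1 - x) ^ k)
      (fun x => (Real.cos θ₁ + k * Real.sin θ₁)⁻¹ * -(k * (1 - x) ^ (k - 1))) w := by
  set d := (Real.cos θ₁ + k * Real.sin θ₁)⁻¹ with hd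
  have hcont : Continuous fun x : ℝ =>
      d * -(k * -(((k - 1 : ℕ) : ℝ) * (1 - x) ^ (k - 1 - 1))) := by fun_prop
  have hLp := memLp_of_continuousOn hcont.continuousOn
  refine ⟨hLp.toLp, isH2Rep_of_hasDerivAt (fun x => (hasDerivAt_one_sub_pow k x).const_mul d)
    (fun x => (((hasDerivAt_one_sub_pow (k - 1) x).const_mul (k : ℝ)).neg).const_mul d) hcont ?_
    hLp.coeFn_toLp⟩
  filter_upwards [(memLp_liftFun θ₁ θ₂ k firstInput).coeFn_toLp] with x hx
  rw [lift, hx, liftFun]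
  simp [firstInput, hd, div_eq_inv_mul]

theorem opA_smul (a b : ℝ) {f : H} (hf : MemH2 f) (s : ℝ) : opA a b (s • f) = s • opA a b f := by
  obtain ⟨φ, φ', w, h⟩ := hf
  rw [opA_eq a b h, opA_eq a b (h.smul s)]
  module

theorem opA_lift_smul_firstInput (a b θ₁ θ₂ : ℝ) (k : ℕ) (s : ℝ) :
    opA a b (lift θ₁ θ₂ k (s • firstInput)) = s • opA a b (lift θ₁ θ₂ k firstInput) := by
  obtain ⟨w, hw⟩ := exists_isH2Rep_lift_firstInput θ₁ θ₂ k
  rw [lift_smul, opA_smul a b ⟨_, _, w, hw⟩]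

/-- The coefficient `β_n` with which a scalar control `q`, applied through the first channel, enters
the equation `x_n' = (λ_n - c) x_n + β_n q` of the `n`-th mode of the state. -/
noncomputable def inputCoeff (a b c θ₁ θ₂ : ℝ) (k : ℕ) (lam : ℕ → ℝ) (e : ℕ → H) (n : ℕ) : ℝ :=
  inner ℝ (e n) (opA a b (lift θ₁ θ₂ k firstInput)) -
    (lam n - c) * inner ℝ (e n) (lift θ₁ θ₂ k firstInput)

theorem IsEigensystem.inputCoeff_ne_zero {a b c θ₁ θ₂ : ℝ} {lam : ℕ → ℝ} {e : ℕ → H}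
    (he : IsEigensystem a b c θ₁ θ₂ lam e) (ha : a ≠ 0) {k : ℕ} (hk : 2 ≤ k)
    (hk₁ : Real.cos θ₁ + k * Real.sin θ₁ ≠ 0) (n : ℕ) :
    inputCoeff a b c θ₁ θ₂ k lam e n ≠ 0 := by
  obtain ⟨w, hw⟩ := exists_isH2Rep_lift_firstInput θ₁ θ₂ k
  obtain ⟨ψ, ψ', hψ, hψ₀, -⟩ := he.hasLaplacian ha n
  obtain ⟨r, hr, hψr, hψr'⟩ := hψ.exists_cauchy_data hψ₀ ((he.orthonormal ha).ne_zero n)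
  -- By Green's formula, the coefficient is the Cauchy datum of the eigenfunction at `0`.
  have hgreen : inner ℝ w (e n) - (lam n - b - c) / a * inner ℝ (lift θ₁ θ₂ k firstInput) (e n) =
      (Real.cos θ₁ + k * Real.sin θ₁)⁻¹ * (Real.cos θ₁ + k * Real.sin θ₁) * r := by
    rw [← real_inner_smul_right, hw.green_formula hψ, hψr, hψr']
    simp only [sub_self, sub_zero, one_pow, zero_pow (by omega : k ≠ 0),
      zero_pow (by omega : k - 1 ≠ 0)]
    ring
  have hcoeff : inputCoeff a b c θ₁ θ₂ k lam e n = a * r := by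
    have hrate : lam n - c = a * ((lam n - b - c) / a) + b := by field_simp; ring
    rw [inv_mul_cancel₀ hk₁, one_mul, real_inner_comm, real_inner_comm (e n)] at hgreen
    rw [inputCoeff, opA_eq a b hw, inner_add_right, inner_smul_right, inner_smul_right, hrate]
    linear_combination a * hgreen
  rw [hcoeff]
  exact mul_ne_zero ha hr

theorem feedback_eq (e : ℕ → H) {N : ℕ} (g : Fin N → ℝ) (X : ℝ → H) :
    feedback e (Matrix.of ![g, 0]) X =
      fun t => (∑ i : Fin N, g i * inner ℝ (e i) (X t)) • firstInput := by
  ext t i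
  fin_cases i <;>
    simp [feedback, modes, firstInput, Matrix.toEuclideanLin, dotProduct, real_inner_comm]

theorem absolutelyContinuousOnInterval_smul_iff {E : Type*} [NormedAddCommGroup E]
    [NormedSpace ℝ E] {u : E} (hu : ‖u‖ = 1) {q : ℝ → ℝ} {s t : ℝ} :
    AbsolutelyContinuousOnInterval (fun t => q t • u) s t ↔
      AbsolutelyContinuousOnInterval q s t := by
  have hdist : ∀ x y, dist (q x • u) (q y • u) = dist (q x) (q y) := fun x y => by
    rw [dist_eq_norm, ← sub_smul, norm_smul, hu, mul_one, dist_eq_norm]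
  simp only [absolutelyContinuousOnInterval_iff, hdist]

theorem IsDuhamelSolution.congr {E : Type*} [NormedAddCommGroup E] [NormedSpace ℝ E]
    {S D : ℝ → E →L[ℝ] E} (hSD : ∀ t, 0 ≤ t → S t = D t) {F y : ℝ → E} :
    IsDuhamelSolution S F y ↔ IsDuhamelSolution D F y := by
  refine forall₂_congr fun t ht => ?_
  rw [hSD t ht, intervalIntegral.integral_congr (g := fun s => D (t - s) (F s))]
  intro s hs
  rw [uIcc_of_le ht] at hs
  simp only [hSD _ (sub_nonneg.2 hs.2)]

/-- The forcing term of the equation for `X - q ℓ`, where `ℓ` is the lift of `firstInput`, when the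
scalar control `q` is applied through the first channel and `f` is the forcing term of `X`. -/
noncomputable def liftedForcing (a b θ₁ θ₂ : ℝ) (k : ℕ) (q : ℝ → ℝ) (f : ℝ → H) (s : ℝ) : H :=
  q s • opA a b (lift θ₁ θ₂ k firstInput) - deriv q s • lift θ₁ θ₂ k firstInput + f s

section BoundaryControl

variable {a b c θ₁ θ₂ : ℝ} {k : ℕ} {S : ℝ → H →L[ℝ] H} {hM : ℝ} {Φ p X : ℝ → H} {h q : ℝ → ℝ}

theorem isMildSolution_smul_firstInput_iff (hM0 : 0 ≤ hM) :
    IsMildSolution a b c θ₁ θ₂ k S hM Φ p h (fun t => q t • firstInput) X ↔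
      ContinuousOn X (Ici 0) ∧ EqOn X Φ (Icc (-hM) 0) ∧
        (∀ T, 0 ≤ T → AbsolutelyContinuousOnInterval q 0 T) ∧
        IsDuhamelSolution S (liftedForcing a b θ₁ θ₂ k q fun s => c • X (s - h s) + p s)
          (fun t => X t - q t • lift θ₁ θ₂ k firstInput) := by
  have hac : ∀ T, AbsolutelyContinuousOnInterval (fun t => q t • firstInput) 0 T ↔
      AbsolutelyContinuousOnInterval q 0 T := fun T =>
    absolutelyContinuousOnInterval_smul_iff (by simp [firstInput])
  have hduhamel (hX : EqOn X Φ (Icc (-hM) 0))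
      (hq : ∀ T, 0 ≤ T → AbsolutelyContinuousOnInterval q 0 T) (t : ℝ) (ht : 0 ≤ t) :
      X t = S t (Φ 0 - lift θ₁ θ₂ k (q 0 • firstInput)) + lift θ₁ θ₂ k (q t • firstInput) +
        ∫ s in (0 : ℝ)..t, S (t - s) (opA a b (lift θ₁ θ₂ k (q s • firstInput)) -
          lift θ₁ θ₂ k (deriv (fun t => q t • firstInput) s) + c • X (s - h s) + p s) ↔
      X t - q t • lift θ₁ θ₂ k firstInput = S t (X 0 - q 0 • lift θ₁ θ₂ k firstInput) +
        ∫ s in (0 : ℝ)..t, S (t - s)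
          (liftedForcing a b θ₁ θ₂ k q (fun s => c • X (s - h s) + p s) s) := by
    rw [lift_smul, lift_smul, hX ⟨neg_nonpos.2 hM0, le_rfl⟩, add_right_comm, ← sub_eq_iff_eq_add,
      intervalIntegral.integral_congr_ae]
    filter_upwards [(hq t ht).ae_differentiableAt] with s hs hst
    rw [deriv_smul_const (hs (uIoc_subset_uIcc hst)), opA_lift_smul_firstInput, lift_smul,
      liftedForcing, add_assoc]
  constructor
  · intro hX
    have hq : ∀ T, 0 ≤ T → AbsolutelyContinuousOnInterval q 0 T := fun T hT =>
      (hac T).1 (hX.ac_input T hT)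
    exact ⟨hX.continuousOn, hX.initial, hq, fun t ht =>
      (hduhamel hX.initial hq t ht).1 (hX.duhamel t ht)⟩
  · rintro ⟨hcont, hinit, hq, hX⟩
    exact ⟨hcont, fun T hT => (hac T).2 (hq T hT), hinit, fun t ht =>
      (hduhamel hinit hq t ht).2 (hX t ht)⟩

theorem intervalIntegrable_liftedForcing {f : ℝ → H} {T : ℝ}
    (hq : AbsolutelyContinuousOnInterval q 0 T) (hf : IntervalIntegrable f volume 0 T) :
    IntervalIntegrable (liftedForcing a b θ₁ θ₂ k q f) volume 0 T := by
  have hqα : IntervalIntegrable (fun s => q s • opA a b (lift θ₁ θ₂ k firstInput)) volume 0 T :=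
    (hq.continuousOn.smul continuousOn_const).intervalIntegrable
  have hqℓ : IntervalIntegrable (fun s => deriv q s • lift θ₁ θ₂ k firstInput) volume 0 T :=
    ⟨hq.intervalIntegrable_deriv.1.smul_const _, hq.intervalIntegrable_deriv.2.smul_const _⟩
  exact (hqα.sub hqℓ).add hf

theorem isPrimitiveOn_lifted_mode_iff {lam : ℕ → ℝ} {e : ℕ → H} {f : ℝ → H} {T : ℝ}
    (hq : AbsolutelyContinuousOnInterval q 0 T) (n : ℕ) :
    IsPrimitiveOn (fun t => inner ℝ (e n) (X t - q t • lift θ₁ θ₂ k firstInput))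
      (fun s => (lam n - c) * inner ℝ (e n) (X s - q s • lift θ₁ θ₂ k firstInput) +
        inner ℝ (e n) (liftedForcing a b θ₁ θ₂ k q f s)) 0 T ↔
    IsPrimitiveOn (fun t => inner ℝ (e n) (X t)) (fun s => (lam n - c) * inner ℝ (e n) (X s) +
      (inputCoeff a b c θ₁ θ₂ k lam e n * q s + inner ℝ (e n) (f s))) 0 T := by
  rw [← ((IsPrimitiveOn.of_absolutelyContinuousOnInterval hq).const_mul
    (inner ℝ (e n) (lift θ₁ θ₂ k firstInput))).add_iff]
  congr! 2 with t s <;>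
  · simp only [liftedForcing, inputCoeff, inner_sub_right, inner_add_right, inner_smul_right]
    ring

theorem IsGeneratedByA₀.isDuhamelSolution_lifted_iff (hS : IsGeneratedByA₀ a b θ₁ θ₂ S)
    {lam : ℕ → ℝ} {e : ℕ → H} (he : IsEigensystem a b c θ₁ θ₂ lam e) {B : HilbertBasis ℕ ℝ H}
    (hB : ⇑B = e) {f : ℝ → H} (hf : ∀ T, 0 ≤ T → IntervalIntegrable f volume 0 T)
    (hq : ∀ T, 0 ≤ T → AbsolutelyContinuousOnInterval q 0 T) :
    IsDuhamelSolution S (liftedForcing a b θ₁ θ₂ k q f)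
      (fun t => X t - q t • lift θ₁ θ₂ k firstInput) ↔
    ∀ n T, 0 ≤ T → IsPrimitiveOn (fun t => inner ℝ (B n) (X t))
      (fun s => (lam n - c) * inner ℝ (B n) (X s) +
        (inputCoeff a b c θ₁ θ₂ k lam e n * q s + inner ℝ (B n) (f s))) 0 T := by
  obtain ⟨D, hD⟩ := exists_isDiagSemigroup B fun n =>
    sub_le_sub_right (he.strictAnti.antitone n.zero_le) c
  rw [IsDuhamelSolution.congr fun t ht => hS.eq_of_isDiagSemigroup he hB hD ht,
    hD.isDuhamelSolution_iff fun T hT => intervalIntegrable_liftedForcing (hq T hT) (hf T hT), hB]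
  exact forall₃_congr fun n T hT => isPrimitiveOn_lifted_mode_iff (hq T hT) n

end BoundaryControl

/-! ### The closed loop -/

theorem MemLinftyLoc.intervalIntegrable {p : ℝ → H} (hp : MemLinftyLoc p) (T : ℝ) (hT : 0 ≤ T) :
    IntervalIntegrable p volume 0 T := by
  rw [intervalIntegrable_iff_integrableOn_Icc_of_le hT]
  exact (hp T hT).integrable le_top

theorem MemLinftyLoc.clm_apply {p : ℝ → H} (hp : MemLinftyLoc p) (Q : H →L[ℝ] H) :
    MemLinftyLoc fun t => Q (p t) :=
  fun T hT => Q.comp_memLp' (hp T hT)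

theorem continuousOn_Ici_of_eqOn_Icc {E : Type*} [NormedAddCommGroup E] {X Φ : ℝ → E} {s t : ℝ}
    (hst : s ≤ t) (hX : ContinuousOn X (Ici t)) (hΦ : ContinuousOn Φ (Icc s t))
    (hXΦ : EqOn X Φ (Icc s t)) : ContinuousOn X (Ici s) := by
  rw [← Icc_union_Ici_eq_Ici hst]
  exact (hΦ.congr hXΦ).union_of_isClosed hX isClosed_Icc isClosed_Ici

section ClosedLoop

variable {a b c θ₁ θ₂ : ℝ} {k : ℕ} {S : ℝ → H →L[ℝ] H} {lam : ℕ → ℝ} {e : ℕ → H}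
  {B : HilbertBasis ℕ ℝ H} {N : ℕ} {g : Fin N → ℝ} {ν : ℕ → ℝ} {w : ℝ} {R : H ≃L[ℝ] H}
  {D : ℝ → H →L[ℝ] H} {hM : ℝ} {Φ p X : ℝ → H} {h : ℝ → ℝ}

theorem isDuhamelSolution_closedLoop_iff (hS : IsGeneratedByA₀ a b θ₁ θ₂ S)
    (he : IsEigensystem a b c θ₁ θ₂ lam e) (hB : ⇑B = e)
    (hR : DiagonalizesClosedLoop B (fun n => lam n - c) (inputCoeff a b c θ₁ θ₂ k lam e) g ν R)
    (hD : IsDiagSemigroup B ν w D) {f : ℝ → H}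
    (hf : ∀ T, 0 ≤ T → IntervalIntegrable f volume 0 T) {q : ℝ → ℝ}
    (hq : ∀ t, q t = ∑ i : Fin N, g i * inner ℝ (B i) (X t)) :
    ((∀ T, 0 ≤ T → AbsolutelyContinuousOnInterval q 0 T) ∧
      IsDuhamelSolution S (liftedForcing a b θ₁ θ₂ k q f)
        (fun t => X t - q t • lift θ₁ θ₂ k firstInput)) ↔
    IsDuhamelSolution D (fun t => R.symm (f t)) (fun t => R.symm (X t)) := by
  obtain rfl : q = fun t => ∑ i : Fin N, g i * inner ℝ (B i) (X t) := funext hq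
  have hRf : ∀ T, 0 ≤ T → IntervalIntegrable (fun t => R.symm (f t)) volume 0 T := fun T hT =>
    ⟨R.symm.integrable_comp_iff.2 (hf T hT).1, R.symm.integrable_comp_iff.2 (hf T hT).2⟩
  have hmodes := hR (fun t => R.symm (X t)) fun t => R.symm (f t)
  simp only [ContinuousLinearEquiv.apply_symm_apply] at hmodes
  rw [hD.isDuhamelSolution_iff hRf, hmodes]
  constructor
  · rintro ⟨hac, hX⟩
    exact (hS.isDuhamelSolution_lifted_iff he hB hf hac).1 hX
  · intro hX
    have hac := fun T hT => (IsPrimitiveOn.sum Finset.univ fun (i : Fin N) _ =>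
      (hX i T hT).const_mul (g i)).absolutelyContinuousOnInterval
    exact ⟨hac, (hS.isDuhamelSolution_lifted_iff he hB hf hac).2 hX⟩

theorem isMildSolution_feedback_iff (hS : IsGeneratedByA₀ a b θ₁ θ₂ S)
    (he : IsEigensystem a b c θ₁ θ₂ lam e) (hB : ⇑B = e)
    (hR : DiagonalizesClosedLoop B (fun n => lam n - c) (inputCoeff a b c θ₁ θ₂ k lam e) g ν R)
    (hD : IsDiagSemigroup B ν w D) (hM0 : 0 ≤ hM) (hcont : ContinuousOn h (Ici 0))
    (hh : ∀ t, 0 ≤ t → h t ≤ hM) (hΦ : ContinuousOn Φ (Icc (-hM) 0)) (hp : MemLinftyLoc p) :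
    IsMildSolution a b c θ₁ θ₂ k S hM Φ p h (feedback e (Matrix.of ![g, 0]) X) X ↔
      IsDelaySolution D c hM h (fun t => R.symm (Φ t)) (fun t => R.symm (p t))
        (fun t => R.symm (X t)) := by
  have hduhamel (hX : ContinuousOn X (Ici (-hM))) := isDuhamelSolution_closedLoop_iff
    (X := X) (q := fun t => ∑ i : Fin N, g i * inner ℝ (B i) (X t)) hS he hB hR hD
    (intervalIntegrable_delayed (c := c) hX hcont hh hp.intervalIntegrable) fun _ => rfl
  simp only [map_add, map_smul] at hduhamel
  rw [feedback_eq, ← hB, isMildSolution_smul_firstInput_iff hM0]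
  constructor
  · rintro ⟨hX0, hinit, hX⟩
    have hX_cont := continuousOn_Ici_of_eqOn_Icc (neg_nonpos.2 hM0) hX0 hΦ hinit
    exact ⟨R.symm.continuous.comp_continuousOn hX_cont, hinit.comp_left, (hduhamel hX_cont).1 hX⟩
  · intro hξ
    have hX_cont : ContinuousOn X (Ici (-hM)) :=
      (R.continuous.comp_continuousOn hξ.continuousOn).congr fun t _ => by simp
    exact ⟨hX_cont.mono (Ici_subset_Ici.2 (neg_nonpos.2 hM0)),
      fun τ hτ => R.symm.injective (hξ.initial hτ), (hduhamel hX_cont).2 hξ.duhamel⟩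

end ClosedLoop

theorem IsEigensystem.exists_diagonalizesClosedLoop {a b c θ₁ θ₂ : ℝ} {lam : ℕ → ℝ} {e : ℕ → H}
    (he : IsEigensystem a b c θ₁ θ₂ lam e) (ha : 0 < a) {k : ℕ} (hk : 2 ≤ k)
    (hk₁ : Real.cos θ₁ + k * Real.sin θ₁ ≠ 0) {B : HilbertBasis ℕ ℝ H} (hB : ⇑B = e) (σ : ℝ) :
    ∃ (m : ℕ) (g : Fin (m + 1) → ℝ) (ν : ℕ → ℝ) (R : H ≃L[ℝ] H), (∀ n, ν n ≤ -σ) ∧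
      DiagonalizesClosedLoop B (fun n => lam n - c) (inputCoeff a b c θ₁ θ₂ k lam e) g ν R := by
  obtain ⟨m, hm⟩ := he.exists_lam_lt ha (c - σ)
  obtain ⟨g, ν, R, hν, hR⟩ := DelayRD.exists_diagonalizesClosedLoop B
    (fun i j hij => sub_lt_sub_right (he.strictAnti hij) c) (fun n => by rw [hB]; rfl)
    (he.inputCoeff_ne_zero ha.ne' hk hk₁) m
  exact ⟨m, g, ν, R, fun n => (hν n).trans (by linarith), hR⟩

/-! ### The fading memory estimate -/

section FadingMemory

variable {p : ℝ → H} {κ t : ℝ}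

theorem MemLinftyLoc.ae_le_essSup_fading (hp : MemLinftyLoc p) (hκ : 0 ≤ κ) (ht : 0 ≤ t) :
    ∀ᵐ τ ∂volume.restrict (Icc 0 t), Real.exp (-κ * (t - τ)) * ‖p τ‖ ≤
      essSup (fun τ => Real.exp (-κ * (t - τ)) * ‖p τ‖) (volume.restrict (Icc 0 t)) := by
  have hlt : eLpNormEssSup p (volume.restrict (Icc 0 t)) < ⊤ := by
    simpa only [eLpNorm_exponent_top] using (hp t ht).2
  refine ae_le_essSup (isBoundedUnder_of_eventually_le
    (a := (eLpNormEssSup p (volume.restrict (Icc 0 t))).toReal) ?_)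
  filter_upwards [ae_le_eLpNormEssSup (f := p) (μ := volume.restrict (Icc 0 t)),
    ae_restrict_mem measurableSet_Icc] with τ hpτ hτ
  have hexp : Real.exp (-κ * (t - τ)) ≤ 1 :=
    Real.exp_le_one_iff.2 (by nlinarith [hτ.2])
  calc Real.exp (-κ * (t - τ)) * ‖p τ‖ ≤ ‖p τ‖ := mul_le_of_le_one_left (norm_nonneg _) hexp
    _ ≤ _ := by
      rw [← toReal_enorm]
      exact ENNReal.toReal_mono hlt.ne hpτ

theorem MemLinftyLoc.essSup_fading_nonneg (hp : MemLinftyLoc p) (hκ : 0 ≤ κ) (ht : 0 ≤ t) :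
    0 ≤ essSup (fun τ => Real.exp (-κ * (t - τ)) * ‖p τ‖) (volume.restrict (Icc 0 t)) := by
  rcases ht.eq_or_lt with rfl | ht_pos
  · simp [essSup, limsup, limsSup]
  · have : NeZero (volume.restrict (Icc 0 t)) := ⟨by simpa using ht_pos⟩
    obtain ⟨τ, hτ⟩ := (hp.ae_le_essSup_fading hκ ht).exists
    exact (by positivity : (0 : ℝ) ≤ _).trans hτ

theorem MemLinftyLoc.ae_exp_mul_norm_le (hp : MemLinftyLoc p) (hκ : 0 ≤ κ) (ht : 0 ≤ t) :
    ∀ᵐ s, s ∈ Ioc 0 t → Real.exp (κ * s) * ‖p s‖ ≤ Real.exp (κ * t) *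
      essSup (fun τ => Real.exp (-κ * (t - τ)) * ‖p τ‖) (volume.restrict (Icc 0 t)) := by
  filter_upwards [(ae_restrict_iff' measurableSet_Icc).1 (hp.ae_le_essSup_fading hκ ht)]
    with s hps hs
  calc Real.exp (κ * s) * ‖p s‖
      = Real.exp (κ * t) * (Real.exp (-κ * (t - s)) * ‖p s‖) := by
        rw [← mul_assoc, ← Real.exp_add]
        ring_nf
    _ ≤ _ := by
        gcongr
        exact hps (Ioc_subset_Icc_self hs)

theorem norm_le_iSup_of_continuousOn {E : Type*} [SeminormedAddCommGroup E] {Φ : ℝ → E} {s t τ : ℝ}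
    (hΦ : ContinuousOn Φ (Icc s t)) (hτ : τ ∈ Icc s t) : ‖Φ τ‖ ≤ ⨆ τ : Icc s t, ‖Φ τ‖ := by
  obtain ⟨C, hC⟩ := isCompact_Icc.exists_bound_of_continuousOn hΦ
  exact le_ciSup (f := fun τ : Icc s t => ‖Φ τ‖) ⟨C, forall_mem_range.2 fun x => hC x x.2⟩ ⟨τ, hτ⟩

theorem IsDelaySolution.norm_apply_le_fadingBound {D : ℝ → H →L[ℝ] H} {c hM σ : ℝ} {h : ℝ → ℝ}
    {Φ ξ : ℝ → H} {R Q : H →L[ℝ] H}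
    (hξ : IsDelaySolution D c hM h (fun t => Q (Φ t)) (fun t => Q (p t)) ξ)
    (hD : ∀ t, 0 ≤ t → ∀ x, ‖D t x‖ ≤ Real.exp (-σ * t) * ‖x‖) (hκ : 0 ≤ κ)
    (hσ : 1 + 2 * (|c| * Real.exp (κ * hM)) ≤ σ - κ) (hh : ∀ t, 0 ≤ t → 0 ≤ h t ∧ h t ≤ hM)
    (hΦ : ContinuousOn Φ (Icc (-hM) 0)) (hp : MemLinftyLoc p) (ht : 0 ≤ t) :
    ‖R (ξ t)‖ ≤ fadingBound hM κ (2 * ‖R‖ * ‖Q‖) (2 * ‖R‖ * ‖Q‖) Φ p t := by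
  set M := ⨆ τ : Icc (-hM) 0, ‖Φ τ‖
  set L := essSup (fun τ => Real.exp (-κ * (t - τ)) * ‖p τ‖) (volume.restrict (Icc 0 t))
  have hL : 0 ≤ L := hp.essSup_fading_nonneg hκ ht
  have hQΦ : ∀ τ ∈ Icc (-hM) 0, ‖Q (Φ τ)‖ ≤ ‖Q‖ * M := fun τ hτ =>
    Q.le_opNorm_of_le (norm_le_iSup_of_continuousOn hΦ hτ)
  have hQp : ∀ᵐ s, s ∈ Ioc 0 t → Real.exp (κ * s) * ‖Q (p s)‖ ≤ ‖Q‖ * (Real.exp (κ * t) * L) := by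
    filter_upwards [hp.ae_exp_mul_norm_le hκ ht] with s hps hs
    calc Real.exp (κ * s) * ‖Q (p s)‖ ≤ Real.exp (κ * s) * (‖Q‖ * ‖p s‖) := by
          gcongr
          exact Q.le_opNorm _
      _ = ‖Q‖ * (Real.exp (κ * s) * ‖p s‖) := by ring
      _ ≤ _ := mul_le_mul_of_nonneg_left (hps hs) (norm_nonneg _)
  have hweighted := hξ.exp_mul_norm_le hD hκ hσ hh ht hQΦ (by positivity) hQp
  have hexp := exp_neg_mul_exp_mul κ t
  calc ‖R (ξ t)‖ ≤ ‖R‖ * ‖ξ t‖ := R.le_opNorm _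
    _ = ‖R‖ * Real.exp (-κ * t) * (Real.exp (κ * t) * ‖ξ t‖) := by
        linear_combination (-‖R‖ * ‖ξ t‖) * hexp
    _ ≤ ‖R‖ * Real.exp (-κ * t) * (2 * (‖Q‖ * M + ‖Q‖ * (Real.exp (κ * t) * L))) := by gcongr
    _ = fadingBound hM κ (2 * ‖R‖ * ‖Q‖) (2 * ‖R‖ * ‖Q‖) Φ p t := by
        unfold fadingBound
        linear_combination (2 * ‖R‖ * ‖Q‖ * L) * hexp

end FadingMemory

theorem norm_modes_le {e : ℕ → H} (he : Orthonormal ℝ e) (N : ℕ) (x : H) : ‖modes e N x‖ ≤ ‖x‖ := by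
  refine le_of_sq_le_sq ?_ (norm_nonneg _)
  rw [EuclideanSpace.norm_sq_eq]
  simpa only [modes, real_inner_comm, Function.comp_apply] using
    (he.comp _ Fin.val_injective).sum_inner_products_le x (s := (Finset.univ : Finset (Fin N)))

theorem norm_feedback_le {e : ℕ → H} (he : Orthonormal ℝ e) {N : ℕ} (K : Matrix (Fin 2) (Fin N) ℝ)
    (X : ℝ → H) (t : ℝ) : ‖feedback e K X t‖ ≤ matNorm K * ‖X t‖ :=
  ((Matrix.toEuclideanLin K).toContinuousLinearMap).le_opNorm_of_le (norm_modes_le he N (X t))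

theorem norm_feedback_le_fadingBound {e : ℕ → H} (he : Orthonormal ℝ e) {N : ℕ}
    (K : Matrix (Fin 2) (Fin N) ℝ) {X Φ p : ℝ → H} {hM κ C₀ C₁ t : ℝ}
    (hX : ‖X t‖ ≤ fadingBound hM κ C₀ C₁ Φ p t) :
    ‖feedback e K X t‖ ≤ fadingBound hM κ (C₀ * matNorm K) (C₁ * matNorm K) Φ p t :=
  calc ‖feedback e K X t‖ ≤ matNorm K * ‖X t‖ := norm_feedback_le he K X t
    _ ≤ matNorm K * fadingBound hM κ C₀ C₁ Φ p t :=
        mul_le_mul_of_nonneg_left hX (norm_nonneg _)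
    _ = fadingBound hM κ (C₀ * matNorm K) (C₁ * matNorm K) Φ p t := by
        simp only [fadingBound]
        ring

end DelayRD

theorem mainTheorem2 (a b c θ₁ θ₂ : ℝ) (ha : 0 < a) (hc : c ≠ 0)
    (hθ₁ : θ₁ ∈ Ico 0 (2 * Real.pi)) (hθ₂ : θ₂ ∈ Ico 0 (2 * Real.pi))
    (k : ℕ) (hk : 2 ≤ k) (hk₁ : Real.cos θ₁ + k * Real.sin θ₁ ≠ 0)
    (hk₂ : Real.cos θ₂ + k * Real.sin θ₂ ≠ 0)
    (hm hM κ : ℝ) (hm_pos : 0 < hm) (hm_lt : hm < hM) (hκ : 0 < κ) :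
    (∃ S, IsGeneratedByA₀ a b θ₁ θ₂ S) ∧
    (∃ lam e, IsEigensystem a b c θ₁ θ₂ lam e) ∧
    ∀ S, IsGeneratedByA₀ a b θ₁ θ₂ S →
    ∀ lam e, IsEigensystem a b c θ₁ θ₂ lam e →
      ∃ N₀ : ℕ, 1 ≤ N₀ ∧ ∃ (K : Matrix (Fin 2) (Fin N₀) ℝ) (C₀ C₁ : ℝ), 0 < C₀ ∧ 0 < C₁ ∧
        ∀ (Φ p : ℝ → H) (h : ℝ → ℝ), ContinuousOn Φ (Icc (-hM) 0) → MemLinftyLoc p →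
          ContinuousOn h (Ici 0) → (∀ t, 0 ≤ t → hm ≤ h t ∧ h t ≤ hM) →
          ∃ X : ℝ → H,
            IsMildSolution a b c θ₁ θ₂ k S hM Φ p h (feedback e K X) X ∧
            (∀ X' : ℝ → H, IsMildSolution a b c θ₁ θ₂ k S hM Φ p h (feedback e K X') X' →
              EqOn X' X (Ici (-hM))) ∧
            ∀ t : ℝ, 0 ≤ t →
              ‖X t‖ ≤ fadingBound hM κ C₀ C₁ Φ p t ∧
              ‖feedback e K X t‖ ≤
                fadingBound hM κ (C₀ * matNorm K) (C₁ * matNorm K) Φ p t := by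
  refine ⟨exists_isGeneratedByA₀ ha b θ₁ θ₂, exists_isEigensystem ha b c θ₁ θ₂,
    fun S hS lam e he => ?_⟩
  obtain ⟨B, hB⟩ := he.exists_hilbertBasis ha.ne'
  obtain ⟨m, g, ν, R, hν, hR⟩ := he.exists_diagonalizesClosedLoop ha hk hk₁ hB
    (κ + (1 + 2 * (|c| * Real.exp (κ * hM))))
  obtain ⟨D, hD⟩ := exists_isDiagSemigroup B hν
  have : Nontrivial H := ⟨e 0, 0, (he.orthonormal ha.ne').ne_zero 0⟩
  have hC : 0 < 2 * ‖(R : H →L[ℝ] H)‖ * ‖(R.symm : H →L[ℝ] H)‖ :=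
    mul_pos (mul_pos two_pos R.norm_pos) R.symm.norm_pos
  refine ⟨m + 1, m.succ_pos, Matrix.of ![g, 0], _, _, hC, hC, fun Φ p h hΦ hp hcont hh => ?_⟩
  have hiff (X : ℝ → H) := isMildSolution_feedback_iff (X := X) hS he hB hR hD
    (hm_pos.trans hm_lt).le hcont (fun t ht => (hh t ht).2) hΦ hp
  obtain ⟨ξ, hξ⟩ : ∃ ξ,
      IsDelaySolution D c hM h (fun t => R.symm (Φ t)) (fun t => R.symm (p t)) ξ :=
    exists_isDelaySolution hD.continuous_apply hD.zero hm_pos hcont hh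
      (R.symm.continuous.comp_continuousOn hΦ) (hp.clm_apply R.symm).intervalIntegrable
  have hX := (hiff fun t => R (ξ t)).2 (by simpa only [R.symm_apply_apply] using hξ)
  refine ⟨_, hX, fun X' hX' t ht => R.symm.injective
    (((hiff X').1 hX').eqOn hD.zero hm_pos hh ((hiff _).1 hX) ht), fun t ht => ?_⟩
  have hbound := hξ.norm_apply_le_fadingBound (R := R) (Q := R.symm) hD.norm_apply_le_of_nonneg
    hκ.le (by linarith) (fun s hs => ⟨hm_pos.le.trans (hh s hs).1, (hh s hs).2⟩) hΦ hp ht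
  exact ⟨hbound, norm_feedback_le_fadingBound (he.orthonormal ha.ne') _ hbound⟩
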